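/- Let $d\in\mathbb N$, $s>1/2$ and $\chi\in\operatorname{Sp}(d,\mathbb R)$, the group of real symplectic $2d\times 2d$ matrices acting on $(x,\xi)\in\mathbb R^{2d}$. **Spaces.** $\Sigma_s(\mathbb R^d)$ is the space of all $f\in C^\infty(\mathbb R^d)$ such that $$\|f\|_{s,h}=\sup_{\alpha,\beta\in\mathbb N^d,\;x\in\mathbb R^d}\frac{|x^\alpha\partial^\beta f(x)|}{h^{|\alpha+\beta|}\,\alpha!^s\,\beta!^s}<\infty\quad\text{for all } h>0,$$ with the topology defined by the norms $\|\cdot\|_{s,h}$, $h>0$. $\Sigma_s'(\mathbb R^d)$ is its topological dual, and $\Sigma_s(\mathbb R^d)$ is embedded in $\Sigma_s'(\mathbb R^d)$ by letting $f$ act as $g\mapsto\int_{\mathbb R^d} f(x)g(x)\,dx$. **Metaplectic operators.** For $a\in\mathscr S(\mathbb R^{2d})$ and $f\in L^2(\mathbb R^d)$ let $$a^w(x,D)f(x)=(2\pi)^{-d}\iint_{\mathbb R^{2d}}e^{i\langle x-y,\xi\rangle}\,a\Big(\frac{x+y}{2},\xi\Big)f(y)\,dy\,d\xi$$ be the Weyl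 quantization. A metaplectic operator $\mu(\chi)$ is a unitary operator on $L^2(\mathbb R^d)$ such that $$\mu(\chi)^{-1}a^w(x,D)\,\mu(\chi)=(a\circ\chi)^w(x,D)\quad\text{for all } a\in\mathscr S(\mathbb R^{2d}).$$ **Proposition.** Such an operator $\mu(\chi)$ exists, and every such operator $\mu(\chi)$ maps $\Sigma_s(\mathbb R^d)$ into itself, is continuous on $\Sigma_s(\mathbb R^d)$, and the restriction of $\mu(\chi)$ to $\Sigma_s(\mathbb R^d)$ extends uniquely to a continuous linear operator on $\Sigma_s'(\mathbb R^d)$. The existence and the uniqueness of the extension hold both when $\Sigma_s'(\mathbb R^d)$ carries the strong dual topology and when it carries the weak-$*$ topology. -/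

import Mathlib

open MeasureTheory SchwartzMap
open scoped SchwartzMap

noncomputable section

namespace Metaplectic

/-- Configuration space `ℝ^d` with its Euclidean structure. -/
abbrev Space (d : ℕ) : Type := EuclideanSpace ℝ (Fin d)

/-- Phase space `T^*ℝ^d = ℝ^{2d}`; the summand `inl` holds the position `x`, the summand `inr` the
covariable `ξ`. -/
abbrev Phase (d : ℕ) : Type := EuclideanSpace ℝ (Fin d ⊕ Fin d)

/-- The point `(x, ξ)` of phase space. -/
def phasePoint {d : ℕ} (x ξ : Space d) : Phase d :=
  WithLp.toLp 2 (Sum.elim x.ofLp ξ.ofLp)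

/-- The Hilbert space `L²(ℝ^d)` (complex valued, Lebesgue measure). -/
abbrev L2 (d : ℕ) : Type := Lp ℂ 2 (volume : Measure (Space d))

/-! ### Gelfand–Shilov spaces of Beurling type -/

/-- The monomial `x^α`. -/
def monomial {d : ℕ} (α : Fin d → ℕ) (x : Space d) : ℝ := ∏ i, x i ^ α i

/-- `|α| = α_1 + ⋯ + α_d`. -/
def order {d : ℕ} (α : Fin d → ℕ) : ℕ := ∑ i, α i

/-- `α! = α_1! ⋯ α_d!`. -/
def factorial {d : ℕ} (α : Fin d → ℕ) : ℕ := ∏ i, (α i).factorial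

/-- The partial derivative `∂^β = ∂_1^{β_1} ⋯ ∂_d^{β_d}` on smooth rapidly decreasing functions. -/
def partialDeriv {d : ℕ} (β : Fin d → ℕ) : 𝓢(Space d, ℂ) →L[ℂ] 𝓢(Space d, ℂ) :=
  ((List.finRange d).map fun i =>
    LineDeriv.lineDerivOpCLM ℂ 𝓢(Space d, ℂ) (EuclideanSpace.single i (1 : ℝ)) ^ β i).prod

/-- The quotient `|x^α ∂^β f(x)| / (h^{|α+β|} α!^s β!^s)`. -/
def gsQuot {d : ℕ} (s h : ℝ) (f : 𝓢(Space d, ℂ))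
    (p : (Fin d → ℕ) × (Fin d → ℕ) × Space d) : ℝ :=
  ‖(monomial p.1 p.2.2 : ℂ) * partialDeriv p.2.1 f p.2.2‖ /
    (h ^ order (p.1 + p.2.1) * (factorial p.1 : ℝ) ^ s * (factorial p.2.1 : ℝ) ^ s)

lemma gsDenom_pos {d : ℕ} (s : ℝ) {h : ℝ} (hh : 0 < h) (α β : Fin d → ℕ) :
    0 < h ^ order (α + β) * (factorial α : ℝ) ^ s * (factorial β : ℝ) ^ s := by
  have key : ∀ γ : Fin d → ℕ, (0 : ℝ) < (factorial γ : ℝ) := fun γ => by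
    have : 0 < factorial γ := Finset.prod_pos fun i _ => Nat.factorial_pos _
    exact_mod_cast this
  have h1 := Real.rpow_pos_of_pos (key α) s
  have h2 := Real.rpow_pos_of_pos (key β) s
  positivity

lemma gsQuot_nonneg {d : ℕ} (s : ℝ) {h : ℝ} (hh : 0 < h) (f : 𝓢(Space d, ℂ))
    (p : (Fin d → ℕ) × (Fin d → ℕ) × Space d) : 0 ≤ gsQuot s h f p :=
  div_nonneg (norm_nonneg _) (gsDenom_pos s hh _ _).le

lemma gsQuot_add {d : ℕ} (s : ℝ) {h : ℝ} (hh : 0 < h) (f g : 𝓢(Space d, ℂ))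
    (p : (Fin d → ℕ) × (Fin d → ℕ) × Space d) :
    gsQuot s h (f + g) p ≤ gsQuot s h f p + gsQuot s h g p := by
  unfold gsQuot
  rw [← add_div]
  refine div_le_div_of_nonneg_right ?_ (gsDenom_pos s hh _ _).le
  rw [map_add, add_apply, mul_add]
  exact norm_add_le _ _

lemma gsQuot_smul {d : ℕ} (s h : ℝ) (c : ℂ) (f : 𝓢(Space d, ℂ))
    (p : (Fin d → ℕ) × (Fin d → ℕ) × Space d) :
    gsQuot s h (c • f) p = ‖c‖ * gsQuot s h f p := by
  unfold gsQuot
  rw [map_smul, smul_apply, smul_eq_mul, mul_left_comm, norm_mul, mul_div_assoc]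

/-- The functions `f` with
`‖f‖_{s,h} = sup |x^α ∂^β f(x)| / (h^{|α+β|} α!^s β!^s) < ∞` for all `h > 0`, as a subspace of the
Schwartz space.  (A smooth function with these bounds is rapidly decreasing together with all its
derivatives, so nothing is lost by looking for it in the Schwartz space.) -/
def gsSubmodule (s : ℝ) (d : ℕ) : Submodule ℂ 𝓢(Space d, ℂ) where
  carrier := {f | ∀ h : ℝ, 0 < h → BddAbove (Set.range (gsQuot s h f))}
  zero_mem' := by
    intro h _
    refine ⟨0, ?_⟩
    rintro _ ⟨p, rfl⟩
    simp [gsQuot]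
  add_mem' := by
    intro f g hf hg h hh
    obtain ⟨A, hA⟩ := hf h hh
    obtain ⟨B, hB⟩ := hg h hh
    refine ⟨A + B, ?_⟩
    rintro _ ⟨p, rfl⟩
    exact (gsQuot_add s hh f g p).trans (add_le_add (hA ⟨p, rfl⟩) (hB ⟨p, rfl⟩))
  smul_mem' := by
    intro c f hf h hh
    obtain ⟨A, hA⟩ := hf h hh
    refine ⟨‖c‖ * A, ?_⟩
    rintro _ ⟨p, rfl⟩
    rw [gsQuot_smul]
    exact mul_le_mul_of_nonneg_left (hA ⟨p, rfl⟩) (norm_nonneg c)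

/-- The Gelfand–Shilov space `Σ_s(ℝ^d)` of Beurling type.  It is a type of its own because its
topology is finer than the one induced by the Schwartz space. -/
def GelfandShilov (s : ℝ) (d : ℕ) : Type := gsSubmodule s d

instance (s : ℝ) (d : ℕ) : AddCommGroup (GelfandShilov s d) :=
  inferInstanceAs (AddCommGroup (gsSubmodule s d))

instance (s : ℝ) (d : ℕ) : Module ℂ (GelfandShilov s d) :=
  inferInstanceAs (Module ℂ (gsSubmodule s d))

/-- The inclusion of `Σ_s(ℝ^d)` in the Schwartz space. -/
def GelfandShilov.toSchwartz {s : ℝ} {d : ℕ} : GelfandShilov s d →ₗ[ℂ] 𝓢(Space d, ℂ) :=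
  (gsSubmodule s d).subtype

/-- The norm `‖f‖_{s,h}` as a seminorm on `Σ_s(ℝ^d)`, for `h > 0`. -/
def gsSeminorm (s : ℝ) (d : ℕ) (h : {h : ℝ // 0 < h}) : Seminorm ℂ (GelfandShilov s d) :=
  Seminorm.of (fun f => ⨆ p, gsQuot s h f.toSchwartz p)
    (by
      intro f g
      refine ciSup_le fun p => ?_
      rw [map_add]
      exact (gsQuot_add s h.2 _ _ p).trans
        (add_le_add (le_ciSup (f.2 h h.2) p) (le_ciSup (g.2 h h.2) p)))
    (by
      intro c f
      rw [map_smul, Real.mul_iSup_of_nonneg (norm_nonneg c)]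
      exact congrArg iSup (funext fun p => gsQuot_smul s h c f.toSchwartz p))

/-- `Σ_s(ℝ^d)` carries the projective limit topology, defined by the seminorms `‖·‖_{s,h}`,
`h > 0`. -/
instance (s : ℝ) (d : ℕ) : TopologicalSpace (GelfandShilov s d) :=
  (SeminormFamily.moduleFilterBasis (𝕜 := ℂ) (gsSeminorm s d)).topology

lemma withSeminorms_gsSeminorm (s : ℝ) (d : ℕ) :
    WithSeminorms (𝕜 := ℂ) (gsSeminorm s d) := ⟨rfl⟩

instance (s : ℝ) (d : ℕ) : IsTopologicalAddGroup (GelfandShilov s d) :=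
  (withSeminorms_gsSeminorm s d).topologicalAddGroup

instance (s : ℝ) (d : ℕ) : ContinuousSMul ℂ (GelfandShilov s d) :=
  (withSeminorms_gsSeminorm s d).continuousSMul

/-- The inclusion of `Σ_s(ℝ^d)` in `L²(ℝ^d)`. -/
def GelfandShilov.toL2 {s : ℝ} {d : ℕ} (f : GelfandShilov s d) : L2 d := f.toSchwartz.toLp 2

/-! ### The dual space -/

lemma norm_le_gsSeminorm {s : ℝ} {d : ℕ} (g : GelfandShilov s d) (x : Space d) :
    ‖g.toSchwartz x‖ ≤ gsSeminorm s d ⟨1, one_pos⟩ g := by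
  have h := le_ciSup (g.2 1 one_pos) (0, 0, x)
  have e : gsQuot s 1 g.toSchwartz (0, 0, x) = ‖g.toSchwartz x‖ := by
    have hd : partialDeriv (0 : Fin d → ℕ) = 1 := by
      unfold partialDeriv
      exact List.prod_eq_one (by simp)
    simp [gsQuot, hd, monomial, factorial]
  rw [← e]
  exact h

lemma integrable_mul {s : ℝ} {d : ℕ} (f g : GelfandShilov s d) :
    Integrable (fun x => f.toSchwartz x * g.toSchwartz x) := by
  refine (f.toSchwartz.integrable).mul_bdd (c := gsSeminorm s d ⟨1, one_pos⟩ g)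
    g.toSchwartz.continuous.aestronglyMeasurable ?_
  exact Filter.Eventually.of_forall fun x => norm_le_gsSeminorm g x

/-- The distribution dual `Σ_s'(ℝ^d)`: the continuous linear functionals on `Σ_s(ℝ^d)`, with the
strong topology (uniform convergence on bounded sets). -/
abbrev GSDist (s : ℝ) (d : ℕ) : Type := StrongDual ℂ (GelfandShilov s d)

/-- The same space of functionals with the weak-* topology (pointwise convergence). -/
abbrev GSDistWeak (s : ℝ) (d : ℕ) : Type := GelfandShilov s d →Lₚₜ[ℂ] ℂ

/-- The bilinear pairing `g ↦ ∫ f g dx` on `Σ_s(ℝ^d)`. -/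
def pairing {s : ℝ} {d : ℕ} (f : GelfandShilov s d) : GelfandShilov s d →ₗ[ℂ] ℂ where
  toFun g := ∫ x, f.toSchwartz x * g.toSchwartz x
  map_add' g k := by
    rw [← integral_add (integrable_mul f g) (integrable_mul f k)]
    simp [mul_add]
  map_smul' c g := by
    simp only [map_smul, smul_apply, smul_eq_mul, RingHom.id_apply]
    rw [← integral_const_mul]
    exact integral_congr_ae (Filter.Eventually.of_forall fun x => mul_left_comm _ _ _)

lemma norm_pairing_le {s : ℝ} {d : ℕ} (f g : GelfandShilov s d) :
    ‖pairing f g‖ ≤ (∫ x, ‖f.toSchwartz x‖) * gsSeminorm s d ⟨1, one_pos⟩ g := by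
  refine (norm_integral_le_integral_norm _).trans ?_
  rw [← integral_mul_const]
  refine integral_mono (integrable_mul f g).norm
    (f.toSchwartz.integrable.norm.mul_const _) fun x => ?_
  rw [norm_mul]
  exact mul_le_mul_of_nonneg_left (norm_le_gsSeminorm g x) (norm_nonneg _)

/-- The embedding `Σ_s(ℝ^d) ⊆ Σ_s'(ℝ^d)`: the function `f` acts as `g ↦ ∫ f g dx`. -/
def toDist {s : ℝ} {d : ℕ} (f : GelfandShilov s d) : GSDist s d where
  toLinearMap := pairing f
  cont := by
    refine (withSeminorms_gsSeminorm s d).continuous_normedSpace_rng ℂ (pairing f)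
      ⟨{⟨1, one_pos⟩}, ⟨∫ x, ‖f.toSchwartz x‖, integral_nonneg fun x => norm_nonneg _⟩, ?_⟩
    intro g
    rw [Finset.sup_singleton]
    exact norm_pairing_le f g

/-- The same embedding into the dual with the weak-* topology. -/
def toDistWeak {s : ℝ} {d : ℕ} (f : GelfandShilov s d) : GSDistWeak s d :=
  ContinuousLinearMap.toPointwiseConvergenceCLM ℂ (RingHom.id ℂ) (GelfandShilov s d) ℂ (toDist f)

/-! ### Weyl quantization and metaplectic operators -/

/-- The Weyl quantization
`a^w(x,D) f(x) = (2π)^{-d} ∬ e^{i⟨x-y,ξ⟩} a((x+y)/2, ξ) f(y) dy dξ`.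
For a Schwartz symbol `a` and `f ∈ L²(ℝ^d)` the integral converges absolutely for every `x`, and
the resulting function is again in `L²(ℝ^d)`. -/
def weylOp {d : ℕ} (a : Phase d → ℂ) (f : Space d → ℂ) (x : Space d) : ℂ :=
  ((2 * Real.pi : ℝ) : ℂ) ^ (-(d : ℤ)) *
    ∫ ξ : Space d, ∫ y : Space d,
      Complex.exp (Complex.I * (inner ℝ (x - y) ξ : ℝ)) *
        a (phasePoint ((1 / 2 : ℝ) • (x + y)) ξ) * f y

/-- The linear map of phase space with matrix `χ`. -/
def phaseMap {d : ℕ} (χ : Matrix (Fin d ⊕ Fin d) (Fin d ⊕ Fin d) ℝ) (z : Phase d) : Phase d :=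
  WithLp.toLp 2 (χ.mulVec z.ofLp)

/-- `U` is a metaplectic operator for the symplectic matrix `χ`: it is unitary on `L²(ℝ^d)` and
`U⁻¹ a^w(x,D) U = (a ∘ χ)^w(x,D)` for all Schwartz symbols `a`.  The identity of operators is
written as the equality of their graphs, `g = (a ∘ χ)^w f ↔ U g = a^w (U f)`. -/
def IsMetaplectic {d : ℕ} (χ : Matrix.symplecticGroup (Fin d) ℝ) (U : L2 d ≃ₗᵢ[ℂ] L2 d) : Prop :=
  ∀ (a : 𝓢(Phase d, ℂ)) (f g : L2 d),
    (g =ᵐ[volume] weylOp (fun z => a (phaseMap χ.1 z)) f) ↔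
      (U g =ᵐ[volume] weylOp a (U f))

end Metaplectic

end

/-! Everything is reduced to the Weyl operators W(z) (`weyl`), the phase space translations on L².
They satisfy W(z)W(w) = exp(iσ(z,w)/2) W(z+w) with σ = `sform`, and the substitution z = (x+y, 2ξ)
turns the Weyl quantization into (4π)^{-d} ∫ a(z/2) W(z)P dz, where P is the parity
(`weylOp_ae_eq`). Varying the symbol a, the metaplectic identity forces U W(z) = W(χz) U
(`IsMetaplectic.intertwines`); conversely this relation together with UP = PU gives the metaplectic
identity.

Existence follows von Neumann's proof of uniqueness of the Schrödinger representation. For a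
symplectic M the operator Q_M = ∫ exp(-|z|²/4) W(Mz) dz (`gproj`) satisfies Q_M W(Mz) Q_M = c
exp(-|z|²/4) Q_M (`gproj_weyl_gproj`). With φ the Gaussian and g = Q_M φ ≠ 0, suitably normalized,
the vectors W(Mz)g have the same Gram matrix as the vectors W(z)φ. Both families are total
(`eq_zero_of_inner_weyl_eq_zero`), so W(z)φ ↦ W(Mz)g extends to a unitary operator
(`exists_intertwines`).

Continuity on Σ_s comes from the coherent states W(z)φ. Superpositions ∫ F(z) W(z)φ dz lie in Σ_s
when F decays faster than exp(-r|z|^{1/s}) for every r; here s > 1/2 enters, because the derivatives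
of a Gaussian grow like √(n!) (`exists_gelfandShilov_integral_coherent`). Conversely, matrix
coefficients ⟨W(z)g, f⟩ with f, g in Σ_s have that decay (`exists_norm_coeff_mul_gsExp_le`). Since
Q_id is a multiple of the projection on φ, there is a reproducing formula, up to a constant Uf = ∫
⟨W(z)φ, Uf⟩ W(z)φ dz, whose coefficients equal ⟨W(M⁻¹z)U⁻¹φ, f⟩. The vector U⁻¹φ is a multiple of
Q_{M⁻¹}φ, a superposition with Gaussian coefficients, hence in Σ_s. So Uf lies in Σ_s, with seminorm
estimates (`Intertwines.exists_continuousLinearMap`).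

For the dual, the transpose of U under ∫fg is k ↦ conj(U⁻¹ conj k). It intertwines Weyl operators as
well, so it acts on Σ_s, and composing functionals with it gives the extension for both topologies.
Uniqueness is density of Σ_s in the strong dual (`denseRange_toDist`). Truncating the coherent state
expansion of the argument to a ball of radius R turns a functional into the pairing with an element
of Σ_s, by the Riesz theorem, and the error is at most C/R times one fixed seminorm, hence uniform
on bounded sets. -/

namespace Metaplectic

/-! ### Phase space, the symplectic form and the Weyl operators. -/

noncomputable section

open Complex (I)
open scoped ComplexConjugate InnerProductSpace

variable {d : ℕ}

/-! ### Phase space -/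

/-- The position component of a point of phase space. -/
def pos : Phase d →L[ℝ] Space d :=
  LinearMap.toContinuousLinearMap
    { toFun := fun z => WithLp.toLp 2 fun i => z (Sum.inl i)
      map_add' := fun _ _ => by ext; simp
      map_smul' := fun _ _ => by ext; simp }

/-- The momentum component of a point of phase space. -/
def mom : Phase d →L[ℝ] Space d :=
  LinearMap.toContinuousLinearMap
    { toFun := fun z => WithLp.toLp 2 fun i => z (Sum.inr i)
      map_add' := fun _ _ => by ext; simp
      map_smul' := fun _ _ => by ext; simp }

@[simp] lemma pos_apply (z : Phase d) (i : Fin d) : pos z i = z (Sum.inl i) := rfl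
@[simp] lemma mom_apply (z : Phase d) (i : Fin d) : mom z i = z (Sum.inr i) := rfl

@[simp] lemma pos_phasePoint (x ξ : Space d) : pos (phasePoint x ξ) = x := by
  ext i; simp [phasePoint]

@[simp] lemma mom_phasePoint (x ξ : Space d) : mom (phasePoint x ξ) = ξ := by
  ext i; simp [phasePoint]

@[simp] lemma phasePoint_pos_mom (z : Phase d) : phasePoint (pos z) (mom z) = z := by
  ext i; rcases i with i | i <;> simp [phasePoint]

lemma norm_sq_phase (z : Phase d) : ‖z‖ ^ 2 = ‖pos z‖ ^ 2 + ‖mom z‖ ^ 2 := by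
  simp [EuclideanSpace.norm_sq_eq, Fintype.sum_sum_type]

lemma norm_pos_le (z : Phase d) : ‖pos z‖ ≤ ‖z‖ := by
  have := norm_sq_phase z
  nlinarith [norm_nonneg z, norm_nonneg (pos z), sq_nonneg ‖mom z‖]

lemma norm_mom_le (z : Phase d) : ‖mom z‖ ≤ ‖z‖ := by
  have := norm_sq_phase z
  nlinarith [norm_nonneg z, norm_nonneg (mom z), sq_nonneg ‖pos z‖]

/-- The measurable equivalence `T^*ℝ^d ≃ ℝ^d × ℝ^d`. -/
def phaseSplit (d : ℕ) : Phase d ≃ᵐ Space d × Space d :=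
  (MeasurableEquiv.toLp 2 (Fin d ⊕ Fin d → ℝ)).symm.trans
    ((MeasurableEquiv.sumPiEquivProdPi fun _ : Fin d ⊕ Fin d => ℝ).trans
      ((MeasurableEquiv.toLp 2 (Fin d → ℝ)).prodCongr (MeasurableEquiv.toLp 2 (Fin d → ℝ))))

lemma phaseSplit_apply (z : Phase d) : phaseSplit d z = (pos z, mom z) := rfl

lemma phaseSplit_symm_apply (p : Space d × Space d) :
    (phaseSplit d).symm p = phasePoint p.1 p.2 := by
  rw [MeasurableEquiv.symm_apply_eq, phaseSplit_apply]; simp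

lemma measurePreserving_phaseSplit (d : ℕ) :
    MeasurePreserving (phaseSplit d) volume volume := by
  have h1 := PiLp.volume_preserving_ofLp (Fin d ⊕ Fin d)
  have h2 := volume_measurePreserving_sumPiEquivProdPi (fun _ : Fin d ⊕ Fin d => ℝ)
  have h3 := (PiLp.volume_preserving_toLp (Fin d)).prod (PiLp.volume_preserving_toLp (Fin d))
  exact h3.comp (h2.comp h1)

lemma integral_phase_symm (F : Phase d → ℂ) (hF : Integrable F) :
    ∫ z, F z = ∫ η : Space d, ∫ y : Space d, F (phasePoint y η) := by
  have h := (measurePreserving_phaseSplit d).symm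
  rw [← h.integral_comp (phaseSplit d).symm.measurableEmbedding]
  simp_rw [phaseSplit_symm_apply]
  rw [Measure.volume_eq_prod, integral_prod_symm]
  have := (h.integrable_comp_emb (phaseSplit d).symm.measurableEmbedding).2 hF
  refine this.congr (Filter.Eventually.of_forall fun p => ?_)
  simp [phaseSplit_symm_apply]

/-- The canonical symplectic form. -/
def sform (z w : Phase d) : ℝ := ⟪mom z, pos w⟫_ℝ - ⟪pos z, mom w⟫_ℝ

lemma sform_add_left (z w v : Phase d) : sform (z + w) v = sform z v + sform w v := by
  simp only [sform, map_add, inner_add_left]; ring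
lemma sform_add_right (z w v : Phase d) : sform z (w + v) = sform z w + sform z v := by
  simp only [sform, map_add, inner_add_right]; ring
lemma sform_neg_left (z w : Phase d) : sform (-z) w = -sform z w := by
  simp only [sform, map_neg, inner_neg_left]; ring
lemma sform_neg_right (z w : Phase d) : sform z (-w) = -sform z w := by
  simp only [sform, map_neg, inner_neg_right]; ring
lemma sform_smul_left (c : ℝ) (z w : Phase d) : sform (c • z) w = c * sform z w := by
  simp only [sform, map_smul, real_inner_smul_left]; ring
lemma sform_smul_right (c : ℝ) (z w : Phase d) : sform z (c • w) = c * sform z w := by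
  simp only [sform, map_smul, real_inner_smul_right]; ring
lemma sform_swap (z w : Phase d) : sform z w = -sform w z := by
  simp only [sform, real_inner_comm (mom z), real_inner_comm (pos z)]; ring
@[simp] lemma sform_self (z : Phase d) : sform z z = 0 := by
  have := sform_swap z z; linarith
@[simp] lemma sform_zero_left (z : Phase d) : sform 0 z = 0 := by simp [sform]

/-- `sform z w = ⟪z, rot w⟫`. -/
def rot (w : Phase d) : Phase d := phasePoint (-mom w) (pos w)

lemma sform_eq_inner (z w : Phase d) : sform z w = ⟪rot w, z⟫_ℝ := by
  simp only [sform, rot, phasePoint, PiLp.inner_apply, Fintype.sum_sum_type]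
  simp [mul_comm]
  ring

lemma norm_rot (w : Phase d) : ‖rot w‖ = ‖w‖ := by
  rw [← sq_eq_sq₀ (norm_nonneg _) (norm_nonneg _), norm_sq_phase, norm_sq_phase w]
  simp [rot, add_comm]

/-! ### Weyl operators on `L²` -/

/-- The unimodular factor of the Weyl operator. -/
def weylPhase (z : Phase d) (x : Space d) : ℂ :=
  Complex.exp (((⟪mom z, x⟫_ℝ - ⟪pos z, mom z⟫_ℝ / 2 : ℝ) : ℂ) * I)

@[simp] lemma norm_weylPhase (z : Phase d) (x : Space d) : ‖weylPhase z x‖ = 1 :=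
  Complex.norm_exp_ofReal_mul_I _

lemma continuous_weylPhase : Continuous fun p : Phase d × Space d => weylPhase p.1 p.2 := by
  unfold weylPhase; fun_prop

/-- The Weyl operator on functions. -/
def weylFun (z : Phase d) (f : Space d → ℂ) (x : Space d) : ℂ := weylPhase z x * f (x - pos z)

lemma weylFun_congr (z : Phase d) {f g : Space d → ℂ} (h : f =ᵐ[volume] g) :
    weylFun z f =ᵐ[volume] weylFun z g := by
  have := (measurePreserving_sub_right volume (pos z)).quasiMeasurePreserving.ae_eq_comp h
  filter_upwards [this] with x hx
  simp only [weylFun]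
  congr 1

lemma continuous_weylPhase_right (z : Phase d) : Continuous (weylPhase z) := by
  unfold weylPhase; fun_prop

lemma memLp_weylFun (z : Phase d) {f : Space d → ℂ} (hf : MemLp f 2 volume) :
    MemLp (weylFun z f) 2 volume := by
  have h : MemLp (fun x => f (x - pos z)) 2 volume :=
    hf.comp_measurePreserving (measurePreserving_sub_right volume (pos z))
  have hm : AEStronglyMeasurable (weylFun z f) volume :=
    (continuous_weylPhase_right z).aestronglyMeasurable.mul h.1
  refine MemLp.of_le h hm (Filter.Eventually.of_forall fun x => ?_)
  rw [weylFun, norm_mul, norm_weylPhase, one_mul]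

lemma eLpNorm_weylFun (z : Phase d) {f : Space d → ℂ} (hf : MemLp f 2 volume) :
    eLpNorm (weylFun z f) 2 volume = eLpNorm f 2 volume := by
  rw [← eLpNorm_comp_measurePreserving hf.1 (measurePreserving_sub_right volume (pos z))]
  refine eLpNorm_congr_norm_ae (Filter.Eventually.of_forall fun x => ?_)
  simp [weylFun]

/-- The Weyl operator on `L²`. -/
def weyl (z : Phase d) : L2 d →ₗᵢ[ℂ] L2 d where
  toFun f := (memLp_weylFun z (Lp.memLp f)).toLp _
  map_add' f g := by
    rw [← MemLp.toLp_add]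
    refine MemLp.toLp_congr _ _ ?_
    refine (weylFun_congr z (Lp.coeFn_add f g)).trans (Filter.Eventually.of_forall fun x => ?_)
    simp [weylFun, mul_add]
  map_smul' c f := by
    rw [RingHom.id_apply, ← MemLp.toLp_const_smul]
    refine MemLp.toLp_congr _ _ ?_
    refine (weylFun_congr z (Lp.coeFn_smul c f)).trans (Filter.Eventually.of_forall fun x => ?_)
    simp [weylFun, mul_left_comm]
  norm_map' f := by
    change ‖(memLp_weylFun z (Lp.memLp f)).toLp _‖ = ‖f‖
    rw [Lp.norm_toLp, eLpNorm_weylFun z (Lp.memLp f), Lp.norm_def]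

lemma coeFn_weyl (z : Phase d) (f : L2 d) : weyl z f =ᵐ[volume] weylFun z f :=
  MemLp.coeFn_toLp (memLp_weylFun z (Lp.memLp f))

lemma weylPhase_mul (z w : Phase d) (x : Space d) :
    weylPhase z x * weylPhase w (x - pos z) =
      Complex.exp ((sform z w / 2 : ℝ) * I) * weylPhase (z + w) x := by
  simp only [weylPhase, ← Complex.exp_add, sform]
  congr 1
  rw [← add_mul, ← add_mul, ← Complex.ofReal_add, ← Complex.ofReal_add]
  congr 2
  simp only [map_add, inner_add_left, inner_add_right, inner_sub_right]
  rw [real_inner_comm (pos w) (mom z), real_inner_comm (mom w) (pos z)]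
  ring

/-- The canonical commutation relations. -/
lemma weyl_weyl (z w : Phase d) (f : L2 d) :
    weyl z (weyl w f) = Complex.exp ((sform z w / 2 : ℝ) * I) • weyl (z + w) f := by
  refine Lp.ext ?_
  refine (coeFn_weyl z _).trans ((weylFun_congr z (coeFn_weyl w f)).trans ?_)
  refine Filter.EventuallyEq.trans ?_ (Lp.coeFn_smul _ _).symm
  filter_upwards [coeFn_weyl (z + w) f] with x hx
  rw [Pi.smul_apply, hx]
  simp only [weylFun, smul_eq_mul, ← mul_assoc, weylPhase_mul, map_add, sub_sub]

@[simp] lemma weyl_zero (f : L2 d) : weyl 0 f = f := by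
  refine Lp.ext ((coeFn_weyl 0 f).trans (Filter.Eventually.of_forall fun x => ?_))
  simp [weylFun, weylPhase]

lemma weyl_neg_weyl (z : Phase d) (f : L2 d) : weyl (-z) (weyl z f) = f := by
  rw [weyl_weyl]; simp [sform_neg_left]

lemma inner_weyl_right (z : Phase d) (f g : L2 d) :
    ⟪f, weyl z g⟫_ℂ = ⟪weyl (-z) f, g⟫_ℂ := by
  rw [← (weyl (-z)).inner_map_map, weyl_neg_weyl]

lemma inner_weyl_left (z : Phase d) (f g : L2 d) :
    ⟪weyl z f, g⟫_ℂ = ⟪f, weyl (-z) g⟫_ℂ := by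
  rw [inner_weyl_right, neg_neg]

/-- The parity operator on `L²`. -/
def parity : L2 d →ₗᵢ[ℂ] L2 d where
  toFun f := Lp.compMeasurePreserving Neg.neg (Measure.measurePreserving_neg volume) f
  map_add' f g := map_add _ f g
  map_smul' c f := by
    refine Lp.ext ?_
    have h := Measure.measurePreserving_neg (volume : Measure (Space d))
    refine (Lp.coeFn_compMeasurePreserving _ h).trans ?_
    refine (h.quasiMeasurePreserving.ae_eq_comp (Lp.coeFn_smul c f)).trans ?_
    refine Filter.EventuallyEq.trans ?_ (Lp.coeFn_smul _ _).symm
    filter_upwards [Lp.coeFn_compMeasurePreserving f h] with x hx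
    simp only [RingHom.id_apply, Pi.smul_apply, hx]
    rfl
  norm_map' f := Lp.norm_compMeasurePreserving f _

lemma coeFn_parity (f : L2 d) : parity f =ᵐ[volume] fun x => f (-x) :=
  Lp.coeFn_compMeasurePreserving f (Measure.measurePreserving_neg volume)

@[simp] lemma parity_parity (f : L2 d) : parity (parity f) = f := by
  refine Lp.ext ((coeFn_parity _).trans ?_)
  have h := (Measure.measurePreserving_neg (volume : Measure (Space d)))
  filter_upwards [h.quasiMeasurePreserving.ae_eq_comp (coeFn_parity f)] with x hx
  simpa using hx

lemma weylPhase_neg (z : Phase d) (x : Space d) : weylPhase z (-x) = weylPhase (-z) x := by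
  simp [weylPhase]

lemma parity_weyl (z : Phase d) (f : L2 d) : parity (weyl z f) = weyl (-z) (parity f) := by
  refine Lp.ext ((coeFn_parity _).trans ?_)
  have h := (Measure.measurePreserving_neg (volume : Measure (Space d)))
  refine Filter.EventuallyEq.trans ?_ (coeFn_weyl _ _).symm
  refine Filter.EventuallyEq.trans ?_ (weylFun_congr _ (coeFn_parity f)).symm
  filter_upwards [h.quasiMeasurePreserving.ae_eq_comp (coeFn_weyl z f)] with x hx
  refine Eq.trans hx ?_
  simp [weylFun, weylPhase_neg, add_comm, sub_eq_add_neg]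

end

end Metaplectic

/-! ### The Gaussian, irreducibility of the Weyl operators and strong continuity. -/

namespace Metaplectic

noncomputable section

open Complex (I)
open scoped ComplexConjugate InnerProductSpace FourierTransform ContDiff

variable {d : ℕ}

/-! ### The Gaussian -/

/-- The Gaussian `exp(-|x|²/2)`. -/
def gauss (x : Space d) : ℂ := Complex.exp (-(‖x‖ ^ 2 / 2 : ℝ))

lemma continuous_gauss : Continuous (gauss (d := d)) := by
  unfold gauss; fun_prop

lemma norm_gauss (x : Space d) : ‖gauss x‖ = Real.exp (-(‖x‖ ^ 2 / 2)) := by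
  rw [gauss, Complex.norm_exp]; simp only [Complex.ofReal_re, Complex.neg_re]

lemma conj_gauss (x : Space d) : conj (gauss x) = gauss x := by
  rw [gauss, ← Complex.exp_conj, map_neg, Complex.conj_ofReal]

lemma gauss_neg (x : Space d) : gauss (-x) = gauss x := by simp [gauss]

lemma memLp_gauss : MemLp (gauss (d := d)) 2 volume := by
  rw [memLp_two_iff_integrable_sq_norm continuous_gauss.aestronglyMeasurable]
  have h := (GaussianFourier.integrable_cexp_neg_mul_sq_norm_add (V := Space d) (b := 1)
    (by simp) 0 0).norm
  refine h.congr (Filter.Eventually.of_forall fun x => ?_)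
  simp only [norm_gauss, Complex.norm_exp, ← Real.exp_nat_mul]
  congr 1
  simp [← Complex.ofReal_pow]
  ring

/-- The Gaussian as an element of `L²`. -/
def phi : L2 d := memLp_gauss.toLp gauss

lemma coeFn_phi : (phi : L2 d) =ᵐ[volume] gauss := memLp_gauss.coeFn_toLp

lemma inner_eq_integral (f g : L2 d) : ⟪f, g⟫_ℂ = ∫ x, conj (f x) * g x := by
  rw [L2.inner_def]; simp [mul_comm]

lemma integrable_conj_mul (f g : L2 d) : Integrable fun x => conj (f x) * g x := by
  have := L2.integrable_inner (𝕜 := ℂ) f g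
  simpa [mul_comm] using this

/-- Centring at half the translation p separates exp(-|p|²/4) from exp(-|t|²) and cancels the
constant part of the Weyl phase. What remains is the Fourier transform of a Gaussian. -/
lemma inner_phi_weyl_aux (z : Phase d) :
    ⟪phi, weyl z phi⟫_ℂ = (Real.pi : ℂ) ^ (Module.finrank ℝ (Space d) / 2 : ℂ) *
      Complex.exp (-(‖z‖ ^ 2 / 4 : ℝ)) := by
  have h1 : ⟪phi, weyl z phi⟫_ℂ =
      ∫ x : Space d, gauss x * (weylPhase z x * gauss (x - pos z)) := by
    rw [inner_eq_integral]
    refine integral_congr_ae ?_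
    filter_upwards [coeFn_phi, (coeFn_weyl z phi).trans (weylFun_congr z coeFn_phi)]
      with x hx hx'
    rw [hx, hx', conj_gauss, weylFun]
  rw [h1, ← integral_add_right_eq_self _ ((1 / 2 : ℝ) • pos z)]
  have h2 : ∀ t : Space d, gauss (t + (1 / 2 : ℝ) • pos z) *
      (weylPhase z (t + (1 / 2 : ℝ) • pos z) * gauss (t + (1 / 2 : ℝ) • pos z - pos z)) =
      Complex.exp (-(‖pos z‖ ^ 2 / 4 : ℝ)) *
        Complex.exp (-1 * ‖t‖ ^ 2 + I * ⟪mom z, t⟫_ℝ) := by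
    intro t
    have e : t + (1 / 2 : ℝ) • pos z - pos z = t - (1 / 2 : ℝ) • pos z := by
      module
    rw [e]
    simp only [gauss, weylPhase, ← Complex.exp_add]
    congr 1
    rw [norm_add_sq_real, norm_sub_sq_real, inner_add_right, real_inner_smul_right,
      real_inner_smul_right, norm_smul, real_inner_comm (mom z) (pos z)]
    push_cast
    norm_num
    ring
  simp_rw [h2]
  rw [integral_const_mul, GaussianFourier.integral_cexp_neg_mul_sq_norm_add (by simp),
    mul_left_comm, ← Complex.exp_add, div_one]
  congr 2
  rw [norm_sq_phase]
  push_cast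
  rw [Complex.I_sq]
  ring

lemma inner_phi_weyl (z : Phase d) :
    ⟪phi, weyl z phi⟫_ℂ = (‖(phi : L2 d)‖ ^ 2 : ℝ) * Complex.exp (-(‖z‖ ^ 2 / 4 : ℝ)) := by
  have h := inner_phi_weyl_aux (0 : Phase d)
  rw [weyl_zero, inner_self_eq_norm_sq_to_K] at h
  rw [inner_phi_weyl_aux]
  simp at h
  simp [h]

lemma phi_ne_zero : (phi : L2 d) ≠ 0 := by
  intro h
  have := inner_phi_weyl_aux (0 : Phase d)
  rw [h] at this
  rw [inner_zero_left, eq_comm, mul_eq_zero] at this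
  rcases this with h | h
  · rw [Complex.cpow_eq_zero_iff] at h
    exact Real.pi_ne_zero (by exact_mod_cast h.1)
  · exact Complex.exp_ne_zero _ h

lemma norm_phi_sq_pos : 0 < ‖(phi : L2 d)‖ ^ 2 := by
  have := norm_pos_iff.2 (phi_ne_zero (d := d)); positivity

lemma inner_weyl_phi_weyl_phi (z w : Phase d) :
    ⟪weyl z phi, weyl w phi⟫_ℂ = (‖(phi : L2 d)‖ ^ 2 : ℝ) *
      Complex.exp ((-(sform z w / 2) : ℝ) * I) * Complex.exp (-(‖w - z‖ ^ 2 / 4 : ℝ)) := by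
  rw [inner_weyl_left, weyl_weyl, inner_smul_right, inner_phi_weyl, sform_neg_left,
    neg_add_eq_sub]
  ring_nf

lemma parity_phi : parity (phi : L2 d) = phi := by
  refine Lp.ext ((coeFn_parity _).trans ?_)
  have h := (Measure.measurePreserving_neg (volume : Measure (Space d)))
  filter_upwards [h.quasiMeasurePreserving.ae_eq_comp coeFn_phi, coeFn_phi] with x hx hx'
  rw [hx', ← gauss_neg]
  exact hx

/-! ### Totality of orbits and strong continuity -/

/-- An integrable function with vanishing Fourier transform vanishes. -/
lemma ae_eq_zero_of_fourier_eq_zero {h : Space d → ℂ} (hi : Integrable h)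
    (h0 : ∀ ξ, 𝓕 h ξ = 0) : ∀ᵐ x, h x = 0 := by
  refine ae_eq_zero_of_integral_contDiff_smul_eq_zero hi.locallyIntegrable fun g hg hc => ?_
  have hc' : HasCompactSupport fun x => (g x : ℂ) := hc.comp_left Complex.ofReal_zero
  let G : 𝓢(Space d, ℂ) := hc'.toSchwartzMap (Complex.ofRealCLM.contDiff.comp hg)
  have hG : ∀ x, G x = g x := fun x => rfl
  -- The test function is the Fourier transform of a Schwartz function k, so the multiplication
  -- formula ∫ 𝓕k · h = ∫ k · 𝓕h moves the transform onto h.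
  obtain ⟨k, hk⟩ : ∃ k : 𝓢(Space d, ℂ), 𝓕 k = G := ⟨𝓕⁻ G, by simp⟩
  have key := VectorFourier.integral_fourierIntegral_smul_eq_flip (L := innerₗ (Space d))
    Real.continuous_fourierChar continuous_inner k.integrable (μ := volume) hi
  have e1 : ∀ x, g x • h x = 𝓕 (k : Space d → ℂ) x • h x := by
    intro x
    rw [← SchwartzMap.fourier_coe, hk, hG]
    simp
  simp_rw [e1]
  refine Eq.trans key ?_
  rw [flip_innerₗ]
  refine integral_eq_zero_of_ae (Filter.Eventually.of_forall fun x => ?_)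
  have := h0 x
  simp only [Real.fourier_eq] at this
  simp only [VectorFourier.fourierIntegral, Pi.zero_apply]
  rw [smul_eq_mul, mul_eq_zero]
  right
  exact this

/-- For a fixed translation y, the momentum dependence of the inner product is, up to a unimodular
factor, the Fourier transform of conj(g(x-y)) f(x). Hence f(x) g(x-y) = 0 for almost all x, for
every y. By Fubini, a typical x with f(x) ≠ 0 would force g = 0 almost everywhere. -/
lemma eq_zero_of_inner_weyl_eq_zero {f g : L2 d} (hg : g ≠ 0)
    (h : ∀ z, ⟪weyl z g, f⟫_ℂ = 0) : f = 0 := by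
  have key : ∀ y : Space d, ∀ᵐ x : Space d, f x = 0 ∨ g (x - y) = 0 := by
    intro y
    have hi : Integrable fun x => conj (weyl (phasePoint y 0) g x) * f x :=
      integrable_conj_mul _ _
    have e : (fun x => conj (weyl (phasePoint y 0) g x) * f x) =ᵐ[volume]
        fun x => conj (g (x - y)) * f x := by
      filter_upwards [coeFn_weyl (phasePoint y 0) g] with x hx
      rw [hx]; simp [weylFun, weylPhase]
    have hF := ae_eq_zero_of_fourier_eq_zero (hi.congr e) (fun ξ => ?_)
    · filter_upwards [hF] with x hx
      rcases mul_eq_zero.1 hx with h | h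
      · right; simpa using h
      · exact Or.inl h
    · have h1 := h (phasePoint y ((2 * Real.pi) • ξ))
      rw [inner_eq_integral] at h1
      rw [Real.fourier_eq']
      have e2 : (fun x => conj (weyl (phasePoint y ((2 * Real.pi) • ξ)) g x) * f x) =ᵐ[volume]
          fun x => Complex.exp ((⟪y, (2 * Real.pi) • ξ⟫_ℝ / 2 : ℝ) * I) *
            (Complex.exp ((-2 * Real.pi * ⟪x, ξ⟫_ℝ : ℝ) * I) • (conj (g (x - y)) * f x)) := by
        filter_upwards [coeFn_weyl (phasePoint y ((2 * Real.pi) • ξ)) g] with x hx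
        rw [hx]
        simp only [weylFun, weylPhase, map_mul, pos_phasePoint, mom_phasePoint, smul_eq_mul,
          ← Complex.exp_conj, Complex.conj_I, Complex.conj_ofReal, ← mul_assoc, ← Complex.exp_add]
        congr 3
        rw [real_inner_smul_left, real_inner_comm x ξ]
        push_cast
        ring
      rw [integral_congr_ae e2, integral_const_mul, mul_eq_zero] at h1
      rcases h1 with h1 | h1
      · exact absurd h1 (Complex.exp_ne_zero _)
      · exact h1
  have hm : MeasurableSet {p : Space d × Space d | f p.2 = 0 ∨ g (p.2 - p.1) = 0} := by
    have hf := (Lp.stronglyMeasurable f).measurable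
    have hg := (Lp.stronglyMeasurable g).measurable
    refine MeasurableSet.union ?_ ?_
    · exact measurableSet_eq_fun (hf.comp measurable_snd) measurable_const
    · exact measurableSet_eq_fun (hg.comp (measurable_snd.sub measurable_fst)) measurable_const
  have key2 : ∀ᵐ x : Space d, ∀ᵐ y : Space d, f x = 0 ∨ g (x - y) = 0 :=
    (Measure.ae_ae_comm hm).1 (Filter.Eventually.of_forall key)
  refine (Lp.eq_zero_iff_ae_eq_zero).2 ?_
  filter_upwards [key2] with x hx
  by_contra hfx
  refine hg ((Lp.eq_zero_iff_ae_eq_zero).2 ?_)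
  have h2 : ∀ᵐ y : Space d, g (x - y) = 0 := hx.mono fun y hy => hy.resolve_left hfx
  have h3 := (Measure.measurePreserving_sub_left (volume : Measure (Space d)) x).quasiMeasurePreserving.ae
    h2
  simp only [sub_sub_cancel] at h3
  exact h3

/-- Serves as an induction principle: identities between bounded operators need checking only on the
Weyl orbit of one nonzero vector. -/
lemma closed_submodule_eq_top {g : L2 d} (hg : g ≠ 0) {S : Submodule ℂ (L2 d)}
    (hS : IsClosed (S : Set (L2 d))) (h : ∀ z, weyl z g ∈ S) : S = ⊤ := by
  rw [← hS.submodule_topologicalClosure_eq, Submodule.topologicalClosure_eq_top_iff,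
    Submodule.eq_bot_iff]
  intro f hf
  exact eq_zero_of_inner_weyl_eq_zero hg fun z => hf _ (h z)

/-- The distance between two coherent states is an explicit continuous function of their inner
product. -/
lemma continuous_weyl_phi : Continuous fun z : Phase d => weyl z (phi : L2 d) := by
  rw [continuous_iff_continuousAt]
  intro z0
  rw [ContinuousAt, tendsto_iff_norm_sub_tendsto_zero]
  have e : ∀ z : Phase d, ‖weyl z (phi : L2 d) - weyl z0 phi‖ =
      Real.sqrt (2 * ‖(phi : L2 d)‖ ^ 2 - 2 * (⟪weyl z (phi : L2 d), weyl z0 phi⟫_ℂ).re) := by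
    intro z
    rw [← Real.sqrt_sq (norm_nonneg (weyl z (phi : L2 d) - weyl z0 phi)),
      @norm_sub_sq ℂ, LinearIsometry.norm_map, LinearIsometry.norm_map]
    congr 1
    simp only [RCLike.re_to_complex]
    ring
  have hc : Continuous fun z : Phase d =>
      Real.sqrt (2 * ‖(phi : L2 d)‖ ^ 2 - 2 * (⟪weyl z (phi : L2 d), weyl z0 phi⟫_ℂ).re) := by
    simp_rw [inner_weyl_phi_weyl_phi]
    unfold sform
    fun_prop
  have := hc.tendsto z0
  simp_rw [e]
  convert this using 2
  rw [← e]; simp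

/-- The vectors with continuous orbit form a submodule. It is closed, since the operators are
isometries and uniform limits of continuous maps are continuous, and it contains the orbit of the
Gaussian. -/
lemma continuous_weyl (k : L2 d) : Continuous fun z : Phase d => weyl z k := by
  let S : Submodule ℂ (L2 d) :=
    { carrier := {k | Continuous fun z : Phase d => weyl z k}
      zero_mem' := by simpa using continuous_const
      add_mem' := fun {a b} ha hb => by
        simp only [Set.mem_ofPred_eq, map_add] at *
        exact ha.add hb
      smul_mem' := fun c a ha => by
        simp only [Set.mem_ofPred_eq, map_smul] at *
        exact ha.const_smul c }
  have hS : IsClosed (S : Set (L2 d)) := by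
    refine isClosed_of_closure_subset fun k hk => ?_
    refine continuous_of_uniform_approx_of_continuous fun u hu => ?_
    obtain ⟨ε, hε, hu⟩ := Metric.mem_uniformity_dist.1 hu
    obtain ⟨b, hb, hkb⟩ := Metric.mem_closure_iff.1 hk ε hε
    exact ⟨_, hb, fun z => hu (by rwa [(weyl z).dist_map])⟩
  have hT : S = ⊤ := closed_submodule_eq_top phi_ne_zero hS fun w => by
    change Continuous fun z : Phase d => weyl z (weyl w phi)
    simp_rw [weyl_weyl]
    have h1 : Continuous fun z : Phase d => Complex.exp ((sform z w / 2 : ℝ) * I) := by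
      unfold sform
      fun_prop
    exact h1.smul (continuous_weyl_phi.comp (continuous_add_const w))
  exact (hT ▸ Submodule.mem_top : k ∈ S)

end

end Metaplectic

/-! ### Integrals of Weyl operators and von Neumann's Gaussian average. -/

namespace Metaplectic

noncomputable section

open Complex (I)
open scoped ComplexConjugate InnerProductSpace FourierTransform ContDiff

variable {d : ℕ}

/-! ### Superpositions of Weyl operators -/

lemma integrable_smul_weyl_comp {M : Phase d → Phase d} (hM : Continuous M) {F : Phase d → ℂ}
    (hF : Integrable F) (k : L2 d) : Integrable fun z => F z • weyl (M z) k := by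
  refine (hF.norm.mul_const ‖k‖).mono'
    (hF.1.smul ((continuous_weyl k).comp hM).aestronglyMeasurable) ?_
  refine Filter.Eventually.of_forall fun z => ?_
  rw [norm_smul, LinearIsometry.norm_map]

lemma inner_integral_smul_weyl {M : Phase d → Phase d} (hM : Continuous M) {F : Phase d → ℂ}
    (hF : Integrable F) (h k : L2 d) :
    ⟪h, ∫ z, F z • weyl (M z) k⟫_ℂ = ∫ z, F z * ⟪h, weyl (M z) k⟫_ℂ := by
  rw [← integral_inner (integrable_smul_weyl_comp hM hF k)]
  simp_rw [inner_smul_right]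

/-- The operator `∫ F(z) W(M z) dz`. -/
def weylInt {M : Phase d → Phase d} (hM : Continuous M) {F : Phase d → ℂ} (hF : Integrable F) :
    L2 d →L[ℂ] L2 d :=
  LinearMap.mkContinuous
    { toFun := fun k => ∫ z, F z • weyl (M z) k
      map_add' := fun k l => by
        rw [← integral_add (integrable_smul_weyl_comp hM hF k)
          (integrable_smul_weyl_comp hM hF l)]
        simp
      map_smul' := fun c k => by
        rw [RingHom.id_apply, ← integral_smul]
        simp_rw [map_smul, smul_comm c] }
    (∫ z, ‖F z‖) fun k => by
      refine (norm_integral_le_integral_norm _).trans ?_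
      simp_rw [norm_smul, LinearIsometry.norm_map]
      rw [integral_mul_const]

/-- This licenses Fubini whenever an integral of Weyl operators is paired with a vector. The inner
x-integral of absolute values is bounded by ‖h‖‖k‖ uniformly in z. -/
lemma integrable_prod_weylFun {F : Phase d → ℂ} (hF : Integrable F) (h k : L2 d) :
    Integrable (fun p : Phase d × Space d => F p.1 * (conj (h p.2) * weylFun p.1 k p.2))
      (volume.prod volume) := by
  have hh := (Lp.stronglyMeasurable h).measurable
  have hk := (Lp.stronglyMeasurable k).measurable
  have hm : Measurable fun p : Phase d × Space d => conj (h p.2) * weylFun p.1 k p.2 := by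
    refine ((Complex.continuous_conj.measurable).comp (hh.comp measurable_snd)).mul
      (continuous_weylPhase.measurable.mul (hk.comp ?_))
    exact measurable_snd.sub (pos.continuous.measurable.comp measurable_fst)
  have hz : ∀ z, (fun x => conj (h x) * weyl z k x) =ᵐ[volume]
      fun x => conj (h x) * weylFun z k x := fun z => by
    filter_upwards [coeFn_weyl z k] with x hx
    rw [hx]
  have hi : ∀ z, Integrable fun x => conj (h x) * weylFun z k x := fun z =>
    (integrable_conj_mul h (weyl z k)).congr (hz z)
  have hb : ∀ z, ∫ x, ‖conj (h x) * weylFun z k x‖ ≤ ‖h‖ * ‖k‖ := fun z => by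
    have h1 : ∀ f : L2 d, ∃ f' : L2 d, ‖f'‖ = ‖f‖ ∧ f' =ᵐ[volume] fun x => (‖f x‖ : ℂ) := by
      intro f
      have hm : MemLp (fun x => (‖f x‖ : ℂ)) 2 volume := (Lp.memLp f).norm.ofReal
      refine ⟨hm.toLp _, ?_, hm.coeFn_toLp⟩
      rw [Lp.norm_toLp, Lp.norm_def]
      congr 1
      exact eLpNorm_congr_norm_ae (Filter.Eventually.of_forall fun x => by simp)
    obtain ⟨h', hn, he⟩ := h1 h
    obtain ⟨k', kn, ke⟩ := h1 (weyl z k)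
    -- Cauchy–Schwarz is applied to the classes of |h| and |W(z)k|, which have the same norms as h
    -- and W(z)k.
    have h2 : ((∫ x, ‖conj (h x) * weylFun z k x‖ : ℝ) : ℂ) = ⟪h', k'⟫_ℂ := by
      rw [inner_eq_integral, ← integral_complex_ofReal]
      refine integral_congr_ae ?_
      filter_upwards [he, ke, coeFn_weyl z k] with x hx hx' hx''
      rw [hx, hx', hx'']
      simp
    have h3 := norm_inner_le_norm (𝕜 := ℂ) h' k'
    rw [← h2, Complex.norm_real, hn, kn, LinearIsometry.norm_map] at h3
    exact (le_abs_self _).trans h3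
  have hmm : AEStronglyMeasurable
      (fun p : Phase d × Space d => F p.1 * (conj (h p.2) * weylFun p.1 k p.2))
      (volume.prod volume) := hF.1.comp_fst.mul hm.aestronglyMeasurable
  refine (integrable_prod_iff hmm).2 ⟨Filter.Eventually.of_forall fun z => (hi z).const_mul (F z), ?_⟩
  refine (hF.norm.mul_const (‖h‖ * ‖k‖)).mono' hmm.norm.integral_prod_right' ?_
  refine Filter.Eventually.of_forall fun z => ?_
  simp_rw [norm_mul (F z)]
  rw [integral_const_mul, norm_mul, norm_norm, Real.norm_of_nonneg (by positivity)]
  exact mul_le_mul_of_nonneg_left (hb z) (norm_nonneg _)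

/-- The Bochner integral of Weyl operators is computed pointwise. -/
lemma coeFn_integral_weyl {F : Phase d → ℂ} (hF : Integrable F) (k : L2 d) :
    (∫ z, F z • weyl z k : L2 d) =ᵐ[volume] fun x => ∫ z, F z * weylFun z k x := by
  have hswap : ∀ h : L2 d, Integrable (fun x => conj (h x) * ∫ z, F z * weylFun z k x) := by
    intro h
    refine (integrable_prod_weylFun hF h k).integral_prod_right.congr
      (Filter.Eventually.of_forall fun x => ?_)
    change ∫ z, F z * (conj (h x) * weylFun z k x) = conj (h x) * ∫ z, F z * weylFun z k x
    rw [← integral_const_mul]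
    congr 1; ext z; ring
  refine ae_eq_of_integral_contDiff_smul_eq
    ((Lp.memLp _).locallyIntegrable one_le_two) ?_ fun g hg hc => ?_
  · refine (locallyIntegrable_iff).2 fun K hK => ?_
    -- Pairing with the indicator of a compact set gives integrability on that set.
    have := hswap (indicatorConstLp 2 hK.measurableSet hK.measure_lt_top.ne (1 : ℂ))
    rw [← integrable_indicator_iff hK.measurableSet]
    refine this.congr ?_
    filter_upwards [indicatorConstLp_coeFn (p := 2) (hs := hK.measurableSet)
      (hμs := hK.measure_lt_top.ne) (c := (1 : ℂ))] with x hx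
    rw [hx]
    by_cases hxK : x ∈ K <;> simp [hxK]
  · have hgL : MemLp (fun x => (g x : ℂ)) 2 (volume : Measure (Space d)) :=
      (hg.continuous.memLp_of_hasCompactSupport hc).ofReal
    have e1 : ∀ f : Space d → ℂ, (fun x => g x • f x) =ᵐ[volume]
        fun x => conj (hgL.toLp _ x) * f x := fun f => by
      filter_upwards [hgL.coeFn_toLp] with x hx
      rw [hx]; simp
    rw [integral_congr_ae (e1 _), integral_congr_ae (e1 _), ← inner_eq_integral]
    refine (inner_integral_smul_weyl continuous_id hF _ _).trans ?_
    have e2 : ∀ z, F z * ⟪hgL.toLp _, weyl (id z) k⟫_ℂ =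
        ∫ x, F z * (conj (hgL.toLp _ x) * weylFun z k x) := fun z => by
      rw [integral_const_mul, inner_eq_integral]
      congr 1
      refine integral_congr_ae ?_
      filter_upwards [coeFn_weyl z k] with x hx
      rw [id, hx]
    simp_rw [e2]
    rw [integral_integral_swap (f := fun z x => F z * (conj (hgL.toLp _ x) * weylFun z k x))
      (integrable_prod_weylFun hF _ k)]
    congr 1; ext x
    rw [← integral_const_mul]
    congr 1; ext z; ring

/-! ### The Gaussian superposition is a multiple of a rank one projection -/

/-- The Gaussian weight `exp(-|z|²/4)` on phase space. -/
def gweight (z : Phase d) : ℂ := Complex.exp (-(‖z‖ ^ 2 / 4 : ℝ))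

lemma continuous_gweight : Continuous (gweight (d := d)) := by unfold gweight; fun_prop

lemma norm_gweight (z : Phase d) : ‖gweight z‖ = Real.exp (-(‖z‖ ^ 2 / 4)) := by
  rw [gweight, Complex.norm_exp]; simp only [Complex.neg_re, Complex.ofReal_re]

lemma gweight_neg (z : Phase d) : gweight (-z) = gweight z := by simp [gweight]

lemma conj_gweight (z : Phase d) : conj (gweight z) = gweight z := by
  rw [gweight, ← Complex.exp_conj, map_neg, Complex.conj_ofReal]

lemma integrable_gweight : Integrable (gweight (d := d)) := by
  refine (GaussianFourier.integrable_cexp_neg_mul_sq_norm_add (V := Phase d) (b := 1 / 4)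
    (by norm_num) 0 0).congr (Filter.Eventually.of_forall fun z => ?_)
  simp only [gweight]
  congr 1
  push_cast
  ring

/-- The constant `∫ exp(-|z|²/2) dz`. -/
def gconst (d : ℕ) : ℂ :=
  ((Real.pi : ℂ) / (1 / 2)) ^ (Module.finrank ℝ (Phase d) / 2 : ℂ)

lemma gconst_ne_zero : gconst d ≠ 0 := by
  rw [gconst, Ne, Complex.cpow_eq_zero_iff]
  rintro ⟨h, -⟩
  have : (Real.pi : ℂ) ≠ 0 := by exact_mod_cast Real.pi_ne_zero
  exact this (by simp at h)

/-- This is the coefficient of W(w) in Q W(z) Q, where Q is the Gaussian average. Centring u at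
(w-z)/2 leaves exp(-|w-z|²/8) times a Gaussian Fourier integral in the direction `rot (w + z)`,
which contributes exp(-|w+z|²/8). The parallelogram law makes the product split into a function of z
times a function of w. -/
lemma integral_gweight_twisted (z w : Phase d) :
    ∫ u, gweight u * gweight (w - z - u) *
      (Complex.exp ((sform z (w - z - u) / 2 : ℝ) * I) *
        Complex.exp ((sform u (z + (w - z - u)) / 2 : ℝ) * I)) =
      gconst d * (gweight z * gweight w) := by
  rw [← integral_add_left_eq_self _ ((1 / 2 : ℝ) • (w - z))]
  have key : ∀ v : Phase d, gweight ((1 / 2 : ℝ) • (w - z) + v) *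
      gweight (w - z - ((1 / 2 : ℝ) • (w - z) + v)) *
      (Complex.exp ((sform z (w - z - ((1 / 2 : ℝ) • (w - z) + v)) / 2 : ℝ) * I) *
        Complex.exp ((sform ((1 / 2 : ℝ) • (w - z) + v)
          (z + (w - z - ((1 / 2 : ℝ) • (w - z) + v))) / 2 : ℝ) * I)) =
      Complex.exp (-(‖w - z‖ ^ 2 / 8 : ℝ)) *
        Complex.exp (-(1 / 2) * ‖v‖ ^ 2 + (I / 2) * ⟪rot (w + z), v⟫_ℝ) := by
    intro v
    have e1 : w - z - ((1 / 2 : ℝ) • (w - z) + v) = (1 / 2 : ℝ) • (w - z) - v := by module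
    have e2 : sform z ((1 / 2 : ℝ) • (w - z) - v) +
        sform ((1 / 2 : ℝ) • (w - z) + v) (z + ((1 / 2 : ℝ) • (w - z) - v)) =
        ⟪rot (w + z), v⟫_ℝ := by
      rw [← sform_eq_inner]
      simp only [sub_eq_add_neg, sform_add_left, sform_add_right, sform_smul_left,
        sform_smul_right, sform_neg_left, sform_neg_right, sform_self]
      rw [sform_swap w z, sform_swap w v, sform_swap z v]
      ring
    rw [e1, ← e2]
    simp only [gweight, ← Complex.exp_add]
    congr 1
    rw [norm_add_sq_real, norm_sub_sq_real, norm_smul]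
    push_cast
    norm_num
    ring
  simp_rw [key]
  rw [integral_const_mul, GaussianFourier.integral_cexp_neg_mul_sq_norm_add (by norm_num),
    norm_rot, ← gconst, mul_left_comm]
  congr 1
  simp only [gweight, ← Complex.exp_add]
  congr 1
  have h1 := norm_add_sq_real w z
  have h2 := norm_sub_sq_real w z
  have : (I / 2) ^ 2 = -(1 / 4 : ℂ) := by rw [div_pow, Complex.I_sq]; norm_num
  rw [this, h2]
  have h1' : ((‖w + z‖ : ℝ) : ℂ) ^ 2 = ((‖w‖ ^ 2 + 2 * ⟪w, z⟫_ℝ + ‖z‖ ^ 2 : ℝ) : ℂ) := by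
    rw [← h1]; push_cast; rfl
  rw [h1']
  push_cast
  ring

/-- The operator `∫ exp(-|z|²/4) W(M z) dz`. -/
def gproj (M : Phase d →L[ℝ] Phase d) : L2 d →L[ℂ] L2 d :=
  weylInt M.continuous integrable_gweight

lemma gproj_apply (M : Phase d →L[ℝ] Phase d) (k : L2 d) :
    gproj M k = ∫ z, gweight z • weyl (M z) k := rfl

/-- Since M preserves the symplectic form, the phases in the product are those of the case M = id,
and the twisted Gaussian integral factors. The factor depending on w rebuilds the Gaussian average.
-/
lemma gproj_weyl_gproj {M : Phase d →L[ℝ] Phase d}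
    (hM : ∀ z w, sform (M z) (M w) = sform z w) (z : Phase d) (k : L2 d) :
    gproj M (weyl (M z) (gproj M k)) = (gconst d * gweight z) • gproj M k := by
  have hcw : ∀ k : L2 d, Continuous fun z : Phase d => weyl (M z) k := fun k =>
    (continuous_weyl k).comp M.continuous
  have h1 : ∀ u, gweight u • weyl (M u) (weyl (M z) (gproj M k)) =
      ∫ w, (gweight u * gweight (w - z - u) *
        (Complex.exp ((sform z (w - z - u) / 2 : ℝ) * I) *
        Complex.exp ((sform u (z + (w - z - u)) / 2 : ℝ) * I))) • weyl (M w) k := by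
    intro u
    rw [gproj_apply, ← (weyl (M z)).coe_toContinuousLinearMap,
      ← ContinuousLinearMap.integral_comp_comm _
        (integrable_smul_weyl_comp M.continuous integrable_gweight k),
      ← (weyl (M u)).coe_toContinuousLinearMap,
      ← ContinuousLinearMap.integral_comp_comm, ← integral_smul]
    -- Translating w by z + u makes the total argument of the three Weyl operators equal to M w.
    · rw [← integral_sub_right_eq_self _ (z + u)]
      congr 1; ext1 w
      simp only [LinearIsometry.coe_toContinuousLinearMap, map_smul, weyl_weyl, smul_smul,
        ← map_add, hM, sub_sub]
      rw [show u + (z + (w - (z + u))) = w by abel]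
      congr 1
      ring
    · exact (weyl (M z)).toContinuousLinearMap.integrable_comp
        (integrable_smul_weyl_comp M.continuous integrable_gweight k)
  rw [gproj_apply]
  simp_rw [h1]
  rw [integral_integral_swap]
  · simp_rw [integral_smul_const, integral_gweight_twisted]
    rw [gproj_apply, ← integral_smul]
    congr 1; ext1 w
    rw [smul_smul, mul_assoc]
  -- Fubini: all phases are unimodular, so the integrand is dominated by a product of two Gaussians
  -- composed with a measure-preserving shear.
  · have h2 := (integrable_gweight (d := d)).mul_prod (integrable_gweight.comp_sub_right z)
    have h3 := (measurePreserving_prod_neg_add (volume : Measure (Phase d))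
      (volume : Measure (Phase d))).integrable_comp_of_integrable h2
    refine (h3.norm.mul_const ‖k‖).mono' ?_ (Filter.Eventually.of_forall fun p => ?_)
    · refine Continuous.aestronglyMeasurable ?_
      have hc := continuous_gweight (d := d)
      have h4 : Continuous fun p : Phase d × Phase d => gweight p.1 * gweight (p.2 - z - p.1) *
          (Complex.exp ((sform z (p.2 - z - p.1) / 2 : ℝ) * I) *
            Complex.exp ((sform p.1 (z + (p.2 - z - p.1)) / 2 : ℝ) * I)) := by
        unfold sform
        fun_prop
      exact h4.smul ((hcw k).comp continuous_snd)
    · simp only [Function.uncurry, norm_smul, norm_mul, LinearIsometry.norm_map,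
        Complex.norm_exp_ofReal_mul_I, mul_one, Function.comp_apply]
      refine le_of_eq ?_
      congr 4
      abel

/-- Tested against the coherent states, this is the case z = 0 of the twisted Gaussian integral. -/
lemma gproj_phi : gproj (ContinuousLinearMap.id ℝ (Phase d)) phi = gconst d • phi := by
  rw [← sub_eq_zero]
  refine eq_zero_of_inner_weyl_eq_zero phi_ne_zero fun w => ?_
  rw [inner_sub_right, sub_eq_zero, inner_smul_right, gproj_apply,
    inner_integral_smul_weyl (ContinuousLinearMap.continuous _) integrable_gweight]
  have h := integral_gweight_twisted 0 w
  have h0 : gweight (0 : Phase d) = 1 := by simp [gweight]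
  rw [h0, one_mul] at h
  rw [inner_weyl_left, inner_phi_weyl, mul_left_comm, norm_neg, ← gweight, ← h,
    ← integral_const_mul]
  congr 1; ext u
  simp only [ContinuousLinearMap.id_apply, inner_weyl_phi_weyl_phi]
  simp only [sub_zero, sform_zero_left, zero_add, sub_eq_add_neg w u, sform_add_right,
    sform_neg_right, sform_self]
  rw [← norm_neg (u - w), neg_sub, ← gweight, sub_eq_add_neg w u, sform_swap w u]
  simp [neg_div]
  ring

/-- `∫ exp(-|z|²/4) W(z) dz` is a multiple of the projection on the Gaussian. -/
lemma gproj_id_apply (k : L2 d) : gproj (ContinuousLinearMap.id ℝ (Phase d)) k =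
    (gconst d / (‖(phi : L2 d)‖ ^ 2 : ℝ) * ⟪phi, k⟫_ℂ) • phi := by
  let A : L2 d →L[ℂ] L2 d := (gconst d / (‖(phi : L2 d)‖ ^ 2 : ℝ)) •
    (innerSL ℂ (phi : L2 d)).smulRight (phi : L2 d)
  have hA : ∀ k, A k = (gconst d / (‖(phi : L2 d)‖ ^ 2 : ℝ) * ⟪phi, k⟫_ℂ) • phi := fun k => by
    simp [A, smul_smul]
  rw [← hA]
  have hn : ((‖(phi : L2 d)‖ ^ 2 : ℝ) : ℂ) ≠ 0 := by exact_mod_cast norm_phi_sq_pos.ne'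
  let S := LinearMap.ker (gproj (ContinuousLinearMap.id ℝ (Phase d)) - A).toLinearMap
  have hS : S = ⊤ := by
    refine closed_submodule_eq_top phi_ne_zero ?_ fun w => ?_
    · exact ContinuousLinearMap.isClosed_ker _
    · rw [LinearMap.mem_ker]
      refine sub_eq_zero.2 ?_
      -- Apply the relation Q W(w) Q = c exp(-|w|²/4) Q to φ, use Qφ = cφ on both sides and cancel
      -- one factor c: this determines Q on every coherent state.
      have h1 := gproj_weyl_gproj (M := ContinuousLinearMap.id ℝ (Phase d)) (fun _ _ => rfl) w phi
      rw [gproj_phi, map_smul, map_smul, mul_smul] at h1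
      have h2 := smul_right_injective (L2 d) gconst_ne_zero h1
      rw [ContinuousLinearMap.id_apply] at h2
      rw [ContinuousLinearMap.coe_coe, h2, ContinuousLinearMap.coe_coe, hA, inner_phi_weyl,
        ← gweight, smul_smul]
      congr 1
      field_simp
  have : k ∈ S := hS ▸ Submodule.mem_top
  exact sub_eq_zero.1 (LinearMap.mem_ker.1 this)

end

end Metaplectic

/-! ### Unitary operators implementing symplectic maps. -/

namespace Metaplectic

noncomputable section

open Complex (I)
open scoped ComplexConjugate InnerProductSpace FourierTransform ContDiff

variable {d : ℕ}

/-! ### Existence of intertwining operators -/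

/-- `U` intertwines the Weyl operators with those composed with `M`. -/
def Intertwines (M : Phase d ≃L[ℝ] Phase d) (U : L2 d ≃ₗᵢ[ℂ] L2 d) : Prop :=
  ∀ z k, U (weyl z k) = weyl (M z) (U k)

/-- The weight is real and even, and the adjoint of W(Mz) is W(-Mz). -/
lemma inner_gproj_left (M : Phase d →L[ℝ] Phase d) (h k : L2 d) :
    ⟪gproj M h, k⟫_ℂ = ⟪h, gproj M k⟫_ℂ := by
  rw [← inner_conj_symm, gproj_apply, gproj_apply,
    inner_integral_smul_weyl M.continuous integrable_gweight,
    inner_integral_smul_weyl M.continuous integrable_gweight, ← integral_conj,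
    ← integral_neg_eq_self]
  congr 1; ext z
  rw [map_mul, conj_gweight, gweight_neg, inner_conj_symm, inner_weyl_left, map_neg, neg_neg]

/-- The integrand is ‖φ‖² times a product of two strictly positive Gaussian factors, so no
cancellation can occur. -/
lemma inner_phi_gproj_phi_ne_zero (M : Phase d →L[ℝ] Phase d) :
    ⟪phi, gproj M phi⟫_ℂ ≠ 0 := by
  rw [gproj_apply, inner_integral_smul_weyl M.continuous integrable_gweight]
  have e0 : ∀ z : Phase d, gweight z * ⟪phi, weyl (M z) (phi : L2 d)⟫_ℂ =
      (‖(phi : L2 d)‖ ^ 2 : ℝ) * (gweight z * Complex.exp (-(‖M z‖ ^ 2 / 4 : ℝ))) := fun z => by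
    rw [inner_phi_weyl]; ring
  simp_rw [e0]
  rw [integral_const_mul]
  refine mul_ne_zero (by exact_mod_cast norm_phi_sq_pos.ne') ?_
  have e : ∀ z : Phase d, gweight z * Complex.exp (-(‖M z‖ ^ 2 / 4 : ℝ)) =
      ((Real.exp (-(‖z‖ ^ 2 / 4)) * Real.exp (-(‖M z‖ ^ 2 / 4)) : ℝ) : ℂ) := by
    intro z; simp [gweight]
  simp_rw [e]
  rw [integral_complex_ofReal]
  have hc : Continuous fun z : Phase d =>
    Real.exp (-(‖z‖ ^ 2 / 4)) * Real.exp (-(‖M z‖ ^ 2 / 4)) := by fun_prop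
  have hi : Integrable fun z : Phase d =>
      Real.exp (-(‖z‖ ^ 2 / 4)) * Real.exp (-(‖M z‖ ^ 2 / 4)) := by
    refine (integrable_gweight (d := d)).norm.mono' hc.aestronglyMeasurable
      (Filter.Eventually.of_forall fun z => ?_)
    rw [norm_gweight, Real.norm_of_nonneg (by positivity)]
    refine mul_le_of_le_one_right (Real.exp_pos _).le (Real.exp_le_one_iff.2 ?_)
    have := sq_nonneg ‖M z‖
    linarith
  have hp : 0 < ∫ z : Phase d, Real.exp (-(‖z‖ ^ 2 / 4)) * Real.exp (-(‖M z‖ ^ 2 / 4)) := by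
    rw [integral_pos_iff_support_of_nonneg (fun z => by positivity) hi]
    have : Function.support (fun z : Phase d =>
        Real.exp (-(‖z‖ ^ 2 / 4)) * Real.exp (-(‖M z‖ ^ 2 / 4))) = Set.univ := by
      ext z; simp [(Real.exp_pos _).ne']
    rw [this]
    exact isOpen_univ.measure_pos volume ⟨0, trivial⟩
  exact_mod_cast hp.ne'

lemma parity_gproj_phi (M : Phase d →L[ℝ] Phase d) :
    parity (gproj M phi) = gproj M (phi : L2 d) := by
  rw [gproj_apply, ← parity.coe_toContinuousLinearMap,
    ← ContinuousLinearMap.integral_comp_comm _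
      (integrable_smul_weyl_comp M.continuous integrable_gweight phi), ← integral_neg_eq_self]
  congr 1; ext1 z
  rw [LinearIsometry.coe_toContinuousLinearMap, map_smul, parity_weyl, parity_phi, gweight_neg,
    map_neg, neg_neg]

lemma inner_linearCombination {ι : Type*} (u : ι → L2 d) (x y : ι →₀ ℂ) :
    ⟪Finsupp.linearCombination ℂ u x, Finsupp.linearCombination ℂ u y⟫_ℂ =
      x.sum fun a s => y.sum fun b t => conj s * (t * ⟪u a, u b⟫_ℂ) := by
  simp only [Finsupp.linearCombination_apply, Finsupp.sum, inner_smul_left, inner_smul_right,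
    sum_inner, inner_sum, Finset.mul_sum]
  rw [Finset.sum_comm]
  refine Finset.sum_congr rfl fun a _ => Finset.sum_congr rfl fun b _ => mul_left_comm _ _ _

lemma denseRange_linearCombination_weyl {g : L2 d} (hg : g ≠ 0) (M : Phase d ≃L[ℝ] Phase d) :
    DenseRange (Finsupp.linearCombination ℂ fun z => weyl (M z) g) := by
  have h : (LinearMap.range
      (Finsupp.linearCombination ℂ fun z => weyl (M z) g)).topologicalClosure = ⊤ := by
    refine closed_submodule_eq_top hg (Submodule.isClosed_topologicalClosure _) fun z => ?_
    refine Submodule.le_topologicalClosure _ ⟨Finsupp.single (M.symm z) 1, ?_⟩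
    simp
  have := Submodule.dense_iff_topologicalClosure_eq_top.2 h
  rwa [LinearMap.coe_range] at this

/-- Every linear symplectic map of phase space is implemented by a unitary operator, which may be
chosen to commute with the parity. -/
theorem exists_intertwines (M : Phase d ≃L[ℝ] Phase d)
    (hM : ∀ z w, sform (M z) (M w) = sform z w) :
    ∃ U : L2 d ≃ₗᵢ[ℂ] L2 d, Intertwines M U ∧ ∀ k, U (parity k) = parity (U k) := by
  set g : L2 d := gproj (M : Phase d →L[ℝ] Phase d) phi with hgdef
  have hMs : ∀ z w, sform ((M : Phase d →L[ℝ] Phase d) z) ((M : Phase d →L[ℝ] Phase d) w) =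
    sform z w := hM
  have h0 : ⟪phi, g⟫_ℂ ≠ 0 := inner_phi_gproj_phi_ne_zero _
  have hg : g ≠ 0 := fun h => h0 (by rw [h, inner_zero_right])
  -- By self-adjointness the left side is ⟨φ, Q W(Mw) Q φ⟩, a constant times exp(-|w|²/4). Taking w
  -- = 0 identifies the constant as ‖g‖².
  have gram0 : ∀ w, ⟪g, weyl (M w) g⟫_ℂ = (‖g‖ ^ 2 : ℝ) * gweight w := by
    have h1 : ∀ w, ⟪g, weyl (M w) g⟫_ℂ = gconst d * gweight w * ⟪phi, g⟫_ℂ := fun w => by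
      have := gproj_weyl_gproj hMs w phi
      rw [hgdef, inner_gproj_left]
      refine (congrArg (fun v => ⟪phi, v⟫_ℂ) this).trans ?_
      rw [inner_smul_right]
    have h2 := h1 0
    rw [map_zero, weyl_zero, inner_self_eq_norm_sq_to_K] at h2
    intro w
    rw [h1]
    simp only [gweight, norm_zero] at h2 ⊢
    simp at h2
    push_cast
    rw [h2]
    ring
  -- Normalization giving c • g the norm of φ, so that the two Gram matrices agree.
  set c : ℂ := ((‖(phi : L2 d)‖ / ‖g‖ : ℝ) : ℂ) with hc
  have hc0 : c ≠ 0 := by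
    rw [hc]
    exact_mod_cast div_ne_zero (norm_ne_zero_iff.2 phi_ne_zero) (norm_ne_zero_iff.2 hg)
  have hcg : c • g ≠ 0 := smul_ne_zero hc0 hg
  have gram : ∀ z w, ⟪weyl (M z) (c • g), weyl (M w) (c • g)⟫_ℂ =
      ⟪weyl z phi, weyl w (phi : L2 d)⟫_ℂ := by
    intro z w
    rw [inner_weyl_left, weyl_weyl, inner_smul_right, sform_neg_left, hM, ← map_neg, ← map_add,
      map_smul, inner_smul_left, inner_smul_right, gram0, inner_weyl_phi_weyl_phi, hc,
      Complex.conj_ofReal, neg_add_eq_sub, gweight]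
    have : (‖g‖ : ℂ) ≠ 0 := by exact_mod_cast norm_ne_zero_iff.2 hg
    push_cast
    rw [neg_div]
    field_simp
  set e₁ := Finsupp.linearCombination ℂ fun z => weyl z (phi : L2 d)
  set e₂ := Finsupp.linearCombination ℂ fun z => weyl (M z) (c • g)
  have d₁ : DenseRange e₁ :=
    denseRange_linearCombination_weyl phi_ne_zero (ContinuousLinearEquiv.refl ℝ (Phase d))
  have d₂ : DenseRange e₂ := denseRange_linearCombination_weyl hcg M
  -- Equal Gram matrices give equal norms of formal linear combinations, so the correspondence W(z)φ
  -- ↦ W(Mz)(c g) is a well-defined isometry between dense subspaces.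
  have hn : ∀ x, ‖e₂ (LinearEquiv.refl ℂ (Phase d →₀ ℂ) x)‖ = ‖e₁ x‖ := by
    intro x
    have : ⟪e₂ x, e₂ x⟫_ℂ = ⟪e₁ x, e₁ x⟫_ℂ := by
      simp only [e₁, e₂, inner_linearCombination, gram]
    rw [LinearEquiv.refl_apply, @norm_eq_sqrt_re_inner ℂ, @norm_eq_sqrt_re_inner ℂ, this]
  let U := LinearEquiv.extendOfIsometry (LinearEquiv.refl ℂ (Phase d →₀ ℂ)) e₁ e₂ d₁ d₂ hn
  have hU : ∀ z, U (weyl z phi) = weyl (M z) (c • g) := by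
    intro z
    have := LinearEquiv.extendOfIsometry_eq (LinearEquiv.refl ℂ (Phase d →₀ ℂ)) e₁ e₂ d₁ d₂ hn
      (Finsupp.single z 1)
    rw [LinearEquiv.refl_apply, Finsupp.linearCombination_single,
      Finsupp.linearCombination_single, one_smul, one_smul] at this
    exact this
  have hU0 : U phi = c • g := by simpa using hU 0
  refine ⟨U, fun z k => ?_, fun k => ?_⟩
  · let S := LinearMap.ker (U.toContinuousLinearEquiv.toContinuousLinearMap ∘L
      (weyl z).toContinuousLinearMap - (weyl (M z)).toContinuousLinearMap ∘L
      U.toContinuousLinearEquiv.toContinuousLinearMap).toLinearMap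
    have hS : S = ⊤ := by
      refine closed_submodule_eq_top phi_ne_zero (ContinuousLinearMap.isClosed_ker _) fun w => ?_
      rw [LinearMap.mem_ker]
      refine sub_eq_zero.2 ?_
      change U (weyl z (weyl w phi)) = weyl (M z) (U (weyl w phi))
      rw [weyl_weyl, map_smul, hU, hU, weyl_weyl, hM, map_add]
    have : k ∈ S := hS ▸ Submodule.mem_top
    exact sub_eq_zero.1 (LinearMap.mem_ker.1 this)
  · let S := LinearMap.ker (U.toContinuousLinearEquiv.toContinuousLinearMap ∘L
      parity.toContinuousLinearMap - parity.toContinuousLinearMap ∘L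
      U.toContinuousLinearEquiv.toContinuousLinearMap).toLinearMap
    have hS : S = ⊤ := by
      refine closed_submodule_eq_top phi_ne_zero (ContinuousLinearMap.isClosed_ker _) fun w => ?_
      rw [LinearMap.mem_ker]
      refine sub_eq_zero.2 ?_
      change U (parity (weyl w phi)) = parity (U (weyl w phi))
      rw [parity_weyl, parity_phi, hU, hU, parity_weyl, map_neg, map_smul parity, hgdef,
        parity_gproj_phi]
    have : k ∈ S := hS ▸ Submodule.mem_top
    exact sub_eq_zero.1 (LinearMap.mem_ker.1 this)

/-! ### Symplectic matrices acting on phase space -/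

lemma phaseMap_mul (A B : Matrix (Fin d ⊕ Fin d) (Fin d ⊕ Fin d) ℝ) (z : Phase d) :
    phaseMap A (phaseMap B z) = phaseMap (A * B) z := by
  simp [phaseMap, Matrix.mulVec_mulVec]

/-- The action of a symplectic matrix on phase space. -/
def phaseEquiv (χ : Matrix.symplecticGroup (Fin d) ℝ) : Phase d ≃L[ℝ] Phase d :=
  LinearEquiv.toContinuousLinearEquiv
    { toFun := phaseMap χ.1
      invFun := phaseMap (χ⁻¹).1
      map_add' := fun z w => by simp [phaseMap, Matrix.mulVec_add]
      map_smul' := fun c z => by simp [phaseMap, Matrix.mulVec_smul]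
      left_inv := fun z => by
        have : (χ⁻¹).1 * χ.1 = 1 := congrArg Subtype.val (inv_mul_cancel χ)
        rw [phaseMap_mul, this]; simp [phaseMap]
      right_inv := fun z => by
        have : χ.1 * (χ⁻¹).1 = 1 := congrArg Subtype.val (mul_inv_cancel χ)
        rw [phaseMap_mul, this]; simp [phaseMap] }

lemma phaseEquiv_apply (χ : Matrix.symplecticGroup (Fin d) ℝ) (z : Phase d) :
    phaseEquiv χ z = phaseMap χ.1 z := rfl

lemma sform_eq_dotProduct (z w : Phase d) :
    sform z w = z.ofLp ⬝ᵥ (Matrix.J (Fin d) ℝ).mulVec w.ofLp := by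
  simp only [sform, PiLp.inner_apply, dotProduct, Fintype.sum_sum_type, Matrix.J]
  simp [Matrix.mulVec, dotProduct, Fintype.sum_sum_type, Matrix.one_apply, mul_comm]
  ring

lemma sform_phaseEquiv (χ : Matrix.symplecticGroup (Fin d) ℝ) (z w : Phase d) :
    sform (phaseEquiv χ z) (phaseEquiv χ w) = sform z w := by
  rw [sform_eq_dotProduct, sform_eq_dotProduct, phaseEquiv_apply, phaseEquiv_apply]
  have h := SymplecticGroup.mem_iff'.1 χ.2
  simp only [phaseMap, Matrix.mulVec_mulVec]
  rw [Matrix.dotProduct_mulVec, Matrix.vecMul_mulVec, ← Matrix.mul_assoc, h,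
    ← Matrix.dotProduct_mulVec]

lemma measurePreserving_phaseEquiv (χ : Matrix.symplecticGroup (Fin d) ℝ) :
    MeasurePreserving (phaseEquiv χ) volume volume := by
  have hd : χ.1.det ≠ 0 := by
    rw [SymplecticGroup.det_eq_one χ.2]; exact one_ne_zero
  have h1 := PiLp.volume_preserving_ofLp (Fin d ⊕ Fin d)
  have h2 : MeasurePreserving (Matrix.toLin' χ.1) (volume : Measure (Fin d ⊕ Fin d → ℝ)) volume := by
    refine ⟨(Matrix.toLin' χ.1).continuous_of_finiteDimensional.measurable, ?_⟩
    rw [Real.map_matrix_volume_pi_eq_smul_volume_pi hd, SymplecticGroup.det_eq_one χ.2]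
    simp
  exact (PiLp.volume_preserving_toLp (Fin d ⊕ Fin d)).comp (h2.comp h1)

end

end Metaplectic

/-! ### Metaplectic covariance expressed through Weyl operators. -/

namespace Metaplectic

noncomputable section

open Complex (I)
open scoped ComplexConjugate InnerProductSpace FourierTransform ContDiff

variable {d : ℕ}

/-! ### Weyl quantization as a superposition of Weyl operators -/

/-- Fubini with the Gaussian as the second vector; the Gaussian vanishes nowhere and can be divided
out. -/
lemma ae_integrable_mul_weylFun {F : Phase d → ℂ} (hF : Integrable F) (k : L2 d) :
    ∀ᵐ x, Integrable fun z => F z * weylFun z k x := by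
  have h := (integrable_prod_weylFun hF phi k).prod_left_ae
  filter_upwards [h, coeFn_phi] with x hx hx'
  have h0 : conj ((phi : L2 d) x) ≠ 0 := by
    rw [hx', conj_gauss]; exact Complex.exp_ne_zero _
  refine (hx.const_mul (conj ((phi : L2 d) x))⁻¹).congr (Filter.Eventually.of_forall fun z => ?_)
  simp only
  field_simp

/-- The operator `a^w(x, D)` on `L²`. -/
def quant (a : Phase d → ℂ) (f : L2 d) : L2 d :=
  ((4 * Real.pi : ℝ) : ℂ) ^ (-(d : ℤ)) • ∫ z, a ((1 / 2 : ℝ) • z) • weyl z (parity f)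

/-- With z = (x+y, 2ξ) the Weyl phase at x is exp(i⟨x-y,ξ⟩) and the reflected, translated f takes
the value f(y). The Jacobian 2^d of the momentum scaling turns (4π)^{-d} into (2π)^{-d}. -/
lemma weylOp_ae_eq {a : Phase d → ℂ} (ha : Integrable a) (f : L2 d) :
    quant a f =ᵐ[volume] weylOp a f := by
  have hF : Integrable fun z : Phase d => a ((1 / 2 : ℝ) • z) :=
    ha.comp_smul (by norm_num)
  refine (Lp.coeFn_smul _ _).trans ?_
  filter_upwards [coeFn_integral_weyl hF (parity f), ae_integrable_mul_weylFun hF (parity f)]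
    with x hx hxi
  rw [Pi.smul_apply, hx, integral_phase_symm _ hxi]
  let G : Space d → ℂ := fun ξ => ∫ y : Space d,
    Complex.exp (Complex.I * (inner ℝ (x - y) ξ : ℝ)) *
        a (phasePoint ((1 / 2 : ℝ) • (x + y)) ξ) * f y
  have hG : ∀ η : Space d, ∫ y : Space d, a ((1 / 2 : ℝ) • phasePoint y η) *
      weylFun (phasePoint y η) (parity f) x = G ((1 / 2 : ℝ) • η) := by
    intro η
    have e1 : (fun y : Space d => a ((1 / 2 : ℝ) • phasePoint y η) *
        weylFun (phasePoint y η) (parity f) x) =ᵐ[volume]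
        fun y => a ((1 / 2 : ℝ) • phasePoint y η) * (weylPhase (phasePoint y η) x * f (y - x)) := by
      have := (Measure.measurePreserving_sub_left (volume : Measure (Space d)) x
        ).quasiMeasurePreserving.ae_eq_comp (coeFn_parity f)
      filter_upwards [this] with y hy
      rw [weylFun, pos_phasePoint]
      congr 2
      refine Eq.trans hy ?_
      simp
    rw [integral_congr_ae e1, ← integral_add_right_eq_self _ x]
    congr 1; ext y
    rw [add_sub_cancel_right]
    have e2 : (1 / 2 : ℝ) • phasePoint (y + x) η =
        phasePoint ((1 / 2 : ℝ) • (x + y)) ((1 / 2 : ℝ) • η) := by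
      ext i; rcases i with i | i <;> simp [phasePoint, add_comm, mul_add]
    rw [e2, weylPhase, pos_phasePoint, mom_phasePoint, ← mul_assoc, mul_comm (a _)]
    congr 3
    rw [mul_comm]
    congr 2
    rw [inner_add_left, inner_smul_right, inner_sub_left, real_inner_comm η x, real_inner_comm η y]
    ring
  simp_rw [hG]
  rw [Measure.integral_comp_smul, weylOp, smul_eq_mul]
  have e3 : |((1 / 2 : ℝ) ^ Module.finrank ℝ (Space d))⁻¹| = 2 ^ d := by
    rw [finrank_euclideanSpace, Fintype.card_fin, abs_of_nonneg (by positivity)]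
    simp
  rw [e3, Complex.real_smul, ← mul_assoc]
  congr 1
  have : (Real.pi : ℂ) ≠ 0 := by exact_mod_cast Real.pi_ne_zero
  push_cast
  rw [show (4 : ℂ) = 2 * 2 by norm_num, mul_assoc, mul_zpow (2 : ℂ) (2 * Real.pi), zpow_neg,
    zpow_neg, zpow_natCast, zpow_natCast]
  field_simp

lemma eq_quant_iff {a : Phase d → ℂ} (ha : Integrable a) (f g : L2 d) :
    (g =ᵐ[volume] weylOp a f) ↔ g = quant a f :=
  ⟨fun h => Lp.ext (h.trans (weylOp_ae_eq ha f).symm), fun h => h ▸ weylOp_ae_eq ha f⟩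

lemma quant_comp_phaseEquiv (χ : Matrix.symplecticGroup (Fin d) ℝ) (a : Phase d → ℂ) (f : L2 d) :
    quant (fun z => a (phaseMap χ.1 z)) f = ((4 * Real.pi : ℝ) : ℂ) ^ (-(d : ℤ)) •
      ∫ z, a ((1 / 2 : ℝ) • z) • weyl ((phaseEquiv χ).symm z) (parity f) := by
  rw [quant]
  congr 1
  refine Eq.trans ?_ ((measurePreserving_phaseEquiv χ).integral_comp
    (phaseEquiv χ).toHomeomorph.measurableEmbedding
    fun z => a ((1 / 2 : ℝ) • z) • weyl ((phaseEquiv χ).symm z) (parity f))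
  congr 1; ext1 z
  rw [ContinuousLinearEquiv.symm_apply_apply, ← phaseEquiv_apply, map_smul]

lemma integrable_comp_phaseMap (χ : Matrix.symplecticGroup (Fin d) ℝ) {a : Phase d → ℂ}
    (ha : Integrable a) : Integrable fun z => a (phaseMap χ.1 z) :=
  ((measurePreserving_phaseEquiv χ).integrable_comp_emb
    (phaseEquiv χ).toHomeomorph.measurableEmbedding).2 ha

lemma map_integral_smul_weyl (U : L2 d ≃ₗᵢ[ℂ] L2 d) {M : Phase d → Phase d} (hM : Continuous M)
    {F : Phase d → ℂ} (hF : Integrable F) (k : L2 d) :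
    U (∫ z, F z • weyl (M z) k) = ∫ z, F z • U (weyl (M z) k) := by
  have := U.toContinuousLinearEquiv.toContinuousLinearMap.integral_comp_comm
    (integrable_smul_weyl_comp hM hF k)
  refine this.symm.trans ?_
  congr 1; ext1 z
  exact map_smul U _ _

lemma isMetaplectic_of_intertwines {χ : Matrix.symplecticGroup (Fin d) ℝ} {U : L2 d ≃ₗᵢ[ℂ] L2 d}
    (hU : Intertwines (phaseEquiv χ) U) (hP : ∀ k, U (parity k) = parity (U k)) :
    IsMetaplectic χ U := by
  intro a f g
  have ha : Integrable a := a.integrable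
  have hF : Integrable fun z : Phase d => a ((1 / 2 : ℝ) • z) := ha.comp_smul (by norm_num)
  rw [eq_quant_iff (integrable_comp_phaseMap χ ha), eq_quant_iff ha]
  have key : U (quant (fun z => a (phaseMap χ.1 z)) f) = quant a (U f) := by
    rw [quant_comp_phaseEquiv, map_smul, quant,
      map_integral_smul_weyl U (phaseEquiv χ).symm.continuous hF]
    congr 2; ext1 z
    rw [hU, ContinuousLinearEquiv.apply_symm_apply, hP]
  rw [← key, U.injective.eq_iff]

/-- Metaplectic operators exist. -/
theorem exists_isMetaplectic (χ : Matrix.symplecticGroup (Fin d) ℝ) :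
    ∃ U : L2 d ≃ₗᵢ[ℂ] L2 d, IsMetaplectic χ U := by
  obtain ⟨U, hU, hP⟩ := exists_intertwines (phaseEquiv χ) (sform_phaseEquiv χ)
  exact ⟨U, isMetaplectic_of_intertwines hU hP⟩

/-- Metaplectic operators intertwine the Weyl operators. -/
theorem IsMetaplectic.intertwines {χ : Matrix.symplecticGroup (Fin d) ℝ} {U : L2 d ≃ₗᵢ[ℂ] L2 d}
    (hU : IsMetaplectic χ U) : Intertwines (phaseEquiv χ) U := by
  -- Both sides are continuous in z, and the metaplectic identity says that their integrals against
  -- a(z/2) agree for every Schwartz a. Hence they agree for every z.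
  have key : ∀ f z, U (weyl ((phaseEquiv χ).symm z) (parity f)) = weyl z (parity (U f)) := by
    intro f
    have hc1 : Continuous fun z => U (weyl ((phaseEquiv χ).symm z) (parity f)) :=
      U.continuous.comp ((continuous_weyl _).comp (phaseEquiv χ).symm.continuous)
    have hc2 : Continuous fun z => weyl z (parity (U f)) := continuous_weyl _
    have hae := ae_eq_of_integral_contDiff_smul_eq (hc1.locallyIntegrable (μ := volume))
      hc2.locallyIntegrable fun g hg hgc => ?_
    · exact fun z => congrFun ((hc1.ae_eq_iff_eq volume hc2).1 hae) z
    -- The symbol is the test function dilated by 2, to undo the factor 1/2 in the quantization.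
    · have hg2 : HasCompactSupport fun z => ((g ((2 : ℝ) • z) : ℝ) : ℂ) :=
        (hgc.comp_smul (two_ne_zero (α := ℝ))).comp_left Complex.ofReal_zero
      let a : 𝓢(Phase d, ℂ) := hg2.toSchwartzMap
        (Complex.ofRealCLM.contDiff.comp (hg.comp (contDiff_const_smul 2)))
      have ha2 : ∀ z, a ((1 / 2 : ℝ) • z) = g z := fun z => by
        change ((g ((2 : ℝ) • (1 / 2 : ℝ) • z) : ℝ) : ℂ) = g z
        rw [smul_smul]; norm_num
      have ha : Integrable a := a.integrable
      have hF : Integrable fun z : Phase d => a ((1 / 2 : ℝ) • z) := ha.comp_smul (by norm_num)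
      have h1 := (hU a f (quant (fun z => a (phaseMap χ.1 z)) f)).1
        (weylOp_ae_eq (integrable_comp_phaseMap χ ha) f)
      rw [eq_quant_iff ha, quant_comp_phaseEquiv, map_smul, quant,
        map_integral_smul_weyl U (phaseEquiv χ).symm.continuous hF] at h1
      have h2 := smul_right_injective (L2 d) (zpow_ne_zero _ (by
        exact_mod_cast (by positivity : (4 * Real.pi : ℝ) ≠ 0))) h1
      simp only [ha2] at h2
      have e : ∀ (r : ℝ) (v : L2 d), r • v = (r : ℂ) • v := fun r v =>
        (Complex.coe_smul r v).symm
      simp_rw [e]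
      exact h2
  intro z k
  -- The value z = 0 shows that U commutes with the parity, which can then be removed from the
  -- general identity.
  have hP : ∀ f, U (parity f) = parity (U f) := fun f => by simpa using key f 0
  have := key (parity k) (phaseEquiv χ z)
  rwa [ContinuousLinearEquiv.symm_apply_apply, parity_parity, ← hP, parity_parity] at this

end

end Metaplectic

/-! ### Differentiation under the integral and derivative bounds for coherent states. -/

namespace Metaplectic

noncomputable section

open Complex (I)
open scoped ComplexConjugate InnerProductSpace ContDiff Nat

variable {d : ℕ}

/-! ### Differentiation of integrals depending on a parameter -/

section Parametric

variable {Z E : Type} [NormedAddCommGroup Z] [NormedSpace ℝ Z] [NormedAddCommGroup E]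
  [NormedSpace ℝ E]

lemma continuous_of_jointly_contDiff {G : Type} [NormedAddCommGroup G] [NormedSpace ℝ G]
    {Ψ : Z → E → G} (hΨ : ContDiff ℝ ∞ fun p : Z × E => Ψ p.1 p.2) (x : E) :
    Continuous fun z => Ψ z x := by
  change Continuous ((fun p : Z × E => Ψ p.1 p.2) ∘ fun z => (z, x))
  exact hΨ.continuous.comp (Continuous.prodMk_left x)

lemma contDiff_of_jointly_contDiff {G : Type} [NormedAddCommGroup G] [NormedSpace ℝ G]
    {Ψ : Z → E → G} (hΨ : ContDiff ℝ ∞ fun p : Z × E => Ψ p.1 p.2) (z : Z) :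
    ContDiff ℝ ∞ (Ψ z) := by
  change ContDiff ℝ ∞ ((fun p : Z × E => Ψ p.1 p.2) ∘ fun x => (z, x))
  exact hΨ.comp (contDiff_prodMk_right z)

lemma contDiff_fderiv_of_jointly_contDiff {G : Type} [NormedAddCommGroup G] [NormedSpace ℝ G]
    {Ψ : Z → E → G} (hΨ : ContDiff ℝ ∞ fun p : Z × E => Ψ p.1 p.2) :
    ContDiff ℝ ∞ fun p : Z × E => fderiv ℝ (Ψ p.1) p.2 := by
  refine ContDiff.fderiv (m := ∞) (f := fun p : Z × E => Ψ p.1)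
    (g := fun p => p.2) ?_ contDiff_snd (by simp)
  exact hΨ.comp ((contDiff_fst.comp contDiff_fst).prodMk contDiff_snd)

lemma continuous_iteratedFDeriv_apply_of_jointly_contDiff (n : ℕ) :
    ∀ {G : Type} [NormedAddCommGroup G] [NormedSpace ℝ G] {Ψ : Z → E → G}
    (_ : ContDiff ℝ ∞ fun p : Z × E => Ψ p.1 p.2) (x : E) (m : Fin n → E),
    Continuous fun z => iteratedFDeriv ℝ n (Ψ z) x m := by
  induction n with
  | zero =>
    intro G _ _ Ψ hΨ x m
    simpa using continuous_of_jointly_contDiff hΨ x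
  | succ n ih =>
    intro G _ _ Ψ hΨ x m
    simp only [iteratedFDeriv_succ_apply_right]
    exact (ih (G := E →L[ℝ] G) (Ψ := fun z y => fderiv ℝ (Ψ z) y)
      (contDiff_fderiv_of_jointly_contDiff hΨ) x (Fin.init m)).clm_apply continuous_const

variable [MeasurableSpace Z] [BorelSpace Z] [SecondCountableTopology Z] {μ : Measure Z}

/-- Differentiation under the integral sign. -/
lemma hasFDerivAt_integral_smul {G : Type} [NormedAddCommGroup G] [NormedSpace ℝ G]
    [NormedSpace ℂ G] [SMulCommClass ℝ ℂ G] {Ψ : Z → E → G}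
    (hΨ : ContDiff ℝ ∞ fun p : Z × E => Ψ p.1 p.2) {F : Z → ℂ} (hF : AEStronglyMeasurable F μ)
    {b : ℕ → Z → ℝ} (hb : ∀ n, Integrable (b n) μ)
    (hle : ∀ n z x, ‖F z‖ * ‖iteratedFDeriv ℝ n (Ψ z) x‖ ≤ b n z) (x : E) :
    HasFDerivAt (fun x => ∫ z, F z • Ψ z x ∂μ) (∫ z, F z • fderiv ℝ (Ψ z) x ∂μ) x := by
  have h0 : ∀ z x, ‖F z • Ψ z x‖ ≤ b 0 z := fun z x => by
    have := hle 0 z x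
    rwa [norm_iteratedFDeriv_zero, ← norm_smul] at this
  have h1 : ∀ z x, ‖F z • fderiv ℝ (Ψ z) x‖ ≤ b 1 z := fun z x => by
    have := hle 1 z x
    rwa [← zero_add 1, ← norm_iteratedFDeriv_fderiv, norm_iteratedFDeriv_zero,
      ← norm_smul] at this
  have m0 : ∀ x, AEStronglyMeasurable (fun z => F z • Ψ z x) μ := fun x =>
    hF.smul (continuous_of_jointly_contDiff hΨ x).aestronglyMeasurable
  have m1 : ∀ x, AEStronglyMeasurable (fun z => F z • fderiv ℝ (Ψ z) x) μ := fun x =>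
    hF.smul (continuous_of_jointly_contDiff
      (contDiff_fderiv_of_jointly_contDiff hΨ) x).aestronglyMeasurable
  refine hasFDerivAt_integral_of_dominated_of_fderiv_le (μ := μ) (𝕜 := ℝ)
    (F := fun x z => F z • Ψ z x) (F' := fun x z => F z • fderiv ℝ (Ψ z) x) (x₀ := x)
    (bound := b 1) (s := Set.univ) Filter.univ_mem
    (Filter.Eventually.of_forall m0)
    ((hb 0).mono' (m0 x) (Filter.Eventually.of_forall fun z => h0 z x)) (m1 x)
    (Filter.Eventually.of_forall fun z x _ => h1 z x) (hb 1)
    (Filter.Eventually.of_forall fun z x _ => ?_)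
  exact (((contDiff_of_jointly_contDiff hΨ z).differentiable (by simp) x).hasFDerivAt).const_smul
    (F z)

/-- Induction on n through the first derivative, which takes values in E →L[ℝ] G. The target space
and the bounds must therefore vary in the induction; the bounds shift by one index. -/
lemma contDiff_integral_smul (n : ℕ) {F : Z → ℂ} (hF : AEStronglyMeasurable F μ) :
    ∀ {G : Type} [NormedAddCommGroup G] [NormedSpace ℝ G] [NormedSpace ℂ G] [SMulCommClass ℝ ℂ G]
    [CompleteSpace G] {Ψ : Z → E → G} (_ : ContDiff ℝ ∞ fun p : Z × E => Ψ p.1 p.2)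
    {b : ℕ → Z → ℝ} (_ : ∀ n, Integrable (b n) μ)
    (_ : ∀ n z x, ‖F z‖ * ‖iteratedFDeriv ℝ n (Ψ z) x‖ ≤ b n z),
    ContDiff ℝ n (fun x => ∫ z, F z • Ψ z x ∂μ) ∧ ∀ (x : E) (m : Fin n → E),
      iteratedFDeriv ℝ n (fun x => ∫ z, F z • Ψ z x ∂μ) x m =
        ∫ z, F z • iteratedFDeriv ℝ n (Ψ z) x m ∂μ := by
  induction n with
  | zero =>
    intro G _ _ _ _ _ Ψ hΨ b hb hle
    refine ⟨?_, fun x m => by simp⟩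
    rw [Nat.cast_zero, contDiff_zero]
    exact continuous_iff_continuousAt.2 fun x =>
      (hasFDerivAt_integral_smul hΨ hF hb hle x).continuousAt
  | succ n ih =>
    intro G _ _ _ _ _ Ψ hΨ b hb hle
    have hder := hasFDerivAt_integral_smul hΨ hF hb hle
    have hf : fderiv ℝ (fun x => ∫ z, F z • Ψ z x ∂μ) =
      fun x => ∫ z, F z • fderiv ℝ (Ψ z) x ∂μ := funext fun x => (hder x).fderiv
    obtain ⟨ih1, ih2⟩ := ih (G := E →L[ℝ] G) (Ψ := fun z y => fderiv ℝ (Ψ z) y)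
      (contDiff_fderiv_of_jointly_contDiff hΨ) (b := fun n => b (n + 1)) (fun n => hb (n + 1))
      (fun n z x => by rw [norm_iteratedFDeriv_fderiv]; exact hle (n + 1) z x)
    refine ⟨?_, fun x m => ?_⟩
    · rw [Nat.cast_add, Nat.cast_one, contDiff_succ_iff_fderiv]
      refine ⟨fun x => (hder x).differentiableAt, by simp, ?_⟩
      rw [hf]
      exact ih1
    · rw [iteratedFDeriv_succ_apply_right, hf, ih2]
      have hm : Continuous fun z => iteratedFDeriv ℝ n (fun y => fderiv ℝ (Ψ z) y) x (Fin.init m) :=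
        continuous_iteratedFDeriv_apply_of_jointly_contDiff n (G := E →L[ℝ] G)
          (Ψ := fun z y => fderiv ℝ (Ψ z) y)
          (contDiff_fderiv_of_jointly_contDiff hΨ) x (Fin.init m)
      have hi : Integrable (fun z => F z • iteratedFDeriv ℝ n (fun y => fderiv ℝ (Ψ z) y) x
          (Fin.init m)) μ := by
        refine ((hb (n + 1)).mul_const (∏ i, ‖Fin.init m i‖)).mono'
          (hF.smul hm.aestronglyMeasurable) (Filter.Eventually.of_forall fun z => ?_)
        rw [norm_smul]
        have h1 := (iteratedFDeriv ℝ n (fun y => fderiv ℝ (Ψ z) y) x).le_opNorm (Fin.init m)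
        have h2 := hle (n + 1) z x
        rw [← norm_iteratedFDeriv_fderiv] at h2
        calc _ ≤ ‖F z‖ * (‖iteratedFDeriv ℝ n (fun y => fderiv ℝ (Ψ z) y) x‖ *
              ∏ i, ‖Fin.init m i‖) := by gcongr
          _ = ‖F z‖ * ‖iteratedFDeriv ℝ n (fun y => fderiv ℝ (Ψ z) y) x‖ *
              ∏ i, ‖Fin.init m i‖ := by ring
          _ ≤ _ := by gcongr
      rw [ContinuousLinearMap.integral_apply hi]
      congr 1; ext1 z
      rw [iteratedFDeriv_succ_apply_right]
      rfl

end Parametric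

/-! ### The translated and modulated Gaussians -/

/-- The function `W(z) exp(-|·|²/2)`. -/
def coherent (z : Phase d) : Space d → ℂ := weylFun z gauss

/-- The exponent of a coherent state. -/
def cexponent (z : Phase d) (x : Space d) : ℂ :=
  ((⟪mom z, x⟫_ℝ - ⟪pos z, mom z⟫_ℝ / 2 : ℝ) : ℂ) * I + (-(‖x - pos z‖ ^ 2 / 2) : ℝ)

lemma coherent_eq (z : Phase d) : coherent z = Complex.exp ∘ cexponent z := by
  ext x
  simp [coherent, weylFun, weylPhase, gauss, cexponent, Complex.exp_add]

lemma norm_coherent (z : Phase d) (x : Space d) :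
    ‖coherent z x‖ = Real.exp (-(‖x - pos z‖ ^ 2 / 2)) := by
  rw [coherent, weylFun, norm_mul, norm_weylPhase, one_mul, norm_gauss]

lemma contDiff_cexponent : ContDiff ℝ ∞ fun p : Phase d × Space d => cexponent p.1 p.2 := by
  unfold cexponent
  have h1 : ContDiff ℝ ∞ fun p : Phase d × Space d => ‖p.2 - pos p.1‖ ^ 2 :=
    (contDiff_snd.sub (pos.contDiff.comp contDiff_fst)).norm_sq ℝ
  have h2 : ContDiff ℝ ∞ fun p : Phase d × Space d => ⟪mom p.1, p.2⟫_ℝ :=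
    (mom.contDiff.comp contDiff_fst).inner ℝ contDiff_snd
  have h3 : ContDiff ℝ ∞ fun p : Phase d × Space d => ⟪pos p.1, mom p.1⟫_ℝ :=
    (pos.contDiff.comp contDiff_fst).inner ℝ (mom.contDiff.comp contDiff_fst)
  refine ContDiff.add (ContDiff.mul (Complex.ofRealCLM.contDiff.comp ?_) contDiff_const)
    (Complex.ofRealCLM.contDiff.comp ?_)
  · exact h2.sub (h3.div_const 2)
  · exact (h1.div_const 2).neg

lemma contDiff_coherent : ContDiff ℝ ∞ fun p : Phase d × Space d => coherent p.1 p.2 := by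
  have : (fun p : Phase d × Space d => coherent p.1 p.2) =
      fun p => Complex.exp (cexponent p.1 p.2) := by ext p; rw [coherent_eq]; rfl
  rw [this]
  exact contDiff_cexponent.cexp

lemma contDiff_cexponent_right (z : Phase d) : ContDiff ℝ ∞ (cexponent z) := by
  change ContDiff ℝ ∞ ((fun p : Phase d × Space d => cexponent p.1 p.2) ∘ fun x => (z, x))
  exact contDiff_cexponent.comp (contDiff_prodMk_right z)

lemma contDiff_coherent_right (z : Phase d) : ContDiff ℝ ∞ (coherent z) := by
  change ContDiff ℝ ∞ ((fun p : Phase d × Space d => coherent p.1 p.2) ∘ fun x => (z, x))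
  exact contDiff_coherent.comp (contDiff_prodMk_right z)

/-- The exponent is a quadratic polynomial in x, so its derivative is affine with linear part
-⟨·,·⟩. Vanishing of the third derivative cuts the Leibniz sum for coherent states down to two
terms. -/
lemma norm_fderiv_cexponent_le (z : Phase d) (x : Space d) :
    ‖fderiv ℝ (cexponent z) x‖ ≤ ‖x - pos z‖ + ‖mom z‖ ∧
      ‖fderiv ℝ (fderiv ℝ (cexponent z)) x‖ ≤ 1 ∧
      fderiv ℝ (fderiv ℝ (fderiv ℝ (cexponent z))) = 0 := by
  let A : Space d →L[ℝ] Space d →L[ℝ] ℂ :=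
    -((ContinuousLinearMap.compL ℝ (Space d) ℝ ℂ Complex.ofRealCLM) ∘L (innerSL ℝ))
  have hA : ∀ v u, A v u = -(⟪v, u⟫_ℝ : ℂ) := fun v u => rfl
  have hAn : ‖A‖ ≤ 1 := by
    refine ContinuousLinearMap.opNorm_le_bound _ zero_le_one fun v => ?_
    refine ContinuousLinearMap.opNorm_le_bound _ (by positivity) fun u => ?_
    rw [hA, norm_neg, Complex.norm_real, one_mul]
    exact norm_inner_le_norm v u
  let B : Space d →L[ℝ] ℂ := I • (Complex.ofRealCLM ∘L (innerSL ℝ (mom z)))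
  have hB : ∀ u, B u = I * (⟪mom z, u⟫_ℝ : ℂ) := fun u => rfl
  have hBn : ‖B‖ ≤ ‖mom z‖ := by
    refine ContinuousLinearMap.opNorm_le_bound _ (norm_nonneg _) fun u => ?_
    rw [hB, norm_mul, Complex.norm_I, one_mul, Complex.norm_real]
    exact norm_inner_le_norm _ u
  have h1 : fderiv ℝ (cexponent z) = fun x => A x + (B - A (pos z)) := by
    ext1 x
    refine HasFDerivAt.fderiv ?_
    unfold cexponent
    have e1 : HasFDerivAt (fun x : Space d => (⟪mom z, x⟫_ℝ - ⟪pos z, mom z⟫_ℝ / 2 : ℝ))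
        (innerSL ℝ (mom z)) x := ((innerSL ℝ (mom z)).hasFDerivAt).sub_const _
    have e2 := (((hasFDerivAt_id x).sub_const (pos z)).norm_sq.mul_const (1 / 2 : ℝ)).neg
    have e3 := ((Complex.ofRealCLM.hasFDerivAt.comp x e1).mul_const I).add
      (Complex.ofRealCLM.hasFDerivAt.comp x e2)
    refine (e3.congr_of_eventuallyEq (Filter.Eventually.of_forall fun y => ?_)).congr_fderiv ?_
    · simp [div_eq_mul_inv]
    · ext u
      simp [hA, hB]
      ring
  have h2 : fderiv ℝ (fun x => A x + (B - A (pos z))) = fun _ => A := by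
    ext1 x
    exact (A.hasFDerivAt.add_const _).fderiv
  rw [h1, h2]
  refine ⟨?_, hAn, ?_⟩
  · have : A x + (B - A (pos z)) = A (x - pos z) + B := by rw [map_sub]; abel
    simp only [this]
    refine (norm_add_le _ _).trans ?_
    have := (A.le_opNorm (x - pos z)).trans (mul_le_mul_of_nonneg_right hAn (norm_nonneg _))
    linarith
  · ext1 x
    simp

lemma fderiv_coherent (z : Phase d) :
    fderiv ℝ (coherent z) = fun x => coherent z x • fderiv ℝ (cexponent z) x := by
  ext1 x
  have h := ((contDiff_cexponent_right z).differentiable (by simp) x).hasFDerivAt.cexp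
  rw [coherent_eq]
  exact h.fderiv

/-- The three-term recursion of the Hermite functions in norm form, from the Leibniz rule applied to
the product of the coherent state with the derivative of its exponent. -/
lemma norm_iteratedFDeriv_coherent_succ_le (n : ℕ) (z : Phase d) (x : Space d) :
    ‖iteratedFDeriv ℝ (n + 2) (coherent z) x‖ ≤
      (‖x - pos z‖ + ‖mom z‖) * ‖iteratedFDeriv ℝ (n + 1) (coherent z) x‖ +
        (n + 1) * ‖iteratedFDeriv ℝ n (coherent z) x‖ := by
  obtain ⟨h1, h2, h3⟩ := norm_fderiv_cexponent_le z x
  have hc : ContDiff ℝ ∞ (fderiv ℝ (cexponent z)) :=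
    (contDiff_cexponent_right z).fderiv_right (by simp)
  rw [← norm_iteratedFDeriv_fderiv, fderiv_coherent]
  refine (norm_iteratedFDeriv_smul_le (contDiff_coherent_right z) hc x
    (by exact_mod_cast (ENat.natCast_lt_top (n + 1)).le)).trans ?_
  rw [Finset.sum_range_succ, Finset.sum_range_succ, Finset.sum_eq_zero]
  · have e1 : ‖iteratedFDeriv ℝ (n + 1 - n) (fderiv ℝ (cexponent z)) x‖ =
        ‖fderiv ℝ (fderiv ℝ (cexponent z)) x‖ := by
      rw [Nat.add_sub_cancel_left, ← norm_iteratedFDeriv_fderiv (n := 0), norm_iteratedFDeriv_zero]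
    have e2 : ‖iteratedFDeriv ℝ (n + 1 - (n + 1)) (fderiv ℝ (cexponent z)) x‖ =
        ‖fderiv ℝ (cexponent z) x‖ := by
      rw [Nat.sub_self, norm_iteratedFDeriv_zero]
    rw [e1, e2, Nat.choose_self, Nat.choose_succ_self_right]
    push_cast
    have h4 : ((n : ℝ) + 1) * ‖iteratedFDeriv ℝ n (coherent z) x‖ *
        ‖fderiv ℝ (fderiv ℝ (cexponent z)) x‖ ≤
        ((n : ℝ) + 1) * ‖iteratedFDeriv ℝ n (coherent z) x‖ :=
      mul_le_of_le_one_right (by positivity) h2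
    have h5 := mul_le_mul_of_nonneg_left h1 (norm_nonneg (iteratedFDeriv ℝ (n + 1) (coherent z) x))
    linarith
  · intro i hi
    rw [Finset.mem_range] at hi
    -- Here i < n, so at least two further derivatives fall on the affine factor and the term
    -- vanishes.
    obtain ⟨k, hk⟩ : ∃ k, n + 1 - i = k + 2 := ⟨n - 1 - i, by omega⟩
    rw [hk, ← norm_iteratedFDeriv_fderiv, ← norm_iteratedFDeriv_fderiv, h3]
    simp

/-- The shift √n solves the Hermite recursion. It contributes only √n^n, comparable to √(n!), and
this is why every s > 1/2 is admissible later. -/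
lemma norm_iteratedFDeriv_coherent_le (n : ℕ) (z : Phase d) (x : Space d) :
    ‖iteratedFDeriv ℝ n (coherent z) x‖ ≤
      (‖x - pos z‖ + ‖mom z‖ + √n) ^ n * Real.exp (-(‖x - pos z‖ ^ 2 / 2)) := by
  set l := ‖x - pos z‖ + ‖mom z‖ with hl
  have hl0 : 0 ≤ l := by positivity
  induction n using Nat.twoStepInduction with
  | zero => rw [norm_iteratedFDeriv_zero, norm_coherent, pow_zero, one_mul]
  | one =>
    rw [← norm_iteratedFDeriv_fderiv (n := 0), norm_iteratedFDeriv_zero, fderiv_coherent,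
      norm_smul, norm_coherent, mul_comm, pow_one]
    have := (norm_fderiv_cexponent_le z x).1
    gcongr
    exact this.trans (le_add_of_nonneg_right (by positivity))
  | more n ih0 ih1 =>
    refine (norm_iteratedFDeriv_coherent_succ_le n z x).trans ?_
    set e := Real.exp (-(‖x - pos z‖ ^ 2 / 2))
    have he : 0 < e := Real.exp_pos _
    set q := l + √((n + 2 : ℕ) : ℝ) with hq
    have hs : √((n + 2 : ℕ) : ℝ) ^ 2 = n + 2 := by
      rw [Real.sq_sqrt (by positivity)]; push_cast; ring
    have hs0 : 0 ≤ √((n + 2 : ℕ) : ℝ) := Real.sqrt_nonneg _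
    have hq0 : 0 ≤ q := by positivity
    have q0 : l + √(n : ℝ) ≤ q := by
      rw [hq]; gcongr; norm_num
    have q1 : l + √((n + 1 : ℕ) : ℝ) ≤ q := by
      rw [hq]; gcongr; norm_num
    -- Since q - l = √(n+2) and q ≥ √(n+2), the difference q² - lq is at least n + 2.
    have hqq : l * q + (n + 1) ≤ q ^ 2 := by
      rw [hq]; nlinarith
    calc _ ≤ l * (q ^ (n + 1) * e) + (n + 1) * (q ^ n * e) := by
          gcongr
          · exact ih1.trans (by gcongr)
          · exact ih0.trans (by gcongr)
      _ = q ^ n * e * (l * q + (n + 1)) := by ring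
      _ ≤ q ^ n * e * q ^ 2 := by gcongr
      _ = _ := by ring

/-- After squaring, this is y^n ≤ n! exp(y) at y = t²/2. -/
lemma pow_mul_exp_neg_sq_le (n : ℕ) (t : ℝ) :
    t ^ n * Real.exp (-(t ^ 2 / 4)) ≤ 2 ^ n * √(n ! : ℝ) := by
  refine abs_le_of_sq_le_sq' ?_ (by positivity) |>.2
  rw [mul_pow, mul_pow, Real.sq_sqrt (by positivity), ← Real.exp_nat_mul]
  have h := Real.pow_div_factorial_le_exp (t ^ 2 / 2) (by positivity) n
  rw [div_le_iff₀ (by positivity)] at h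
  have e1 : (t ^ n) ^ 2 = 2 ^ n * (t ^ 2 / 2) ^ n := by
    rw [← mul_pow, ← pow_mul, mul_comm n 2, pow_mul]; congr 1; ring
  have e2 : ((2 : ℕ) : ℝ) * -(t ^ 2 / 4) = -(t ^ 2 / 2) := by push_cast; ring
  rw [e1, e2]
  calc _ ≤ 2 ^ n * (Real.exp (t ^ 2 / 2) * n !) * Real.exp (-(t ^ 2 / 2)) := by gcongr
    _ = 2 ^ n * n ! * (Real.exp (t ^ 2 / 2) * Real.exp (-(t ^ 2 / 2))) := by ring
    _ = 2 ^ n * n ! := by rw [← Real.exp_add, add_neg_cancel, Real.exp_zero, mul_one]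
    _ ≤ (2 ^ n) ^ 2 * n ! := by
      gcongr
      rw [sq]
      exact le_mul_of_one_le_left (by positivity) (one_le_pow₀ (by norm_num))

/-- After squaring, n^n ≤ n! e^n and e < 9. -/
lemma sqrt_natCast_pow_le (n : ℕ) : √(n : ℝ) ^ n ≤ 3 ^ n * √(n ! : ℝ) := by
  refine abs_le_of_sq_le_sq' ?_ (by positivity) |>.2
  rw [mul_pow, Real.sq_sqrt (by positivity), ← pow_mul, mul_comm n 2, pow_mul,
    Real.sq_sqrt (by positivity)]
  have h := Real.pow_div_factorial_le_exp (n : ℝ) (by positivity) n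
  rw [div_le_iff₀ (by positivity)] at h
  refine h.trans ?_
  gcongr
  rw [← mul_one (n : ℝ), Real.exp_nat_mul, ← pow_mul, mul_comm n 2, pow_mul]
  gcongr
  have := Real.exp_one_lt_d9
  linarith

lemma add_pow_le_two_pow (a b : ℝ) (ha : 0 ≤ a) (hb : 0 ≤ b) (n : ℕ) :
    (a + b) ^ n ≤ 2 ^ n * (a ^ n + b ^ n) := by
  rcases le_total a b with h | h
  · calc (a + b) ^ n ≤ (2 * b) ^ n := by gcongr; linarith
      _ = 2 ^ n * (0 + b ^ n) := by rw [mul_pow, zero_add]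
      _ ≤ _ := by gcongr; positivity
  · calc (a + b) ^ n ≤ (2 * a) ^ n := by gcongr; linarith
      _ = 2 ^ n * (a ^ n + 0) := by rw [mul_pow, add_zero]
      _ ≤ _ := by gcongr; positivity

lemma add_pow_mul_exp_le (n : ℕ) (t b : ℝ) (ht : 0 ≤ t) (hb : 0 ≤ b) :
    (t + b + √n) ^ n * Real.exp (-(t ^ 2 / 4)) ≤ 2 * 8 ^ n * (√(n ! : ℝ) + b ^ n) := by
  have h1 := pow_mul_exp_neg_sq_le n t
  have h2 := sqrt_natCast_pow_le n
  have h3 : Real.exp (-(t ^ 2 / 4)) ≤ 1 := Real.exp_le_one_iff.2 (by nlinarith [sq_nonneg t])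
  have e0 := Real.exp_pos (-(t ^ 2 / 4))
  have hq : 0 ≤ √(n ! : ℝ) := Real.sqrt_nonneg _
  calc _ ≤ 2 ^ n * (2 ^ n * (t ^ n + b ^ n) + √n ^ n) * Real.exp (-(t ^ 2 / 4)) := by
        gcongr
        refine (add_pow_le_two_pow _ _ (by positivity) (by positivity) n).trans ?_
        gcongr
        exact add_pow_le_two_pow _ _ ht hb n
    _ = 4 ^ n * (t ^ n * Real.exp (-(t ^ 2 / 4))) + 4 ^ n * b ^ n * Real.exp (-(t ^ 2 / 4)) +
        2 ^ n * √n ^ n * Real.exp (-(t ^ 2 / 4)) := by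
      have : (4 : ℝ) ^ n = 2 ^ n * 2 ^ n := by rw [← mul_pow]; norm_num
      rw [this]; ring
    _ ≤ 4 ^ n * (2 ^ n * √(n ! : ℝ)) + 4 ^ n * b ^ n * 1 +
        2 ^ n * (3 ^ n * √(n ! : ℝ)) * 1 := by gcongr
    _ = (8 ^ n + 6 ^ n) * √(n ! : ℝ) + 4 ^ n * b ^ n := by
      have a1 : (8 : ℝ) ^ n = 4 ^ n * 2 ^ n := by rw [← mul_pow]; norm_num
      have a2 : (6 : ℝ) ^ n = 2 ^ n * 3 ^ n := by rw [← mul_pow]; norm_num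
      rw [a1, a2]; ring
    _ ≤ (8 ^ n + 8 ^ n) * √(n ! : ℝ) + (2 * 8 ^ n) * b ^ n := by
      have a3 : (4 : ℝ) ^ n ≤ 8 ^ n := by gcongr; norm_num
      have a4 : (4 : ℝ) ^ n ≤ 2 * 8 ^ n := by
        have : (0 : ℝ) ≤ 8 ^ n := by positivity
        linarith
      gcongr
      norm_num
    _ = _ := by ring

/-- The Gaussian factor is split into two equal halves; one absorbs the power of x, the other the
polynomial growth of the derivative. -/
lemma pow_mul_norm_iteratedFDeriv_coherent_le_sqrt (k n : ℕ) (z : Phase d) (x : Space d) :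
    ‖x‖ ^ k * ‖iteratedFDeriv ℝ n (coherent z) x‖ ≤
      (2 * 8 ^ k * (√(k ! : ℝ) + ‖z‖ ^ k)) * (2 * 8 ^ n * (√(n ! : ℝ) + ‖z‖ ^ n)) := by
  set t := ‖x - pos z‖ with ht
  have ht0 : 0 ≤ t := norm_nonneg _
  have hz := norm_nonneg z
  have hx : ‖x‖ ≤ t + ‖z‖ + √k := by
    have h1 : ‖x‖ ≤ t + ‖pos z‖ := by
      calc ‖x‖ = ‖(x - pos z) + pos z‖ := by rw [sub_add_cancel]
        _ ≤ _ := norm_add_le _ _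
    have := norm_pos_le z
    have := Real.sqrt_nonneg (k : ℝ)
    linarith
  have he : Real.exp (-(t ^ 2 / 2)) = Real.exp (-(t ^ 2 / 4)) * Real.exp (-(t ^ 2 / 4)) := by
    rw [← Real.exp_add]; congr 1; ring
  calc _ ≤ (t + ‖z‖ + √k) ^ k *
        ((t + ‖z‖ + √n) ^ n * Real.exp (-(t ^ 2 / 2))) := by
        gcongr
        refine (norm_iteratedFDeriv_coherent_le n z x).trans ?_
        gcongr
        exact norm_mom_le z
    _ = ((t + ‖z‖ + √k) ^ k * Real.exp (-(t ^ 2 / 4))) *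
        ((t + ‖z‖ + √n) ^ n * Real.exp (-(t ^ 2 / 4))) := by rw [he]; ring
    _ ≤ _ := mul_le_mul (add_pow_mul_exp_le k t ‖z‖ ht0 hz) (add_pow_mul_exp_le n t ‖z‖ ht0 hz)
        (by positivity) (by positivity)

lemma sqrt_factorial_add_pow_le (n : ℕ) (b : ℝ) (hb : 0 ≤ b) :
    √(n ! : ℝ) + b ^ n ≤ 2 * n ! * (1 + b) ^ n := by
  have h1 : (1 : ℝ) ≤ n ! := by exact_mod_cast n.factorial_pos
  have h2 : √(n ! : ℝ) ≤ n ! := by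
    rw [Real.sqrt_le_left (by positivity)]; nlinarith
  have h3 : 1 ≤ (1 + b) ^ n := one_le_pow₀ (by linarith)
  have h4 : b ^ n ≤ (1 + b) ^ n := by gcongr; linarith
  nlinarith

lemma pow_mul_norm_iteratedFDeriv_coherent_le (k n : ℕ) (z : Phase d) (x : Space d) :
    ‖x‖ ^ k * ‖iteratedFDeriv ℝ n (coherent z) x‖ ≤
      (4 * 8 ^ k * k !) * (4 * 8 ^ n * n !) * (1 + ‖z‖) ^ (k + n) := by
  refine (pow_mul_norm_iteratedFDeriv_coherent_le_sqrt k n z x).trans ?_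
  calc _ ≤ (2 * 8 ^ k * (2 * k ! * (1 + ‖z‖) ^ k)) * (2 * 8 ^ n * (2 * n ! * (1 + ‖z‖) ^ n)) := by
        gcongr
        · exact sqrt_factorial_add_pow_le k _ (norm_nonneg z)
        · exact sqrt_factorial_add_pow_le n _ (norm_nonneg z)
    _ = _ := by rw [pow_add]; ring

/-- Coherent states as Schwartz functions. -/
def coherentS (z : Phase d) : 𝓢(Space d, ℂ) where
  toFun := coherent z
  smooth' := contDiff_coherent_right z
  decay' k n := ⟨_, fun x => pow_mul_norm_iteratedFDeriv_coherent_le k n z x⟩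

lemma norm_smul_iteratedFDeriv_coherent_le (F : Phase d → ℂ) (n : ℕ) (z : Phase d) (x : Space d) :
    ‖F z‖ * ‖iteratedFDeriv ℝ n (coherent z) x‖ ≤
      ((4 * 8 ^ 0 * 0 !) * (4 * 8 ^ n * n !)) * (‖F z‖ * (1 + ‖z‖) ^ n) := by
  have h := pow_mul_norm_iteratedFDeriv_coherent_le 0 n z x
  rw [pow_zero, one_mul, zero_add] at h
  rw [mul_left_comm]
  exact mul_le_mul_of_nonneg_left h (norm_nonneg _)

/-- A superposition of coherent states is a Schwartz function which may be differentiated under the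
integral sign. -/
lemma exists_schwartz_integral_coherent {F : Phase d → ℂ} (hF : AEStronglyMeasurable F volume)
    (hFi : ∀ m : ℕ, Integrable fun z => ‖F z‖ * (1 + ‖z‖) ^ m) :
    ∃ f : 𝓢(Space d, ℂ), (∀ x, f x = ∫ z, F z * coherent z x) ∧
      ∀ (n : ℕ) (m : Fin n → Space d) (x : Space d),
        iteratedFDeriv ℝ n f x m = ∫ z, F z * iteratedFDeriv ℝ n (coherentS z) x m := by
  have hT := fun n => contDiff_integral_smul (μ := volume) n hF contDiff_coherent
    (fun n => (hFi n).const_mul ((4 * 8 ^ 0 * 0 !) * (4 * 8 ^ n * n !)))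
    (norm_smul_iteratedFDeriv_coherent_le F)
  refine ⟨⟨fun x => ∫ z, F z * coherent z x, contDiff_infty.2 fun n => (hT n).1,
    fun k n => ?_⟩, fun x => rfl, fun n m x => (hT n).2 x m⟩
  refine ⟨∫ z, ((4 * 8 ^ k * k !) * (4 * 8 ^ n * n !)) * (‖F z‖ * (1 + ‖z‖) ^ (k + n)), fun x => ?_⟩
  have hint : Integrable fun z => ((4 * 8 ^ k * k !) * (4 * 8 ^ n * n !)) * (‖F z‖ * (1 + ‖z‖) ^ (k + n)) :=
    (hFi (k + n)).const_mul _
  -- The bound on the operator norm is obtained by dividing by ‖x‖^k, so the case where this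
  -- vanishes is treated apart.
  rcases eq_or_ne (‖x‖ ^ k) 0 with hx | hx
  · rw [hx, zero_mul]
    exact integral_nonneg fun z => by positivity
  have hx' : 0 < ‖x‖ ^ k := lt_of_le_of_ne (by positivity) hx.symm
  rw [mul_comm, ← le_div_iff₀ hx']
  refine ContinuousMultilinearMap.opNorm_le_bound
    (div_nonneg (integral_nonneg fun z => by positivity) hx'.le) fun m => ?_
  refine (congrArg norm ((hT n).2 x m)).trans_le ?_
  rw [div_mul_eq_mul_div, le_div_iff₀ hx', ← integral_mul_const]
  refine (mul_le_mul_of_nonneg_right (norm_integral_le_integral_norm _) hx'.le).trans ?_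
  rw [← integral_mul_const]
  refine integral_mono_of_nonneg (Filter.Eventually.of_forall fun z => by positivity)
    (hint.mul_const _) (Filter.Eventually.of_forall fun z => ?_)
  have h := pow_mul_norm_iteratedFDeriv_coherent_le k n z x
  have h1 := (iteratedFDeriv ℝ n (coherent z) x).le_opNorm m
  simp only
  rw [norm_smul]
  calc _ ≤ ‖F z‖ * (‖iteratedFDeriv ℝ n (coherent z) x‖ * ∏ i, ‖m i‖) * ‖x‖ ^ k := by gcongr
    _ = ‖F z‖ * (‖x‖ ^ k * ‖iteratedFDeriv ℝ n (coherent z) x‖) * ∏ i, ‖m i‖ := by ring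
    _ ≤ ‖F z‖ * ((4 * 8 ^ k * k !) * (4 * 8 ^ n * n !) * (1 + ‖z‖) ^ (k + n)) * ∏ i, ‖m i‖ := by gcongr
    _ = _ := by ring

/-- Partial derivatives are values of iterated derivatives on unit vectors. -/
lemma exists_partialDeriv_eq (β : Fin d → ℕ) : ∃ m : Fin (order β) → Space d, (∀ i, ‖m i‖ ≤ 1) ∧
    ∀ (f : 𝓢(Space d, ℂ)) (x : Space d), partialDeriv β f x = iteratedFDeriv ℝ (order β) f x m := by
  -- The number of directions is freed from its dependence on β, so that the list induction can
  -- prepend directions without casts.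
  suffices h : ∃ (n : ℕ) (m : Fin n → Space d), n = order β ∧ (∀ i, ‖m i‖ ≤ 1) ∧
      ∀ f : 𝓢(Space d, ℂ), partialDeriv β f = LineDeriv.iteratedLineDerivOp m f by
    obtain ⟨n, m, rfl, hm, h⟩ := h
    exact ⟨m, hm, fun f x => by rw [h, SchwartzMap.iteratedLineDerivOp_eq_iteratedFDeriv]⟩
  have ho : order β = ((List.finRange d).map β).sum := by
    rw [order, ← List.sum_ofFn, List.ofFn_eq_map]
  rw [ho]
  unfold partialDeriv
  induction List.finRange d with
  | nil => exact ⟨0, Fin.elim0, by simp, fun i => i.elim0, fun f => by simp⟩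
  | cons i l ih =>
    simp only [List.map_cons, List.prod_cons, List.sum_cons]
    induction β i with
    | zero => simpa using ih
    | succ k ihk =>
      obtain ⟨n, m, hn, hm, h⟩ := ihk
      refine ⟨n + 1, Fin.cons (EuclideanSpace.single i 1) m, by omega, fun j => ?_, fun f => ?_⟩
      · refine Fin.cases ?_ (fun j => ?_) j
        · simp
        · simpa using hm j
      · rw [LineDeriv.iteratedLineDerivOp_succ_left, Fin.cons_zero, Fin.tail_cons, ← h, pow_succ',
          mul_assoc]
        rfl

end

end Metaplectic

/-! ### Rapidly decaying coefficients synthesize elements of Σ_s. -/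

namespace Metaplectic

noncomputable section

open Complex (I)
open scoped ComplexConjugate InnerProductSpace ContDiff Nat

variable {d : ℕ}

/-! ### Superpositions of coherent states in Gelfand–Shilov spaces -/

/-- Raise y^n ≤ n! exp(y), with y = x^{1/δ}, to the power δ. -/
lemma pow_le_factorial_rpow {δ x : ℝ} (hδ : 0 < δ) (hx : 0 ≤ x) (n : ℕ) :
    x ^ n ≤ (n ! : ℝ) ^ δ * Real.exp (δ * x ^ (1 / δ)) := by
  have hy : 0 ≤ x ^ (1 / δ) := Real.rpow_nonneg hx _
  have h := Real.pow_div_factorial_le_exp _ hy n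
  rw [div_le_iff₀ (by positivity)] at h
  have h2 := Real.rpow_le_rpow (by positivity) h hδ.le
  rw [Real.mul_rpow (Real.exp_pos _).le (by positivity), ← Real.exp_mul, ← Real.rpow_natCast,
    ← Real.rpow_mul hx, ← Real.rpow_mul hx] at h2
  have e : 1 / δ * (n : ℝ) * δ = n := by field_simp
  rw [e, Real.rpow_natCast] at h2
  rw [mul_comm, mul_comm δ]
  exact h2

/-- Peel off one index at a time and bound each binomial coefficient by a power of 2. The loss is
exponential in the order, so a change of h absorbs it. -/
lemma factorial_sum_le {ι : Type} (t : Finset ι) (β : ι → ℕ) :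
    (∑ i ∈ t, β i)! ≤ (2 ^ t.card) ^ (∑ i ∈ t, β i) * ∏ i ∈ t, (β i)! := by
  classical
  induction t using Finset.induction_on with
  | empty => simp
  | insert a t ha ih =>
    rw [Finset.sum_insert ha, Finset.prod_insert ha, Finset.card_insert_of_notMem ha]
    set S := ∑ i ∈ t, β i
    have h1 : (β a + S)! ≤ 2 ^ (β a + S) * ((β a)! * S !) := by
      rw [← Nat.add_choose_mul_factorial_mul_factorial, mul_assoc]
      gcongr
      exact Nat.choose_le_two_pow _ _
    calc _ ≤ 2 ^ (β a + S) * ((β a)! * ((2 ^ t.card) ^ S * ∏ i ∈ t, (β i)!)) :=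
          h1.trans (by gcongr)
      _ ≤ 2 ^ (β a + S) * ((β a)! * ((2 ^ t.card) ^ (β a + S) * ∏ i ∈ t, (β i)!)) := by
          gcongr
          · exact Nat.one_le_two_pow
          · omega
      _ = _ := by rw [pow_succ, mul_pow]; ring

lemma factorial_order_le (α : Fin d → ℕ) :
    (order α)! ≤ (2 ^ d) ^ order α * factorial α := by
  simpa [order, factorial] using factorial_sum_le Finset.univ α

lemma abs_monomial_le (α : Fin d → ℕ) (x : Space d) : |monomial α x| ≤ ‖x‖ ^ order α := by
  rw [monomial, Finset.abs_prod, order, ← Finset.prod_pow_eq_pow_sum]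
  refine Finset.prod_le_prod (fun i _ => abs_nonneg _) fun i _ => ?_
  rw [abs_pow]
  gcongr
  exact PiLp.norm_apply_le x i

/-- The weight `exp (r |z|^{1/s})` on phase space. -/
def gsExp (s r : ℝ) (z : Phase d) : ℝ := Real.exp (r * ‖z‖ ^ (1 / s))

lemma gsExp_pos (s r : ℝ) (z : Phase d) : 0 < gsExp s r z := Real.exp_pos _

lemma gsExp_add (s r t : ℝ) (z : Phase d) : gsExp s (r + t) z = gsExp s r z * gsExp s t z := by
  rw [gsExp, add_mul, Real.exp_add]; rfl

lemma gsExp_zero (s : ℝ) (z : Phase d) : gsExp s 0 z = 1 := by simp [gsExp]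

lemma gsExp_mono (s : ℝ) {r t : ℝ} (h : r ≤ t) (z : Phase d) : gsExp s r z ≤ gsExp s t z := by
  unfold gsExp
  have : 0 ≤ ‖z‖ ^ (1 / s) := Real.rpow_nonneg (norm_nonneg z) _
  gcongr

lemma continuous_gsExp {s : ℝ} (hs : 0 < s) (r : ℝ) :
    Continuous fun z : Phase d => gsExp s r z := by
  unfold gsExp
  have : Continuous fun z : Phase d => ‖z‖ ^ (1 / s) :=
    continuous_norm.rpow_const fun _ => Or.inr (by positivity)
  fun_prop

lemma one_le_gsExp {s r : ℝ} (hr : 0 ≤ r) (z : Phase d) : 1 ≤ gsExp s r z := by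
  rw [← gsExp_zero s z]; exact gsExp_mono s hr z

lemma norm_pow_le_gsExp {s h : ℝ} (hs : 0 < s) (hh : 0 < h) (n : ℕ) (z : Phase d) :
    ‖z‖ ^ n ≤ h ^ n * (n ! : ℝ) ^ s * gsExp s (s * h⁻¹ ^ (1 / s)) z := by
  have h1 := pow_le_factorial_rpow hs (x := h⁻¹ * ‖z‖) (by positivity) n
  rw [Real.mul_rpow (by positivity) (norm_nonneg z), ← mul_assoc] at h1
  calc ‖z‖ ^ n = h ^ n * (h⁻¹ * ‖z‖) ^ n := by rw [← mul_pow]; field_simp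
    _ ≤ h ^ n * _ := mul_le_mul_of_nonneg_left h1 (by positivity)
    _ = _ := by rw [gsExp, mul_assoc s, mul_assoc]

lemma one_add_norm_pow_le_gsExp {s : ℝ} (hs : 0 < s) (n : ℕ) (z : Phase d) :
    (1 + ‖z‖) ^ n ≤ (2 ^ n * (1 + (n ! : ℝ) ^ s)) * gsExp s s z := by
  have h := norm_pow_le_gsExp hs one_pos n z
  rw [one_pow, one_mul, inv_one, Real.one_rpow, mul_one] at h
  calc _ ≤ 2 ^ n * (1 ^ n + ‖z‖ ^ n) := add_pow_le_two_pow _ _ zero_le_one (norm_nonneg z) n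
    _ ≤ 2 ^ n * (1 * gsExp s s z + (n ! : ℝ) ^ s * gsExp s s z) := by
        rw [one_pow]; gcongr; rw [one_mul]; exact one_le_gsExp hs.le z
    _ = _ := by ring

/-- This is where s > 1/2 is decisive: the surplus (n!)^{s-1/2} outgrows (8/h)^n for every h. The
power of ‖z‖ is paid for by an exponential weight. -/
lemma exists_sqrt_factorial_add_pow_le {s h : ℝ} (hs : 1 / 2 < s) (hh : 0 < h) :
    ∃ K r : ℝ, 0 ≤ K ∧ 0 ≤ r ∧ ∀ (n : ℕ) (z : Phase d),
      2 * 8 ^ n * (√(n ! : ℝ) + ‖z‖ ^ n) ≤ K * gsExp s r z * (h ^ n * (n ! : ℝ) ^ s) := by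
  have hs0 : 0 < s := by linarith
  have hδ : 0 < s - 1 / 2 := by linarith
  set k := Real.exp ((s - 1 / 2) * (8 / h) ^ (1 / (s - 1 / 2)))
  refine ⟨2 * (k + 1), s * (h / 8)⁻¹ ^ (1 / s), by positivity, by positivity, fun n z => ?_⟩
  set e := gsExp s (s * (h / 8)⁻¹ ^ (1 / s)) z
  have he : 1 ≤ e := one_le_gsExp (by positivity) z
  have h1 : 8 ^ n * √(n ! : ℝ) ≤ h ^ n * (n ! : ℝ) ^ s * k := by
    have h2 := pow_le_factorial_rpow hδ (x := 8 / h) (by positivity) n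
    have h3 : (n ! : ℝ) ^ s = (n ! : ℝ) ^ (s - 1 / 2) * √(n ! : ℝ) := by
      rw [Real.sqrt_eq_rpow, ← Real.rpow_add (by positivity)]; congr 1; ring
    calc _ = h ^ n * √(n ! : ℝ) * (8 / h) ^ n := by rw [div_pow]; field_simp
      _ ≤ h ^ n * √(n ! : ℝ) * ((n ! : ℝ) ^ (s - 1 / 2) * k) := by gcongr
      _ = _ := by rw [h3]; ring
  have h4 : 8 ^ n * ‖z‖ ^ n ≤ h ^ n * (n ! : ℝ) ^ s * e := by
    have h5 := norm_pow_le_gsExp hs0 (h := h / 8) (by positivity) n z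
    calc _ ≤ 8 ^ n * ((h / 8) ^ n * (n ! : ℝ) ^ s * e) := by gcongr
      _ = _ := by rw [div_pow]; field_simp
  have hp : 0 ≤ h ^ n * (n ! : ℝ) ^ s := by positivity
  have hk : 0 ≤ k := (Real.exp_pos _).le
  calc _ = 2 * (8 ^ n * √(n ! : ℝ) + 8 ^ n * ‖z‖ ^ n) := by ring
    _ ≤ 2 * (h ^ n * (n ! : ℝ) ^ s * k * e + h ^ n * (n ! : ℝ) ^ s * e) := by
        exact mul_le_mul_of_nonneg_left (add_le_add
          (h1.trans (le_mul_of_one_le_right (by positivity) he)) h4) zero_le_two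
    _ = _ := by ring

lemma exists_norm_monomial_mul_partialDeriv_coherent_le (d : ℕ) {s h : ℝ} (hs : 1 / 2 < s)
    (hh : 0 < h) :
    ∃ K r : ℝ, 0 ≤ K ∧ 0 ≤ r ∧ ∀ (α β : Fin d → ℕ) (m : Fin (order β) → Space d)
      (_ : ∀ i, ‖m i‖ ≤ 1) (z : Phase d) (x : Space d),
      ‖(monomial α x : ℂ)‖ * ‖iteratedFDeriv ℝ (order β) (coherent z) x m‖ ≤ K * gsExp s r z *
        (h ^ order (α + β) * (factorial α : ℝ) ^ s * (factorial β : ℝ) ^ s) := by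
  have hs0 : 0 < s := by linarith
  set D : ℝ := (2 ^ d : ℝ) ^ s with hD
  have hD0 : 0 < D := by positivity
  -- Working with h/D compensates the factor D^{|α|} lost in replacing (|α|!)^s by (α!)^s.
  obtain ⟨K, r, hK, hr, hKr⟩ := exists_sqrt_factorial_add_pow_le (d := d) hs (h := h / D)
    (by positivity)
  have hfac : ∀ α : Fin d → ℕ, (h / D) ^ order α * ((order α)! : ℝ) ^ s ≤
      h ^ order α * (factorial α : ℝ) ^ s := fun α => by
    have h1 : ((order α)! : ℝ) ≤ (2 ^ d) ^ order α * factorial α := by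
      exact_mod_cast factorial_order_le α
    have h2 := Real.rpow_le_rpow (by positivity) h1 hs0.le
    rw [Real.mul_rpow (by positivity) (by positivity), ← Real.rpow_natCast, ← Real.rpow_mul
      (by positivity), mul_comm _ s, Real.rpow_mul (by positivity), Real.rpow_natCast] at h2
    calc _ ≤ (h / D) ^ order α * (D ^ order α * (factorial α : ℝ) ^ s) := by gcongr
      _ = _ := by rw [div_pow]; field_simp
  refine ⟨K * K, r + r, by positivity, by positivity, fun α β m hm z x => ?_⟩
  have hg := (gsExp_pos s r z).le
  have e1 : order (α + β) = order α + order β := by simp [order, Finset.sum_add_distrib]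
  calc _ ≤ ‖x‖ ^ order α * ‖iteratedFDeriv ℝ (order β) (coherent z) x‖ := by
        refine mul_le_mul ?_ ?_ (norm_nonneg _) (by positivity)
        · rw [Complex.norm_real]; exact abs_monomial_le α x
        · refine (ContinuousMultilinearMap.le_opNorm _ m).trans
            (mul_le_of_le_one_right (norm_nonneg _) ?_)
          exact Finset.prod_le_one (fun i _ => norm_nonneg _) fun i _ => hm i
    _ ≤ (K * gsExp s r z * ((h / D) ^ order α * ((order α)! : ℝ) ^ s)) *
        (K * gsExp s r z * ((h / D) ^ order β * ((order β)! : ℝ) ^ s)) :=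
        (pow_mul_norm_iteratedFDeriv_coherent_le_sqrt _ _ z x).trans
          (mul_le_mul (hKr _ z) (hKr _ z) (by positivity) (by positivity))
    _ ≤ (K * gsExp s r z * (h ^ order α * (factorial α : ℝ) ^ s)) *
        (K * gsExp s r z * (h ^ order β * (factorial β : ℝ) ^ s)) := by
        gcongr ?_ * ?_
        · exact mul_le_mul_of_nonneg_left (hfac α) (by positivity)
        · exact mul_le_mul_of_nonneg_left (hfac β) (by positivity)
    _ = _ := by rw [e1, pow_add, gsExp_add]; ring

/-- Superpositions of coherent states with rapidly decaying coefficients belong to `Σ_s`. -/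
lemma exists_gelfandShilov_integral_coherent (d : ℕ) {s : ℝ} (hs : 1 / 2 < s) :
    ∃ K r : {h : ℝ // 0 < h} → ℝ, (∀ h, 0 ≤ K h) ∧ (∀ h, 0 ≤ r h) ∧ ∀ F : Phase d → ℂ,
      AEStronglyMeasurable F volume → (∀ t, Integrable fun z => ‖F z‖ * gsExp s t z) →
      ∃ f : GelfandShilov s d, (∀ x, f.toSchwartz x = ∫ z, F z * coherent z x) ∧
        ∀ h, gsSeminorm s d h f ≤ K h * ∫ z, ‖F z‖ * gsExp s (r h) z := by
  have hs0 : 0 < s := by linarith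
  choose K r hK hr hKr using fun h : {h : ℝ // 0 < h} =>
    exists_norm_monomial_mul_partialDeriv_coherent_le d hs h.2
  refine ⟨K, r, hK, hr, fun F hF hFi => ?_⟩
  obtain ⟨f, hf, hfd⟩ := exists_schwartz_integral_coherent hF fun m => by
    refine ((hFi s).const_mul (2 ^ m * (1 + (m ! : ℝ) ^ s))).mono'
      (hF.norm.mul (by fun_prop)) (Filter.Eventually.of_forall fun z => ?_)
    rw [Real.norm_of_nonneg (by positivity), mul_left_comm]
    exact mul_le_mul_of_nonneg_left (one_add_norm_pow_le_gsExp hs0 m z) (norm_nonneg _)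
  have hq : ∀ h p, gsQuot s h.1 f p ≤ K h * ∫ z, ‖F z‖ * gsExp s (r h) z := by
    rintro h ⟨α, β, x⟩
    obtain ⟨m, hm, hβ⟩ := exists_partialDeriv_eq β
    unfold gsQuot
    have hden := gsDenom_pos s h.2 α β
    rw [div_le_iff₀ hden, norm_mul, hβ, hfd, ← integral_const_mul, ← integral_mul_const]
    refine (mul_le_mul_of_nonneg_left (norm_integral_le_integral_norm _) (norm_nonneg _)).trans ?_
    rw [← integral_const_mul]
    refine integral_mono_of_nonneg (Filter.Eventually.of_forall fun z => by positivity)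
      (((hFi (r h)).const_mul _).mul_const _) (Filter.Eventually.of_forall fun z => ?_)
    simp only
    rw [norm_mul, mul_left_comm]
    refine (mul_le_mul_of_nonneg_left (hKr h α β m hm z x) (norm_nonneg (F z))).trans_eq ?_
    ring
  refine ⟨⟨f, fun h hh => ⟨_, by rintro _ ⟨p, rfl⟩; exact hq ⟨h, hh⟩ p⟩⟩, hf, fun h => ?_⟩
  exact ciSup_le fun p => hq h p

end

end Metaplectic

/-! ### Exponential decay of matrix coefficients. -/

namespace Metaplectic

noncomputable section

open Complex (I)
open scoped ComplexConjugate InnerProductSpace ContDiff Nat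

variable {d : ℕ}

/-! ### Matrix coefficients of Gelfand–Shilov functions -/

@[simp] lemma partialDeriv_zero : partialDeriv (0 : Fin d → ℕ) = 1 := by
  unfold partialDeriv
  exact List.prod_eq_one (by simp)

lemma partialDeriv_single (j : Fin d) (k : ℕ) : partialDeriv (Pi.single j k) =
    LineDeriv.lineDerivOpCLM ℂ 𝓢(Space d, ℂ) (EuclideanSpace.single j (1 : ℝ)) ^ k := by
  classical
  unfold partialDeriv
  rw [List.prod_map_eq_pow_single j]
  · rw [Pi.single_eq_same, List.count_eq_one_of_mem (List.nodup_finRange d) (List.mem_finRange j),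
      pow_one]
  · intro i hi _
    rw [Pi.single_eq_of_ne hi, pow_zero]

lemma order_add (α β : Fin d → ℕ) : order (α + β) = order α + order β := by
  simp [order, Finset.sum_add_distrib]

@[simp] lemma order_single (j : Fin d) (k : ℕ) : order (Pi.single j k) = k := by
  classical
  simp [order]

@[simp] lemma factorial_single (j : Fin d) (k : ℕ) : factorial (Pi.single j k) = k ! := by
  classical
  rw [factorial, Finset.prod_eq_single j] <;> simp +contextual

@[simp] lemma monomial_single (j : Fin d) (k : ℕ) (x : Space d) :
    monomial (Pi.single j k) x = x j ^ k := by
  classical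
  rw [monomial, Finset.prod_eq_single j] <;> simp +contextual

@[simp] lemma order_zero : order (0 : Fin d → ℕ) = 0 := by simp [order]

@[simp] lemma factorial_zero : factorial (0 : Fin d → ℕ) = 1 := by simp [factorial]

@[simp] lemma monomial_zero (x : Space d) : monomial 0 x = 1 := by simp [monomial]

lemma monomial_add (α β : Fin d → ℕ) (x : Space d) :
    monomial (α + β) x = monomial α x * monomial β x := by
  simp [monomial, pow_add, Finset.prod_mul_distrib]

lemma factorial_add_le (α β : Fin d → ℕ) :
    factorial (α + β) ≤ 2 ^ order (α + β) * (factorial α * factorial β) := by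
  simp only [factorial, order, ← Finset.prod_mul_distrib, ← Finset.prod_pow_eq_pow_sum]
  refine Finset.prod_le_prod (fun i _ => Nat.zero_le _) fun i _ => ?_
  rw [Pi.add_apply, ← Nat.add_choose_mul_factorial_mul_factorial, mul_assoc]
  gcongr
  exact Nat.choose_le_two_pow _ _

lemma norm_monomial_mul_partialDeriv_le {s : ℝ} (h : {h : ℝ // 0 < h}) (f : GelfandShilov s d)
    (α β : Fin d → ℕ) (x : Space d) :
    ‖(monomial α x : ℂ) * partialDeriv β f.toSchwartz x‖ ≤ gsSeminorm s d h f *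
      (h.1 ^ order (α + β) * (factorial α : ℝ) ^ s * (factorial β : ℝ) ^ s) := by
  rw [← div_le_iff₀ (gsDenom_pos s h.2 α β)]
  exact le_ciSup (f.2 h.1 h.2) (α, β, x)

lemma exists_norm_le_card_mul_abs {ι : Type} [Fintype ι] [Nonempty ι] (x : EuclideanSpace ℝ ι) :
    ∃ i, ‖x‖ ≤ Fintype.card ι * |x i| := by
  obtain ⟨i, hi⟩ := Finite.exists_max fun i => |x i|
  refine ⟨i, ?_⟩
  rw [EuclideanSpace.norm_eq, Real.sqrt_le_left (by positivity)]
  have hc : (1 : ℝ) ≤ Fintype.card ι := by exact_mod_cast Fintype.card_pos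
  calc ∑ j, ‖x j‖ ^ 2 ≤ ∑ _j : ι, |x i| ^ 2 := by
        refine Finset.sum_le_sum fun j _ => ?_
        rw [Real.norm_eq_abs]
        exact pow_le_pow_left₀ (abs_nonneg _) (hi j) 2
    _ = Fintype.card ι * |x i| ^ 2 := by simp
    _ ≤ Fintype.card ι ^ 2 * |x i| ^ 2 := by
        gcongr
        nlinarith
    _ = _ := by ring

/-- The L¹ form of the seminorm bounds. Integrability costs a factor |x|^l, dominated by a power of
the largest coordinate and absorbed into the monomial; splitting the factorial of the enlarged index
costs 2^s in h. -/
lemma exists_integral_monomial_mul_partialDeriv_le (d : ℕ) {s : ℝ} (hs : 0 < s)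
    (h : {h : ℝ // 0 < h}) : ∃ C : ℝ, 0 ≤ C ∧ ∀ (f : GelfandShilov s d) (α β : Fin d → ℕ),
      ∫ x, ‖(monomial α x : ℂ) * partialDeriv β f.toSchwartz x‖ ≤ C * gsSeminorm s d h f *
        ((2 ^ s * h.1) ^ order (α + β) * (factorial α : ℝ) ^ s * (factorial β : ℝ) ^ s) := by
  obtain ⟨h, hh⟩ := h
  set l := (volume : Measure (Space d)).integrablePower
  set J := ∫ x : Space d, (1 + ‖x‖) ^ (-(l : ℝ))
  have hJ : 0 ≤ J := integral_nonneg fun x => by positivity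
  have h2s : 1 ≤ (2 : ℝ) ^ s := Real.one_le_rpow one_le_two hs.le
  refine ⟨2 ^ l * J * (1 + (1 + d ^ l * (2 ^ s * h) ^ l * (l ! : ℝ) ^ s)), by positivity,
    fun f α β => ?_⟩
  set p := gsSeminorm s d ⟨h, hh⟩ f
  have hp : 0 ≤ p := apply_nonneg _ _
  set Q := (2 ^ s * h) ^ order (α + β) * (factorial α : ℝ) ^ s * (factorial β : ℝ) ^ s
  have hQ : 0 ≤ Q := by positivity
  have b0 : ∀ x, ‖(monomial α x : ℂ) * partialDeriv β f.toSchwartz x‖ ≤ p * Q := fun x => by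
    refine (norm_monomial_mul_partialDeriv_le ⟨h, hh⟩ f α β x).trans ?_
    simp only [Q]
    gcongr
    exact le_mul_of_one_le_left hh.le h2s
  have b1 : ∀ x, ‖x‖ ^ (0 + l) * ‖(monomial α x : ℂ) * partialDeriv β f.toSchwartz x‖ ≤
      (1 + d ^ l * (2 ^ s * h) ^ l * (l ! : ℝ) ^ s) * (p * Q) := fun x => by
    rw [zero_add]
    -- In dimension zero there is no largest coordinate to choose.
    rcases isEmpty_or_nonempty (Fin d) with hd | hd
    · have hx : ‖x‖ = 0 := by rw [Subsingleton.elim x 0, norm_zero]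
      have h1 : ‖x‖ ^ l ≤ 1 := pow_le_one₀ (norm_nonneg x) (by rw [hx]; exact zero_le_one)
      refine mul_le_mul (h1.trans (le_add_of_nonneg_right (by positivity))) (b0 x) (norm_nonneg _)
        (by positivity)
    · obtain ⟨i, hi⟩ := exists_norm_le_card_mul_abs x
      rw [Fintype.card_fin] at hi
      have h1 := norm_monomial_mul_partialDeriv_le ⟨h, hh⟩ f (α + Pi.single i l) β x
      rw [monomial_add, monomial_single, order_add, order_add, order_single] at h1
      have h2 : (factorial (α + Pi.single i l) : ℝ) ^ s ≤
          ((2 : ℝ) ^ s) ^ (order α + l) * ((factorial α : ℝ) ^ s * (l ! : ℝ) ^ s) := by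
        have h3 : (factorial (α + Pi.single i l) : ℝ) ≤ 2 ^ (order α + l) * (factorial α * l !) := by
          have := factorial_add_le α (Pi.single i l)
          rw [order_add, order_single, factorial_single] at this
          exact_mod_cast this
        refine (Real.rpow_le_rpow (by positivity) h3 hs.le).trans_eq ?_
        rw [Real.mul_rpow (by positivity) (by positivity),
          Real.mul_rpow (by positivity) (by positivity), ← Real.rpow_natCast, ← Real.rpow_natCast,
          ← Real.rpow_mul (by positivity), ← Real.rpow_mul (by positivity), mul_comm s]
      calc _ ≤ (d * |x i|) ^ l * ‖(monomial α x : ℂ) * partialDeriv β f.toSchwartz x‖ := by gcongr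
        _ = d ^ l * ‖((monomial α x * x i ^ l : ℝ) : ℂ) * partialDeriv β f.toSchwartz x‖ := by
          rw [mul_pow, norm_mul, norm_mul, Complex.norm_real, Complex.norm_real, norm_mul, norm_pow,
            Real.norm_eq_abs, Real.norm_eq_abs]
          ring
        _ ≤ d ^ l * (p * (h ^ (order α + l + order β) *
            (((2 : ℝ) ^ s) ^ (order α + l) * ((factorial α : ℝ) ^ s * (l ! : ℝ) ^ s)) *
              (factorial β : ℝ) ^ s)) := by
          gcongr
          exact h1.trans (by gcongr)
        _ ≤ d ^ l * (p * (h ^ (order α + l + order β) *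
            (((2 : ℝ) ^ s) ^ (order α + l + order β) * ((factorial α : ℝ) ^ s * (l ! : ℝ) ^ s)) *
              (factorial β : ℝ) ^ s)) := by
          have : (2 ^ s : ℝ) ^ (order α + l) ≤ (2 ^ s : ℝ) ^ (order α + l + order β) :=
            pow_le_pow_right₀ h2s (by omega)
          gcongr
        _ = d ^ l * (2 ^ s * h) ^ l * (l ! : ℝ) ^ s * (p * Q) := by
          simp only [Q, order_add, mul_pow, pow_add]; ring
        _ ≤ _ := by
          gcongr
          exact le_add_of_nonneg_left zero_le_one
  have key := integral_pow_mul_le_of_le_of_pow_mul_le (μ := volume) b0 b1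
  simp only [pow_zero, one_mul] at key
  refine key.trans_eq ?_
  ring

/-- The sesquilinear form `⟨W(z) g, f⟩` on functions. -/
def coeff (z : Phase d) (f g : 𝓢(Space d, ℂ)) : ℂ := ∫ x, conj (weylFun z g x) * f x

lemma coeFn_toL2 {s : ℝ} (f : GelfandShilov s d) : f.toL2 =ᵐ[volume] f.toSchwartz := by
  unfold GelfandShilov.toL2
  exact SchwartzMap.coeFn_toLp f.toSchwartz 2 volume

lemma inner_weyl_toL2 {s : ℝ} (z : Phase d) (f g : GelfandShilov s d) :
    ⟪weyl z g.toL2, f.toL2⟫_ℂ = coeff z f.toSchwartz g.toSchwartz := by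
  rw [inner_eq_integral, coeff]
  refine integral_congr_ae ?_
  have h1 := coeFn_toL2 g
  have h2 := coeFn_toL2 f
  filter_upwards [coeFn_weyl z g.toL2, weylFun_congr z h1, h2] with x e1 e2 e3
  rw [e1, e2, e3]

lemma norm_weylFun (z : Phase d) (g : Space d → ℂ) (x : Space d) :
    ‖weylFun z g x‖ = ‖g (x - pos z)‖ := by
  rw [weylFun, norm_mul, norm_weylPhase, one_mul]

lemma continuous_weylFun (z : Phase d) {g : Space d → ℂ} (hg : Continuous g) :
    Continuous (weylFun z g) :=
  (continuous_weylPhase_right z).mul (hg.comp (continuous_id.sub continuous_const))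

lemma integrable_conj_weylFun_mul (z : Phase d) (f g : 𝓢(Space d, ℂ)) :
    Integrable fun x => conj (weylFun z g x) * f x := by
  refine f.integrable.bdd_mul (c := SchwartzMap.seminorm ℝ 0 0 g)
    (Complex.continuous_conj.comp (continuous_weylFun z g.continuous)).aestronglyMeasurable
    (Filter.Eventually.of_forall fun x => ?_)
  rw [RCLike.norm_conj, norm_weylFun]
  exact g.norm_le_seminorm ℝ _

lemma norm_coeff_le (z : Phase d) (f g : 𝓢(Space d, ℂ)) {M : ℝ} (hM : ∀ x, ‖g x‖ ≤ M) :
    ‖coeff z f g‖ ≤ (∫ x, ‖f x‖) * M := by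
  refine (norm_integral_le_integral_norm _).trans ?_
  rw [← integral_mul_const]
  refine integral_mono (integrable_conj_weylFun_mul z f g).norm (f.integrable.norm.mul_const _)
    fun x => ?_
  rw [norm_mul, RCLike.norm_conj, norm_weylFun, mul_comm]
  gcongr
  exact hM _

/-- The translation satisfies p_j = x_j - (x-p)_j, so its powers are distributed between f and the
translated g. -/
lemma abs_pow_mul_norm_coeff_le (z : Phase d) (f g : 𝓢(Space d, ℂ)) (j : Fin d) (n : ℕ) {A B : ℝ}
    (hA : ∀ x, ‖f x‖ ≤ A) (hB : ∀ x, ‖g x‖ ≤ B)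
    (hf : Integrable fun x : Space d => ‖(x j ^ n : ℂ) * f x‖)
    (hg : Integrable fun x : Space d => ‖(x j ^ n : ℂ) * g x‖) :
    |pos z j| ^ n * ‖coeff z f g‖ ≤ 2 ^ n * ((∫ x : Space d, ‖(x j ^ n : ℂ) * f x‖) * B +
      A * ∫ x : Space d, ‖(x j ^ n : ℂ) * g x‖) := by
  have hg' := hg.comp_sub_right (pos z)
  calc _ ≤ |pos z j| ^ n * ∫ x, ‖conj (weylFun z g x) * f x‖ := by
        gcongr; exact norm_integral_le_integral_norm _
    _ = ∫ x, |pos z j| ^ n * ‖conj (weylFun z g x) * f x‖ := by rw [integral_const_mul]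
    _ ≤ ∫ x : Space d, 2 ^ n * (‖(x j ^ n : ℂ) * f x‖ * B +
        A * ‖((x - pos z) j ^ n : ℂ) * g (x - pos z)‖) := by
      refine integral_mono ((integrable_conj_weylFun_mul z f g).norm.const_mul _)
        (((hf.mul_const B).add (hg'.const_mul A)).const_mul _) fun x => ?_
      simp only
      rw [norm_mul, norm_mul, norm_mul, RCLike.norm_conj, norm_weylFun, norm_pow, norm_pow,
        Complex.norm_real, Complex.norm_real, Real.norm_eq_abs, Real.norm_eq_abs]
      have h1 : |pos z j| ≤ |x j| + |(x - pos z) j| := by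
        have : pos z j = x j - (x - pos z) j := by simp
        rw [this]
        exact abs_sub _ _
      have h2 := (pow_le_pow_left₀ (abs_nonneg _) h1 n).trans
        (add_pow_le_two_pow _ _ (abs_nonneg _) (abs_nonneg _) n)
      calc _ ≤ 2 ^ n * (|x j| ^ n + |(x - pos z) j| ^ n) * (‖g (x - pos z)‖ * ‖f x‖) := by gcongr
        _ = 2 ^ n * (|x j| ^ n * ‖f x‖ * ‖g (x - pos z)‖ +
          ‖f x‖ * (|(x - pos z) j| ^ n * ‖g (x - pos z)‖)) := by ring
        _ ≤ _ := by
          gcongr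
          · exact hB _
          · exact hA _
    _ = _ := by
      rw [integral_const_mul, integral_add (hf.mul_const B) (hg'.const_mul A), integral_mul_const,
        integral_const_mul]
      congr 3
      exact integral_sub_right_eq_self (fun x : Space d => ‖(x j ^ n : ℂ) * g x‖) (pos z)

lemma hasFDerivAt_weylFun (z : Phase d) (g : 𝓢(Space d, ℂ)) (x : Space d) :
    HasFDerivAt (weylFun z g) (weylPhase z x • fderiv ℝ g (x - pos z) +
      g (x - pos z) • (weylPhase z x • (I • (Complex.ofRealCLM ∘L innerSL ℝ (mom z))))) x := by
  have h1 : HasFDerivAt (fun x => g (x - pos z)) (fderiv ℝ g (x - pos z)) x := by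
    have := (g.hasFDerivAt (x - pos z)).comp x ((hasFDerivAt_id x).sub_const (pos z))
    exact this
  have h2 : HasFDerivAt (fun x : Space d => (⟪mom z, x⟫_ℝ - ⟪pos z, mom z⟫_ℝ / 2 : ℝ))
        (innerSL ℝ (mom z)) x := ((innerSL ℝ (mom z)).hasFDerivAt).sub_const _
  have h3 := ((Complex.ofRealCLM.hasFDerivAt.comp x h2).mul_const I).cexp
  exact HasFDerivAt.mul h3 h1

/-- Integration by parts: differentiating W(z)g produces W(z)∂g and the modulation factor iξ_j. -/
lemma mul_coeff_eq (z : Phase d) (f g : 𝓢(Space d, ℂ)) (j : Fin d) :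
    I * (mom z j : ℂ) * coeff z f g =
      coeff z (LineDeriv.lineDerivOp (EuclideanSpace.single j (1 : ℝ)) f) g +
        coeff z f (LineDeriv.lineDerivOp (EuclideanSpace.single j (1 : ℝ)) g) := by
  set e : Space d := EuclideanSpace.single j (1 : ℝ) with he
  have hd : ∀ x, HasFDerivAt (fun x => conj (weylFun z g x)) _ x := fun x =>
    (Complex.conjCLE.toContinuousLinearMap.hasFDerivAt (x := weylFun z g x)).comp x
      (hasFDerivAt_weylFun z g x)
  have hfd : ∀ x, fderiv ℝ (fun x => conj (weylFun z g x)) x e =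
      conj (weylFun z (LineDeriv.lineDerivOp e g) x) -
        I * (mom z j : ℂ) * conj (weylFun z g x) := fun x => by
    rw [(hd x).fderiv]
    have : ⟪mom z, e⟫_ℝ = mom z j := by simp [he, EuclideanSpace.inner_single_right]
    simp [weylFun, SchwartzMap.lineDerivOp_apply_eq_fderiv, this]
    ring
  have i0 := integrable_conj_weylFun_mul z f g
  have i1 := integrable_conj_weylFun_mul z (LineDeriv.lineDerivOp e f) g
  have i2 := integrable_conj_weylFun_mul z f (LineDeriv.lineDerivOp e g)
  have i3 : Integrable fun x => f x * fderiv ℝ (fun x => conj (weylFun z g x)) x e := by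
    simp only [hfd]
    refine (i2.sub (i0.const_mul (I * (mom z j : ℂ)))).congr
      (Filter.Eventually.of_forall fun x => ?_)
    simp only [Pi.sub_apply]
    ring
  have key := integral_mul_fderiv_eq_neg_fderiv_mul_of_integrable (μ := volume) (𝕜 := ℂ) (v := e)
    (f := f) (g := fun x => conj (weylFun z g x))
    (i1.congr (Filter.Eventually.of_forall fun x => by
      simp only [SchwartzMap.lineDerivOp_apply_eq_fderiv, mul_comm]))
    i3 (i0.congr (Filter.Eventually.of_forall fun x => mul_comm _ _))
    (fun x _ => f.differentiableAt) (fun x _ => (hd x).differentiableAt)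
  have e1 : ∫ x, f x * fderiv ℝ (fun x => conj (weylFun z g x)) x e =
      coeff z f (LineDeriv.lineDerivOp e g) - I * (mom z j : ℂ) * coeff z f g := by
    rw [coeff, coeff, ← integral_const_mul, ← integral_sub i2 (i0.const_mul _)]
    refine integral_congr_ae (Filter.Eventually.of_forall fun x => ?_)
    simp only [hfd]
    ring
  have e2 : ∫ x, fderiv ℝ f x e * conj (weylFun z g x) =
      coeff z (LineDeriv.lineDerivOp e f) g := by
    rw [coeff]
    refine integral_congr_ae (Filter.Eventually.of_forall fun x => ?_)
    simp only [SchwartzMap.lineDerivOp_apply_eq_fderiv, mul_comm]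
  rw [e1, e2] at key
  linear_combination -key

/-- Each factor ξ_j puts one derivative on f or on g, giving 2^n terms in total. The offset m counts
derivatives already taken and keeps the hypothesis stable under the induction. -/
lemma abs_pow_mul_norm_coeff_le_of_forall (z : Phase d) (j : Fin d) {c : ℕ → ℝ} (n : ℕ) :
    ∀ (m : ℕ) (f g : 𝓢(Space d, ℂ)),
    (∀ k l, ‖coeff z (partialDeriv (Pi.single j k) f) (partialDeriv (Pi.single j l) g)‖ ≤
      c (k + l + m)) → |mom z j| ^ n * ‖coeff z f g‖ ≤ 2 ^ n * c (n + m) := by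
  induction n with
  | zero =>
    intro m f g h
    simpa [partialDeriv_single] using h 0 0
  | succ n ih =>
    intro m f g h
    set e : Space d := EuclideanSpace.single j (1 : ℝ) with he
    have h1 := ih (m + 1) (LineDeriv.lineDerivOp e f) g fun k l => by
      have := h (k + 1) l
      rw [partialDeriv_single, partialDeriv_single, pow_succ] at this
      rw [partialDeriv_single, partialDeriv_single]
      rw [show k + l + (m + 1) = k + 1 + l + m by ring]
      exact this
    have h2 := ih (m + 1) f (LineDeriv.lineDerivOp e g) fun k l => by
      have := h k (l + 1)
      rw [partialDeriv_single, partialDeriv_single, pow_succ] at this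
      rw [partialDeriv_single, partialDeriv_single]
      rw [show k + l + (m + 1) = k + (l + 1) + m by ring]
      exact this
    have h3 : |mom z j| * ‖coeff z f g‖ ≤ ‖coeff z (LineDeriv.lineDerivOp e f) g‖ +
        ‖coeff z f (LineDeriv.lineDerivOp e g)‖ := by
      have := congrArg norm (mul_coeff_eq z f g j)
      rw [norm_mul, norm_mul, Complex.norm_I, one_mul, Complex.norm_real, Real.norm_eq_abs] at this
      rw [this]
      exact norm_add_le _ _
    calc _ = |mom z j| ^ n * (|mom z j| * ‖coeff z f g‖) := by ring
      _ ≤ |mom z j| ^ n * (‖coeff z (LineDeriv.lineDerivOp e f) g‖ +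
        ‖coeff z f (LineDeriv.lineDerivOp e g)‖) := by gcongr
      _ ≤ 2 ^ n * c (n + (m + 1)) + 2 ^ n * c (n + (m + 1)) := by
        rw [mul_add]; exact add_le_add h1 h2
      _ = _ := by
        rw [show n + 1 + m = n + (m + 1) by ring]; ring

lemma exists_abs_pow_mul_norm_coeff_le (d : ℕ) {s : ℝ} (hs : 0 < s) (h : {h : ℝ // 0 < h}) :
    ∃ C : ℝ, 0 ≤ C ∧ ∀ (f g : GelfandShilov s d) (z : Phase d),
      ‖coeff z f.toSchwartz g.toSchwartz‖ ≤ C * (gsSeminorm s d h f * gsSeminorm s d h g) ∧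
      ∀ (i : Fin d ⊕ Fin d) (n : ℕ), ‖coeff z f.toSchwartz g.toSchwartz‖ * |z i| ^ n ≤
        C * (gsSeminorm s d h f * gsSeminorm s d h g) * ((2 * (2 ^ s * h.1)) ^ n * (n ! : ℝ) ^ s) := by
  obtain ⟨C, hC, hCf⟩ := exists_integral_monomial_mul_partialDeriv_le d hs h
  have h2s : 1 ≤ (2 : ℝ) ^ s := Real.one_le_rpow one_le_two hs.le
  have hh := h.2
  have hsup : ∀ (f : GelfandShilov s d) x, ‖f.toSchwartz x‖ ≤ gsSeminorm s d h f := fun f x => by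
    simpa using norm_monomial_mul_partialDeriv_le h f 0 0 x
  have hint : ∀ (f : GelfandShilov s d) (j : Fin d) (n : ℕ),
      Integrable fun x : Space d => ‖(x j ^ n : ℂ) * f.toSchwartz x‖ := fun f j n => by
    refine ((f.toSchwartz.integrable_pow_mul volume n).norm).mono' (by fun_prop)
      (Filter.Eventually.of_forall fun x => ?_)
    rw [norm_norm, norm_mul, norm_pow, Complex.norm_real, norm_mul, norm_pow, norm_norm, norm_norm]
    gcongr
    exact PiLp.norm_apply_le x j
  -- The factor 2 comes from the two terms of the position estimate; the other estimates are
  -- weakened to share the constant.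
  refine ⟨2 * C, by positivity, fun f g z => ?_⟩
  have hf : 0 ≤ gsSeminorm s d h f := apply_nonneg _ _
  have hg : 0 ≤ gsSeminorm s d h g := apply_nonneg _ _
  refine ⟨?_, fun i n => ?_⟩
  · refine (norm_coeff_le z f.toSchwartz g.toSchwartz (hsup g)).trans ?_
    have := hCf f 0 0
    simp only [monomial_zero, Complex.ofReal_one, one_mul, factorial_zero, Nat.cast_one,
      Real.one_rpow, mul_one, add_zero, order_zero, pow_zero, partialDeriv_zero] at this
    calc _ ≤ C * gsSeminorm s d h f * gsSeminorm s d h g := by gcongr; exact this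
      _ = C * (gsSeminorm s d h f * gsSeminorm s d h g) := by ring
      _ ≤ _ := by gcongr; linarith
  rw [mul_comm]
  rcases i with j | j
  · have h1 := abs_pow_mul_norm_coeff_le z f.toSchwartz g.toSchwartz j n (hsup f) (hsup g)
      (hint f j n) (hint g j n)
    have h2 : ∀ f : GelfandShilov s d, ∫ x : Space d, ‖(x j ^ n : ℂ) * f.toSchwartz x‖ ≤
        C * gsSeminorm s d h f * ((2 ^ s * h.1) ^ n * (n ! : ℝ) ^ s) := fun f => by
      have := hCf f (Pi.single j n) 0
      simpa using this
    refine h1.trans ?_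
    calc _ ≤ 2 ^ n * (C * gsSeminorm s d h f * ((2 ^ s * h.1) ^ n * (n ! : ℝ) ^ s) *
          gsSeminorm s d h g + gsSeminorm s d h f *
          (C * gsSeminorm s d h g * ((2 ^ s * h.1) ^ n * (n ! : ℝ) ^ s))) := by
          gcongr
          · exact h2 f
          · exact h2 g
      _ = _ := by rw [mul_pow 2]; ring
  · have h1 := abs_pow_mul_norm_coeff_le_of_forall z j n 0 f.toSchwartz g.toSchwartz
      (c := fun m => 2 * C * (gsSeminorm s d h f * gsSeminorm s d h g) *
        ((2 ^ s * h.1) ^ m * (m ! : ℝ) ^ s)) fun k l => by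
      have h2 := hCf f 0 (Pi.single j k)
      have h3 := fun x => norm_monomial_mul_partialDeriv_le h g 0 (Pi.single j l) x
      simp only [zero_add, order_single, factorial_single] at h2 h3
      simp only [monomial_zero, Complex.ofReal_one, one_mul, factorial_zero, Nat.cast_one,
        Real.one_rpow, mul_one] at h2 h3
      refine (norm_coeff_le z _ _ h3).trans ?_
      have h4 : (k ! : ℝ) ^ s * (l ! : ℝ) ^ s ≤ ((k + l)! : ℝ) ^ s := by
        rw [← Real.mul_rpow (by positivity) (by positivity)]
        refine Real.rpow_le_rpow (by positivity) ?_ hs.le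
        exact_mod_cast Nat.le_of_dvd (Nat.factorial_pos _) (Nat.factorial_mul_factorial_dvd_factorial_add k l)
      have h5 : h.1 ^ l ≤ (2 ^ s * h.1) ^ l := by
        gcongr; exact le_mul_of_one_le_left hh.le h2s
      calc _ ≤ C * gsSeminorm s d h f * ((2 ^ s * h.1) ^ k * (k ! : ℝ) ^ s) *
            (gsSeminorm s d h g * ((2 ^ s * h.1) ^ l * (l ! : ℝ) ^ s)) := by gcongr
        _ = C * (gsSeminorm s d h f * gsSeminorm s d h g) * (2 ^ s * h.1) ^ (k + l) *
            ((k ! : ℝ) ^ s * (l ! : ℝ) ^ s) := by rw [pow_add]; ring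
        _ ≤ C * (gsSeminorm s d h f * gsSeminorm s d h g) * (2 ^ s * h.1) ^ (k + l) *
            ((k + l)! : ℝ) ^ s := by gcongr
        _ ≤ 2 * (C * (gsSeminorm s d h f * gsSeminorm s d h g) * (2 ^ s * h.1) ^ (k + l) *
            ((k + l)! : ℝ) ^ s) := le_mul_of_one_le_left (by positivity) one_le_two
        _ = _ := by rw [add_zero]; ring
    refine h1.trans_eq ?_
    rw [add_zero, mul_pow 2]
    ring

/-- Taking 1/s-th powers bounds the n-th term of the exponential series of u by a multiple of
2^{-n}; the 2^s in u provides this geometric factor. Summation and raising to the power s finish. -/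
lemma mul_exp_le_of_forall_pow_le {s h b M t : ℝ} (hs : 0 < s) (hh : 0 < h) (hb : 0 ≤ b)
    (hM : 0 ≤ M) (ht : 0 ≤ t) (H : ∀ n : ℕ, b * t ^ n ≤ M * (h ^ n * (n ! : ℝ) ^ s)) :
    b * Real.exp (s * (t / (2 ^ s * h)) ^ (1 / s)) ≤ 2 ^ s * M := by
  set u := (t / (2 ^ s * h)) ^ (1 / s) with hu
  have hu0 : 0 ≤ u := by positivity
  have h1 : ∀ n : ℕ, b ^ (1 / s) * (u ^ n / n !) ≤ M ^ (1 / s) * (1 / 2) ^ n := fun n => by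
    have e1 : b * (t / (2 ^ s * h)) ^ n ≤ M * ((1 / 2 : ℝ) ^ n * n !) ^ s := by
      have e2 : ((1 / 2 : ℝ) ^ n) ^ s = ((2 ^ s : ℝ) ^ n)⁻¹ := by
        rw [← Real.rpow_natCast, ← Real.rpow_natCast, ← Real.rpow_mul (by positivity),
          ← Real.rpow_mul (by positivity), one_div, Real.inv_rpow (by positivity), mul_comm]
      rw [Real.mul_rpow (by positivity) (by positivity), e2, div_pow, mul_pow]
      calc _ = b * t ^ n * (((2 ^ s : ℝ) ^ n)⁻¹ * (h ^ n)⁻¹) := by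
            rw [div_eq_mul_inv, mul_inv]; ring
        _ ≤ M * (h ^ n * (n ! : ℝ) ^ s) * (((2 ^ s : ℝ) ^ n)⁻¹ * (h ^ n)⁻¹) :=
            mul_le_mul_of_nonneg_right (H n) (by positivity)
        _ = _ := by field_simp
    have e3 := Real.rpow_le_rpow (by positivity) e1 (z := 1 / s) (by positivity)
    rw [Real.mul_rpow hb (by positivity), Real.mul_rpow hM (by positivity),
      ← Real.rpow_mul (x := (1 / 2 : ℝ) ^ n * n !) (by positivity),
      mul_one_div_cancel hs.ne', Real.rpow_one] at e3
    have e4 : ((t / (2 ^ s * h)) ^ n) ^ (1 / s) = u ^ n := by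
      rw [hu, ← Real.rpow_natCast, ← Real.rpow_natCast, ← Real.rpow_mul (by positivity),
        ← Real.rpow_mul (by positivity), mul_comm (n : ℝ)]
    rw [e4] at e3
    rw [← mul_div_assoc, div_le_iff₀ (by positivity)]
    exact e3.trans_eq (by ring)
  have h2 : b ^ (1 / s) * Real.exp u ≤ M ^ (1 / s) * 2 := by
    have s1 := (NormedSpace.expSeries_div_hasSum_exp (𝔸 := ℝ) u).mul_left (b ^ (1 / s))
    have s2 := hasSum_geometric_two.mul_left (M ^ (1 / s))
    rw [← Real.exp_eq_exp_ℝ] at s1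
    exact hasSum_le h1 s1 s2
  have h3 := Real.rpow_le_rpow (by positivity) h2 hs.le
  rw [Real.mul_rpow (by positivity) (by positivity), Real.mul_rpow (by positivity) (by positivity),
    ← Real.rpow_mul hb, ← Real.rpow_mul hM, one_div_mul_cancel hs.ne', Real.rpow_one,
    Real.rpow_one, ← Real.exp_mul] at h3
  rw [mul_comm s, mul_comm _ M]
  exact h3

/-- Decay of the matrix coefficients of functions in `Σ_s`. -/
lemma exists_norm_coeff_mul_gsExp_le (d : ℕ) {s : ℝ} (hs : 0 < s) (r : ℝ) :
    ∃ (C : ℝ) (h : {h : ℝ // 0 < h}), 0 ≤ C ∧ ∀ (f g : GelfandShilov s d) (z : Phase d),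
      ‖coeff z f.toSchwartz g.toSchwartz‖ * gsExp s r z ≤
        C * (gsSeminorm s d h f * gsSeminorm s d h g) := by
  -- The weight increases with r, so a nonpositive rate is covered by the rate 1.
  wlog hr : 0 < r
  · obtain ⟨C, h, hC, H⟩ := this d hs 1 one_pos
    refine ⟨C, h, hC, fun f g z => le_trans ?_ (H f g z)⟩
    gcongr
    exact gsExp_mono s (by linarith) z
  -- The added 1 keeps N positive in dimension zero.
  set N : ℝ := Fintype.card (Fin d ⊕ Fin d) + 1 with hN
  have hN0 : 0 < N := by positivity
  -- This h makes the exponent s (t/(2^s · 2 · 2^s h))^{1/s} equal to r (N t)^{1/s}, which dominates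
  -- r ‖z‖^{1/s}.
  obtain ⟨h, hh, hhe⟩ : ∃ h : ℝ, 0 < h ∧ 2 ^ s * (2 * (2 ^ s * h)) * (r / s) ^ s * N = 1 := by
    refine ⟨(2 ^ s * (2 * 2 ^ s) * (r / s) ^ s * N)⁻¹, by positivity, ?_⟩
    field_simp
  obtain ⟨C, hC, H⟩ := exists_abs_pow_mul_norm_coeff_le d hs ⟨h, hh⟩
  refine ⟨2 ^ s * C, ⟨h, hh⟩, by positivity, fun f g z => ?_⟩
  set p := gsSeminorm s d ⟨h, hh⟩ f * gsSeminorm s d ⟨h, hh⟩ g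
  have hp : 0 ≤ p := mul_nonneg (apply_nonneg _ _) (apply_nonneg _ _)
  obtain ⟨t, ht, hzt, Ht⟩ : ∃ t : ℝ, 0 ≤ t ∧ ‖z‖ ≤ N * t ∧ ∀ n : ℕ,
      ‖coeff z f.toSchwartz g.toSchwartz‖ * t ^ n ≤
        C * p * ((2 * (2 ^ s * h)) ^ n * (n ! : ℝ) ^ s) := by
    rcases isEmpty_or_nonempty (Fin d ⊕ Fin d) with hd | hd
    · refine ⟨0, le_rfl, by rw [Subsingleton.elim z 0, norm_zero, mul_zero], fun n => ?_⟩
      rcases n with _ | n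
      · simpa using (H f g z).1
      · rw [zero_pow n.succ_ne_zero, mul_zero]; positivity
    · obtain ⟨i, hi⟩ := exists_norm_le_card_mul_abs z
      refine ⟨|z i|, abs_nonneg _, hi.trans ?_, fun n => (H f g z).2 i n⟩
      gcongr
      linarith
  have key := mul_exp_le_of_forall_pow_le hs (h := 2 * (2 ^ s * h)) (by positivity)
    (norm_nonneg _) (by positivity) ht Ht
  rw [mul_assoc]
  refine le_trans (mul_le_mul_of_nonneg_left ?_ (norm_nonneg _)) key
  unfold gsExp
  refine Real.exp_le_exp.2 ?_
  have e : t / (2 ^ s * (2 * (2 ^ s * h))) = (r / s) ^ s * (N * t) := by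
    rw [div_eq_iff (by positivity)]
    linear_combination -t * hhe
  rw [e, Real.mul_rpow (by positivity) (by positivity), ← Real.rpow_mul (by positivity),
    mul_one_div_cancel hs.ne', Real.rpow_one, ← mul_assoc, mul_div_cancel₀ _ hs.ne']
  gcongr

end

end Metaplectic

/-! ### Continuity of intertwining operators on Σ_s. -/

namespace Metaplectic

noncomputable section

open Complex (I)
open scoped ComplexConjugate InnerProductSpace ContDiff Nat

variable {d : ℕ}

/-! ### Intertwining operators on Gelfand–Shilov spaces -/

/-- The L² Gaussian is known only almost everywhere, with an exceptional set of x depending on z;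
Fubini exchanges the quantifiers. -/
lemma ae_weylFun_phi_eq_coherent :
    ∀ᵐ x : Space d, ∀ᵐ z : Phase d, weylFun z (phi : L2 d) x = coherent z x := by
  have hm : MeasurableSet {p : Phase d × Space d |
      weylFun p.1 (phi : L2 d) p.2 = coherent p.1 p.2} := by
    have hphi : Measurable (phi : L2 d) := (Lp.stronglyMeasurable _).measurable
    refine measurableSet_eq_fun ?_ contDiff_coherent.continuous.measurable
    unfold weylFun
    exact continuous_weylPhase.measurable.mul (hphi.comp
      (measurable_snd.sub (pos.continuous.measurable.comp measurable_fst)))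
  rw [← Measure.ae_ae_comm (p := fun z x => weylFun z (phi : L2 d) x = coherent z x) hm]
  exact Filter.Eventually.of_forall fun z => weylFun_congr z coeFn_phi

lemma toL2_eq_integral {s : ℝ} {F : Phase d → ℂ} (hF : Integrable F) {f : GelfandShilov s d}
    (hf : ∀ x, f.toSchwartz x = ∫ z, F z * coherent z x) :
    f.toL2 = ∫ z, F z • weyl z phi := by
  refine Lp.ext ?_
  filter_upwards [coeFn_toL2 f, coeFn_integral_weyl hF phi, ae_weylFun_phi_eq_coherent]
    with x h1 h2 h3
  rw [h1, h2, hf]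
  refine integral_congr_ae ?_
  filter_upwards [h3] with z hz
  rw [hz]

lemma integrable_gsExp_neg {s : ℝ} (hs : 0 < s) : Integrable fun z : Phase d => gsExp s (-s) z := by
  set n := Module.finrank ℝ (Phase d) + 1
  have h := integrable_one_add_norm (E := Phase d) (μ := volume) (r := n) (by
    simp only [n]; push_cast; linarith)
  refine (h.const_mul (2 ^ n * (1 + (n ! : ℝ) ^ s))).mono'
    (continuous_gsExp hs _).aestronglyMeasurable (Filter.Eventually.of_forall fun z => ?_)
  have h1 := one_add_norm_pow_le_gsExp hs n z
  have h2 : gsExp s s z * gsExp s (-s) z = 1 := by rw [← gsExp_add, add_neg_cancel, gsExp_zero]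
  have h3 := gsExp_pos s (-s) z
  have h4 : 0 < (1 + ‖z‖) ^ n := by positivity
  rw [Real.norm_of_nonneg h3.le, Real.rpow_neg (by positivity), Real.rpow_natCast,
    ← div_eq_mul_inv, le_div_iff₀ h4]
  calc _ ≤ gsExp s (-s) z * ((2 ^ n * (1 + (n ! : ℝ) ^ s)) * gsExp s s z) := by gcongr
    _ = 2 ^ n * (1 + (n ! : ℝ) ^ s) * (gsExp s s z * gsExp s (-s) z) := by ring
    _ = _ := by rw [h2, mul_one]

/-- Superpositions of coherent states with rapidly decaying coefficients, in `L²`. -/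
lemma exists_toL2_eq_integral (d : ℕ) {s : ℝ} (hs : 1 / 2 < s) :
    ∃ K r : {h : ℝ // 0 < h} → ℝ, (∀ h, 0 ≤ K h) ∧ ∀ (F : Phase d → ℂ) (A : ℝ → ℝ),
      AEStronglyMeasurable F volume → (∀ t z, ‖F z‖ * gsExp s t z ≤ A t) →
      Integrable F ∧ ∃ f : GelfandShilov s d, f.toL2 = ∫ z, F z • weyl z phi ∧
        ∀ h, gsSeminorm s d h f ≤ K h * A (r h) := by
  have hs0 : 0 < s := by linarith
  obtain ⟨K, r, hK, -, H⟩ := exists_gelfandShilov_integral_coherent d hs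
  set J := ∫ z : Phase d, gsExp s (-s) z
  have hJ : 0 ≤ J := integral_nonneg fun z => (gsExp_pos s _ z).le
  -- The extra rate s converts a supremum bound into an integral bound, through the integrable
  -- weight `gsExp s (-s)`.
  refine ⟨fun h => K h * J, fun h => r h + s, fun h => mul_nonneg (hK h) hJ,
    fun F A hF hA => ?_⟩
  have hle : ∀ t z, ‖F z‖ * gsExp s t z ≤ A (t + s) * gsExp s (-s) z := fun t z => by
    have e : gsExp s t z = gsExp s (t + s) z * gsExp s (-s) z := by
      rw [← gsExp_add]; congr 1; ring
    rw [e, ← mul_assoc]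
    exact mul_le_mul_of_nonneg_right (hA _ z) (gsExp_pos s _ z).le
  have hint : ∀ t, Integrable fun z => ‖F z‖ * gsExp s t z := fun t => by
    refine ((integrable_gsExp_neg hs0).const_mul (A (t + s))).mono'
      (hF.norm.mul (continuous_gsExp hs0 t).aestronglyMeasurable)
      (Filter.Eventually.of_forall fun z => ?_)
    rw [Real.norm_of_nonneg (mul_nonneg (norm_nonneg _) (gsExp_pos s _ z).le)]
    exact hle t z
  have hFi : Integrable F := by
    have := hint 0
    simp only [gsExp_zero, mul_one] at this
    exact (integrable_norm_iff hF).1 this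
  obtain ⟨f, hf, hp⟩ := H F hF hint
  refine ⟨hFi, f, toL2_eq_integral hFi hf, fun h => (hp h).trans ?_⟩
  simp only
  rw [mul_assoc]
  refine mul_le_mul_of_nonneg_left ?_ (hK h)
  refine (integral_mono (hint (r h)) ((integrable_gsExp_neg hs0).const_mul (A (r h + s)))
    (hle (r h))).trans_eq ?_
  rw [integral_const_mul, mul_comm]

lemma exists_gsExp_le_gsExp_comp (s r : ℝ) (hs : 0 < s) (M : Phase d ≃L[ℝ] Phase d) :
    ∃ t, ∀ z, gsExp s r z ≤ gsExp s t (M z) := by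
  set K := ‖(M.symm : Phase d →L[ℝ] Phase d)‖
  refine ⟨|r| * K ^ (1 / s), fun z => ?_⟩
  refine (gsExp_mono s (le_abs_self r) z).trans (Real.exp_le_exp.2 ?_)
  have h1 : ‖z‖ ≤ K * ‖M z‖ := by
    have := (M.symm : Phase d →L[ℝ] Phase d).le_opNorm (M z)
    simpa using this
  rw [mul_assoc, ← Real.mul_rpow (norm_nonneg _) (norm_nonneg _)]
  gcongr

/-- Since 1/s < 2, the Gaussian beats the weight; beyond the radius B the term |r|‖z‖^{1/s} is at
most ‖z‖²/4. -/
lemma exists_norm_gweight_mul_gsExp_le {s : ℝ} (hs : 1 / 2 < s) (r : ℝ) :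
    ∃ A, ∀ z : Phase d, ‖gweight z‖ * gsExp s r z ≤ A := by
  have hs0 : 0 < s := by linarith
  set p := 1 / s with hp
  have hp2 : p < 2 := by rw [hp, div_lt_iff₀ hs0]; linarith
  have hp0 : 0 < p := by positivity
  set B := (4 * |r|) ^ (1 / (2 - p)) with hB
  have hB0 : 0 ≤ B := by positivity
  have hBp : B ^ (2 - p) = 4 * |r| := by
    rw [hB, ← Real.rpow_mul (by positivity), one_div_mul_cancel (by linarith), Real.rpow_one]
  refine ⟨Real.exp (|r| * B ^ p), fun z => ?_⟩
  rw [norm_gweight, gsExp, ← Real.exp_add]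
  refine Real.exp_le_exp.2 ?_
  set x := ‖z‖
  have hx : 0 ≤ x := norm_nonneg z
  have h0 : r * x ^ p ≤ |r| * x ^ p := by gcongr; exact le_abs_self r
  rcases le_total x B with h | h
  · have h1 : |r| * x ^ p ≤ |r| * B ^ p := by gcongr
    have : 0 ≤ x ^ 2 := sq_nonneg x
    linarith
  · have h1 : 4 * |r| ≤ x ^ (2 - p) := by
      rw [← hBp]
      exact Real.rpow_le_rpow hB0 h (by linarith)
    have h2 : 4 * |r| * x ^ p ≤ x ^ 2 := by
      calc _ ≤ x ^ (2 - p) * x ^ p := by gcongr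
        _ = x ^ 2 := by
          rcases hx.eq_or_lt with hx | hx
          · rw [← hx, Real.zero_rpow (by linarith)]; simp [hp0.ne']
          · rw [← Real.rpow_add hx, sub_add_cancel, Real.rpow_two]
    have h3 : 0 ≤ |r| * B ^ p := by positivity
    linarith

/-- The reproducing formula for coherent states. -/
lemma integral_inner_smul_weyl_phi {k : L2 d} (hk : Integrable fun z => ⟪weyl z phi, k⟫_ℂ) :
    ∫ z, ⟪weyl z phi, k⟫_ℂ • weyl z phi = (gconst d * (‖(phi : L2 d)‖ ^ 2 : ℝ)) • k := by
  rw [← sub_eq_zero]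
  refine eq_zero_of_inner_weyl_eq_zero phi_ne_zero fun w => ?_
  have hphi : ((‖(phi : L2 d)‖ ^ 2 : ℝ) : ℂ) ≠ 0 := by
    exact_mod_cast norm_phi_sq_pos.ne'
  have hphi' : ⟪phi, (phi : L2 d)⟫_ℂ = (‖(phi : L2 d)‖ ^ 2 : ℝ) := by
    rw [inner_self_eq_norm_sq_to_K]; norm_cast
  -- The Gaussian average is a multiple of the projection on φ. Written out as an integral over u
  -- and with z = w - u, this identity is the claim tested against W(w)φ.
  have key : ⟪phi, gproj (ContinuousLinearMap.id ℝ (Phase d)) (weyl (-w) k)⟫_ℂ =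
      gconst d * ⟪phi, weyl (-w) k⟫_ℂ := by
    rw [gproj_id_apply, inner_smul_right, hphi']
    field_simp
  have h1 := inner_integral_smul_weyl continuous_id hk (weyl w phi) phi
  simp only [id] at h1
  rw [gproj_apply, inner_integral_smul_weyl (ContinuousLinearMap.id ℝ (Phase d)).continuous
    integrable_gweight] at key
  rw [inner_sub_right, sub_eq_zero, h1, inner_smul_right, inner_weyl_left w phi k, mul_right_comm,
    ← key, ← integral_mul_const,
    ← integral_sub_left_eq_self (fun z => ⟪weyl z phi, k⟫_ℂ * ⟪weyl w phi, weyl z phi⟫_ℂ) volume w]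
  refine integral_congr_ae (Filter.Eventually.of_forall fun u => ?_)
  simp only [ContinuousLinearMap.id_apply]
  have e1 : ⟪phi, weyl (u + -w) k⟫_ℂ = ⟪weyl (w - u) phi, k⟫_ℂ := by
    rw [inner_weyl_right]; congr 3; abel
  have e2 : sform w (w - u) = -sform w u := by
    rw [sub_eq_add_neg, sform_add_right, sform_self, sform_neg_right, zero_add]
  have e3 : sform u (-w) = sform w u := by rw [sform_neg_right, ← sform_swap]
  have e4 : ‖w - u - w‖ = ‖u‖ := by rw [← norm_neg]; congr 1; abel
  rw [weyl_weyl, inner_smul_right, e1, inner_weyl_phi_weyl_phi, e2, e3, e4, gweight]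
  rw [neg_div, neg_neg]
  ring

lemma toL2_injective {s : ℝ} : Function.Injective (GelfandShilov.toL2 : GelfandShilov s d → L2 d) :=
  fun _ _ h => Subtype.ext (SchwartzMap.injective_toLp 2 volume h)

lemma toL2_add {s : ℝ} (f g : GelfandShilov s d) : (f + g).toL2 = f.toL2 + g.toL2 := by
  unfold GelfandShilov.toL2
  rw [map_add]
  exact map_add (SchwartzMap.toLpCLM ℂ ℂ 2 volume) _ _

lemma toL2_smul {s : ℝ} (c : ℂ) (f : GelfandShilov s d) : (c • f).toL2 = c • f.toL2 := by
  unfold GelfandShilov.toL2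
  rw [map_smul]
  exact map_smul (SchwartzMap.toLpCLM ℂ ℂ 2 volume) _ _

lemma aestronglyMeasurable_inner_weyl (k l : L2 d) :
    AEStronglyMeasurable (fun z : Phase d => ⟪weyl z k, l⟫_ℂ) volume :=
  ((continuous_weyl k).inner continuous_const).aestronglyMeasurable

/-- The image of the Gaussian under an intertwining operator belongs to `Σ_s`. -/
lemma Intertwines.exists_toL2_eq_symm_phi {s : ℝ} (hs : 1 / 2 < s) {M : Phase d ≃L[ℝ] Phase d}
    (hM : MeasurePreserving M volume volume) {U : L2 d ≃ₗᵢ[ℂ] L2 d} (hU : Intertwines M U) :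
    ∃ g : GelfandShilov s d, g.toL2 = U.symm phi := by
  have hs0 : 0 < s := by linarith
  obtain ⟨K, r, hK, H⟩ := exists_toL2_eq_integral d hs
  have hA : ∀ t, ∃ A, ∀ z, ‖gweight (M z)‖ * gsExp s t z ≤ A := fun t => by
    obtain ⟨t', ht'⟩ := exists_gsExp_le_gsExp_comp s t hs0 M
    obtain ⟨A, hA⟩ := exists_norm_gweight_mul_gsExp_le (d := d) hs t'
    exact ⟨A, fun z => (mul_le_mul_of_nonneg_left (ht' z) (norm_nonneg _)).trans (hA (M z))⟩
  choose A hA using hA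
  -- Because M preserves measure, the superposition with coefficients exp(-|Mz|²/4) is Q_{M⁻¹}φ.
  obtain ⟨-, g, hg, -⟩ := H (fun z => gweight (M z)) A
    (continuous_gweight.comp M.continuous).aestronglyMeasurable hA
  have h1 : g.toL2 = gproj (M.symm : Phase d →L[ℝ] Phase d) phi := by
    rw [hg, gproj_apply]
    have := hM.integral_comp M.toHomeomorph.measurableEmbedding
      (fun z => gweight z • weyl (M.symm z) (phi : L2 d))
    simpa using this
  -- Intertwining gives U Q_{M⁻¹} = Q_id U, and Q_id has range in the multiples of φ. So Ug is a
  -- multiple of φ, nonzero because g is.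
  have h2 : U (gproj (M.symm : Phase d →L[ℝ] Phase d) phi) =
      gproj (ContinuousLinearMap.id ℝ (Phase d)) (U phi) := by
    rw [gproj_apply, gproj_apply, map_integral_smul_weyl U
      (M.symm : Phase d →L[ℝ] Phase d).continuous integrable_gweight]
    refine integral_congr_ae (Filter.Eventually.of_forall fun z => ?_)
    change gweight z • U (weyl (M.symm z) phi) = gweight z • weyl z (U phi)
    rw [hU, ContinuousLinearEquiv.apply_symm_apply]
  rw [gproj_id_apply, ← h1] at h2
  set c := gconst d / (‖(phi : L2 d)‖ ^ 2 : ℝ) * ⟪phi, U phi⟫_ℂ with hc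
  have hg0 : g.toL2 ≠ 0 := by
    intro h0
    refine inner_phi_gproj_phi_ne_zero (M.symm : Phase d →L[ℝ] Phase d) ?_
    rw [← h1, h0, inner_zero_right]
  have hc0 : c ≠ 0 := by
    intro h0
    rw [h0, zero_smul] at h2
    exact hg0 ((map_eq_zero_iff U U.injective).1 h2)
  refine ⟨c⁻¹ • g, ?_⟩
  rw [toL2_smul, inv_smul_eq_iff₀ hc0, ← map_smul, ← h2, LinearIsometryEquiv.symm_apply_apply]

/-- Unitary operators which intertwine the Weyl operators act continuously on `Σ_s`. -/
theorem Intertwines.exists_continuousLinearMap {s : ℝ} (hs : 1 / 2 < s) {M : Phase d ≃L[ℝ] Phase d}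
    (hM : MeasurePreserving M volume volume) {U : L2 d ≃ₗᵢ[ℂ] L2 d} (hU : Intertwines M U) :
    ∃ T : GelfandShilov s d →L[ℂ] GelfandShilov s d, ∀ f, (T f).toL2 = U f.toL2 := by
  have hs0 : 0 < s := by linarith
  obtain ⟨K, r, hK, H⟩ := exists_toL2_eq_integral d hs
  obtain ⟨g, hg⟩ := hU.exists_toL2_eq_symm_phi hs hM
  have hA : ∀ t, ∃ (A : ℝ) (h : {h : ℝ // 0 < h}), 0 ≤ A ∧ ∀ (f : GelfandShilov s d) z,
      ‖⟪weyl z phi, U f.toL2⟫_ℂ‖ * gsExp s t z ≤ A * gsSeminorm s d h f := fun t => by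
    obtain ⟨t', ht'⟩ := exists_gsExp_le_gsExp_comp s t hs0 M.symm
    obtain ⟨A, h, hA, hAf⟩ := exists_norm_coeff_mul_gsExp_le d hs0 t'
    refine ⟨A * gsSeminorm s d h g, h, mul_nonneg hA (apply_nonneg _ _), fun f z => ?_⟩
    -- Unitarity and intertwining move U onto the Gaussian: the coefficient is ⟨W(M⁻¹z)U⁻¹φ, f⟩,
    -- with both vectors in Σ_s.
    have e : ⟪weyl z phi, U f.toL2⟫_ℂ = coeff (M.symm z) f.toSchwartz g.toSchwartz := by
      rw [← inner_weyl_toL2, hg, ← U.inner_map_map (weyl (M.symm z) (U.symm phi)), hU, LinearIsometryEquiv.apply_symm_apply,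
        ContinuousLinearEquiv.apply_symm_apply]
    rw [e]
    calc _ ≤ ‖coeff (M.symm z) f.toSchwartz g.toSchwartz‖ * gsExp s t' (M.symm z) := by
          gcongr; exact ht' z
      _ ≤ A * (gsSeminorm s d h f * gsSeminorm s d h g) := hAf f g _
      _ = _ := by ring
  choose A h hA0 hA using hA
  set c := gconst d * (‖(phi : L2 d)‖ ^ 2 : ℝ) with hc
  have hc0 : c ≠ 0 := mul_ne_zero gconst_ne_zero (by exact_mod_cast norm_phi_sq_pos.ne')
  have hT : ∀ f : GelfandShilov s d, ∃ u : GelfandShilov s d, u.toL2 = U f.toL2 ∧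
      ∀ k, gsSeminorm s d k u ≤ ‖c⁻¹‖ * (K k * A (r k)) * gsSeminorm s d (h (r k)) f := fun f => by
    obtain ⟨hi, u, hu, hp⟩ := H (fun z => ⟪weyl z phi, U f.toL2⟫_ℂ)
      (fun t => A t * gsSeminorm s d (h t) f) (aestronglyMeasurable_inner_weyl _ _)
      (fun t z => hA t f z)
    refine ⟨c⁻¹ • u, ?_, fun k => ?_⟩
    · rw [toL2_smul, inv_smul_eq_iff₀ hc0, hu]
      exact integral_inner_smul_weyl_phi hi
    · rw [map_smul_eq_mul, mul_assoc, mul_assoc]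
      exact mul_le_mul_of_nonneg_left (hp k) (norm_nonneg _)
  choose T hT1 hT2 using hT
  let L : GelfandShilov s d →ₗ[ℂ] GelfandShilov s d :=
    { toFun := T
      map_add' := fun f g => toL2_injective (by rw [toL2_add, hT1, hT1, hT1, toL2_add, map_add])
      map_smul' := fun a f => toL2_injective (by
        rw [RingHom.id_apply, toL2_smul, hT1, hT1, toL2_smul, map_smul]) }
  refine ⟨⟨L, ?_⟩, hT1⟩
  refine WithSeminorms.continuous_of_isBounded (withSeminorms_gsSeminorm s d)
    (withSeminorms_gsSeminorm s d) L fun k =>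
      ⟨{h (r k)}, ⟨‖c⁻¹‖ * (K k * A (r k)), by have := hK k; have := hA0 (r k); positivity⟩, ?_⟩
  intro f
  rw [Finset.sup_singleton]
  exact hT2 f k

end

end Metaplectic

/-! ### Transposes with respect to the bilinear pairing. -/

namespace Metaplectic

noncomputable section

open Complex (I)
open scoped ComplexConjugate InnerProductSpace ContDiff Nat

variable {d : ℕ}

/-! ### Complex conjugation and transposes -/

lemma coeFn_star_L2 (f : L2 d) : (star f : L2 d) =ᵐ[volume] fun x => conj (f x) := Lp.coeFn_star f

lemma inner_star_star (f g : L2 d) : ⟪star f, star g⟫_ℂ = conj ⟪f, g⟫_ℂ := by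
  rw [inner_eq_integral, inner_eq_integral, ← integral_conj]
  refine integral_congr_ae ?_
  filter_upwards [coeFn_star_L2 f, coeFn_star_L2 g] with x h1 h2
  rw [h1, h2, map_mul]

lemma star_add_L2 (f g : L2 d) : star (f + g) = star f + star g := by
  refine Lp.ext ?_
  filter_upwards [coeFn_star_L2 f, coeFn_star_L2 g, coeFn_star_L2 (f + g), Lp.coeFn_add f g,
    Lp.coeFn_add (star f) (star g)] with x h1 h2 h3 h4 h5
  rw [h3, h4, h5, Pi.add_apply, Pi.add_apply, h1, h2, map_add]

lemma star_smul_L2 (c : ℂ) (f : L2 d) : star (c • f) = conj c • star f := by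
  refine Lp.ext ?_
  filter_upwards [coeFn_star_L2 f, coeFn_star_L2 (c • f), Lp.coeFn_smul c f,
    Lp.coeFn_smul (conj c) (star f)] with x h1 h2 h3 h4
  rw [h2, h3, h4, Pi.smul_apply, Pi.smul_apply, h1, smul_eq_mul, smul_eq_mul, map_mul]

lemma norm_star_L2 (f : L2 d) : ‖star f‖ = ‖f‖ := by
  have h := inner_star_star f f
  rw [inner_self_eq_norm_sq_to_K, inner_self_eq_norm_sq_to_K, map_pow, RCLike.conj_ofReal] at h
  have h' : ‖star f‖ ^ 2 = ‖f‖ ^ 2 := by exact_mod_cast h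
  exact (sq_eq_sq₀ (norm_nonneg _) (norm_nonneg _)).1 h'

/-- The reflection `(x, ξ) ↦ (x, -ξ)`. -/
def momNeg (d : ℕ) : Phase d ≃ₗᵢ[ℝ] Phase d :=
  LinearIsometryEquiv.mk (LinearEquiv.ofInvolutive
    { toFun := fun z => phasePoint (pos z) (-mom z)
      map_add' := fun z w => by
        ext i; rcases i with i | i <;> simp [phasePoint, add_comm]
      map_smul' := fun c z => by
        ext i; rcases i with i | i <;> simp [phasePoint] }
    (fun z => by simp)) fun z => by
      have h : ‖phasePoint (pos z) (-mom z)‖ ^ 2 = ‖z‖ ^ 2 := by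
        rw [norm_sq_phase, norm_sq_phase]; simp
      exact (sq_eq_sq₀ (norm_nonneg _) (norm_nonneg _)).1 h

lemma momNeg_apply (z : Phase d) : momNeg d z = phasePoint (pos z) (-mom z) := rfl

@[simp] lemma momNeg_momNeg (z : Phase d) : momNeg d (momNeg d z) = z := by
  simp [momNeg_apply]

lemma conj_weylPhase (z : Phase d) (x : Space d) :
    conj (weylPhase z x) = weylPhase (momNeg d z) x := by
  rw [weylPhase, weylPhase, ← Complex.exp_conj, map_mul, Complex.conj_I, Complex.conj_ofReal]
  congr 1
  simp [momNeg_apply]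
  ring

lemma star_weyl (z : Phase d) (k : L2 d) : star (weyl z k) = weyl (momNeg d z) (star k) := by
  refine Lp.ext ?_
  filter_upwards [coeFn_star_L2 (weyl z k), coeFn_weyl z k, coeFn_weyl (momNeg d z) (star k),
    weylFun_congr (momNeg d z) (coeFn_star_L2 k)] with x h1 h2 h3 h4
  rw [h1, h2, h3, h4, weylFun, weylFun, map_mul, conj_weylPhase]
  simp [momNeg_apply]

lemma star_phi : star (phi : L2 d) = phi := by
  refine Lp.ext ?_
  filter_upwards [coeFn_star_L2 (phi : L2 d), coeFn_phi (d := d)] with x h1 h2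
  rw [h1, h2, conj_gauss]

/-- The transpose of a unitary operator with respect to the bilinear pairing. -/
def transpose (U : L2 d ≃ₗᵢ[ℂ] L2 d) : L2 d ≃ₗᵢ[ℂ] L2 d where
  toFun k := star (U.symm (star k))
  invFun k := star (U (star k))
  map_add' k l := by rw [star_add_L2, map_add, star_add_L2]
  map_smul' c k := by
    rw [star_smul_L2, map_smul, star_smul_L2, Complex.conj_conj, RingHom.id_apply]
  left_inv k := by simp
  right_inv k := by simp
  norm_map' k := by
    change ‖star (U.symm (star k))‖ = ‖k‖
    rw [norm_star_L2, LinearIsometryEquiv.norm_map, norm_star_L2]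

lemma transpose_apply (U : L2 d ≃ₗᵢ[ℂ] L2 d) (k : L2 d) :
    transpose U k = star (U.symm (star k)) := rfl

lemma Intertwines.symm {M : Phase d ≃L[ℝ] Phase d} {U : L2 d ≃ₗᵢ[ℂ] L2 d} (hU : Intertwines M U)
    (z : Phase d) (k : L2 d) : U.symm (weyl z k) = weyl (M.symm z) (U.symm k) := by
  rw [LinearIsometryEquiv.symm_apply_eq, hU, ContinuousLinearEquiv.apply_symm_apply,
    LinearIsometryEquiv.apply_symm_apply]

/-- Conjugation carries W(z) to W(κz) with κ the momentum reflection, and U⁻¹ carries it to W(M⁻¹z);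
the composite yields κM⁻¹κ. -/
lemma Intertwines.transpose {M : Phase d ≃L[ℝ] Phase d} {U : L2 d ≃ₗᵢ[ℂ] L2 d}
    (hU : Intertwines M U) :
    Intertwines ((momNeg d).toContinuousLinearEquiv.trans
      (M.symm.trans (momNeg d).toContinuousLinearEquiv)) (transpose U) := by
  intro z k
  rw [transpose_apply, star_weyl, hU.symm, star_weyl]
  rfl

lemma inner_star_left_eq_integral (f g : L2 d) : ⟪star f, g⟫_ℂ = ∫ x, f x * g x := by
  rw [inner_eq_integral]
  refine integral_congr_ae ?_
  filter_upwards [coeFn_star_L2 f] with x h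
  rw [h, Complex.conj_conj]

lemma pairing_eq_inner {s : ℝ} (f g : GelfandShilov s d) :
    pairing f g = ⟪star f.toL2, g.toL2⟫_ℂ := by
  rw [inner_star_left_eq_integral]
  refine integral_congr_ae ?_
  filter_upwards [coeFn_toL2 f, coeFn_toL2 g] with x h1 h2
  rw [h1, h2]

lemma inner_star_map (U : L2 d ≃ₗᵢ[ℂ] L2 d) (k l : L2 d) :
    ⟪star (U k), l⟫_ℂ = ⟪star k, transpose U l⟫_ℂ := by
  rw [transpose_apply, inner_star_star, ← U.inner_map_map k, LinearIsometryEquiv.apply_symm_apply,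
    ← inner_star_star, star_star]

/-- The transpose of the restriction of an intertwining operator. -/
theorem Intertwines.exists_pairing_eq {s : ℝ} (hs : 1 / 2 < s) {M : Phase d ≃L[ℝ] Phase d}
    (hM : MeasurePreserving M volume volume) {U : L2 d ≃ₗᵢ[ℂ] L2 d} (hU : Intertwines M U)
    {T : GelfandShilov s d →L[ℂ] GelfandShilov s d} (hT : ∀ f, (T f).toL2 = U f.toL2) :
    ∃ T' : GelfandShilov s d →L[ℂ] GelfandShilov s d, ∀ f g,
      pairing (T f) g = pairing f (T' g) := by
  have hM' : MeasurePreserving M.symm volume volume :=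
    MeasurePreserving.symm M.toHomeomorph.toMeasurableEquiv hM
  -- For continuity on Σ_s only measure preservation of κM⁻¹κ has to be checked.
  obtain ⟨T', hT'⟩ := hU.transpose.exists_continuousLinearMap hs
    (((momNeg d).measurePreserving.comp hM').comp (momNeg d).measurePreserving)
  refine ⟨T', fun f g => ?_⟩
  rw [pairing_eq_inner, pairing_eq_inner, hT, hT', inner_star_map]

end

end Metaplectic

/-! ### Density of Σ_s in the dual by truncated coherent state expansions. -/

namespace Metaplectic

noncomputable section

open Complex (I)
open scoped ComplexConjugate InnerProductSpace ContDiff Nat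

variable {d : ℕ} {s : ℝ}

/-! ### Density of `Σ_s` in its dual -/

/-- `f` is the superposition of coherent states with coefficients `F`. -/
def IsSynth (F : Phase d → ℂ) (f : GelfandShilov s d) : Prop :=
  ∀ x, f.toSchwartz x = ∫ z, F z * coherent z x

/-- Coefficients which decay rapidly enough to define elements of `Σ_s`. -/
def IsRapid (s : ℝ) (F : Phase d → ℂ) : Prop :=
  AEStronglyMeasurable F volume ∧ ∀ t, Integrable fun z => ‖F z‖ * gsExp s t z

lemma IsRapid.integrable {F : Phase d → ℂ} (hF : IsRapid s F) : Integrable F := by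
  have := hF.2 0
  simp only [gsExp_zero, mul_one] at this
  exact (integrable_norm_iff hF.1).1 this

lemma IsRapid.integrable_mul_coherent {F : Phase d → ℂ} (hF : IsRapid s F) (x : Space d) :
    Integrable fun z => F z * coherent z x := by
  refine hF.integrable.mul_bdd (c := 1)
    (continuous_of_jointly_contDiff contDiff_coherent x).aestronglyMeasurable
    (Filter.Eventually.of_forall fun z => ?_)
  rw [norm_coherent]
  exact Real.exp_le_one_iff.2 (by nlinarith [sq_nonneg ‖x - pos z‖])

lemma IsSynth.unique {F : Phase d → ℂ} {f g : GelfandShilov s d} (hf : IsSynth F f)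
    (hg : IsSynth F g) : f = g :=
  Subtype.ext (SchwartzMap.ext fun x => (hf x).trans (hg x).symm)

lemma IsSynth.congr {F G : Phase d → ℂ} {f : GelfandShilov s d} (hf : IsSynth F f)
    (h : F =ᵐ[volume] G) : IsSynth G f := fun x => (hf x).trans (integral_congr_ae (by
  filter_upwards [h] with z hz
  rw [hz]))

lemma IsSynth.add {F G : Phase d → ℂ} {f g : GelfandShilov s d} (hf : IsSynth F f)
    (hg : IsSynth G g) (hF : IsRapid s F) (hG : IsRapid s G) :
    IsSynth (fun z => F z + G z) (f + g) := fun x => by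
  rw [map_add, add_apply, hf, hg,
    ← integral_add (hF.integrable_mul_coherent x) (hG.integrable_mul_coherent x)]
  simp only [add_mul]

lemma IsSynth.smul {F : Phase d → ℂ} {f : GelfandShilov s d} (hf : IsSynth F f) (c : ℂ) :
    IsSynth (fun z => c * F z) (c • f) := fun x => by
  rw [map_smul, smul_apply, hf, smul_eq_mul, ← integral_const_mul]
  simp only [mul_assoc]

lemma IsRapid.exists_isSynth (hs : 1 / 2 < s) {F : Phase d → ℂ} (hF : IsRapid s F) :
    ∃ f : GelfandShilov s d, IsSynth F f := by
  obtain ⟨K, r, -, -, H⟩ := exists_gelfandShilov_integral_coherent d hs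
  obtain ⟨f, hf, -⟩ := H F hF.1 hF.2
  exact ⟨f, hf⟩

/-- Continuity bounds u by finitely many seminorms, each controlled by a weighted L¹ norm of the
coefficients. The rates are nonnegative, so their sum serves for all of them. -/
lemma exists_norm_apply_le_integral (hs : 1 / 2 < s) (u : GSDist s d) :
    ∃ B r : ℝ, 0 ≤ B ∧ ∀ (F : Phase d → ℂ) (f : GelfandShilov s d), IsRapid s F → IsSynth F f →
      ‖u f‖ ≤ B * ∫ z, ‖F z‖ * gsExp s r z := by
  obtain ⟨K, r, hK, hr, H⟩ := exists_gelfandShilov_integral_coherent d hs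
  obtain ⟨t, C, -, hC⟩ := Seminorm.bound_of_continuous (withSeminorms_gsSeminorm s d)
    ((normSeminorm ℂ ℂ).comp u.toLinearMap) (continuous_norm.comp u.continuous)
  refine ⟨∑ h ∈ t, C * K h, ∑ h ∈ t, r h, Finset.sum_nonneg fun h _ => by
    have := hK h; positivity, fun F f hF hf => ?_⟩
  obtain ⟨f', hf', hp⟩ := H F hF.1 hF.2
  obtain rfl := hf.unique hf'
  have h1 : ‖u f‖ ≤ C * (t.sup (gsSeminorm s d)) f := hC f
  have h2 : (t.sup (gsSeminorm s d)) f ≤ ∑ h ∈ t, gsSeminorm s d h f := by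
    exact Seminorm.finset_sup_apply_le (Finset.sum_nonneg fun h _ => apply_nonneg _ _)
      fun h hh => Finset.single_le_sum (f := fun h => gsSeminorm s d h f)
        (fun h _ => apply_nonneg _ _) hh
  refine h1.trans ((mul_le_mul_of_nonneg_left h2 C.2).trans ?_)
  rw [Finset.mul_sum, Finset.sum_mul]
  refine Finset.sum_le_sum fun h hh => ?_
  rw [mul_assoc]
  refine mul_le_mul_of_nonneg_left ((hp h).trans (mul_le_mul_of_nonneg_left ?_ (hK h))) C.2
  refine integral_mono (hF.2 _) (hF.2 _) fun z => mul_le_mul_of_nonneg_left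
    (gsExp_mono s (Finset.single_le_sum (fun h _ => hr h) hh) z) (norm_nonneg _)

/-- Truncation of functions on phase space. -/
def cut (R : ℝ) (F : Phase d → ℂ) : Phase d → ℂ := (Metric.closedBall 0 R).indicator F

lemma gsExp_le_of_mem (hs : 0 < s) (t : ℝ) {R : ℝ} {z : Phase d}
    (hz : z ∈ Metric.closedBall (0 : Phase d) R) :
    gsExp s t z ≤ Real.exp (|t| * R ^ (1 / s)) := by
  rw [mem_closedBall_zero_iff] at hz
  refine (gsExp_mono s (le_abs_self t) z).trans (Real.exp_le_exp.2 ?_)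
  gcongr

lemma isRapid_cut (hs : 0 < s) (R : ℝ) {F : Phase d → ℂ} (hF : LocallyIntegrable F) :
    IsRapid s (cut R F) := by
  have hi : Integrable (cut R F) :=
    (integrable_indicator_iff Metric.isClosed_closedBall.measurableSet).2
      (hF.integrableOn_isCompact (isCompact_closedBall 0 R))
  refine ⟨hi.aestronglyMeasurable, fun t => ?_⟩
  refine (hi.norm.mul_const (Real.exp (|t| * R ^ (1 / s)))).mono'
    (hi.aestronglyMeasurable.norm.mul (continuous_gsExp hs t).aestronglyMeasurable)
    (Filter.Eventually.of_forall fun z => ?_)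
  rw [Real.norm_of_nonneg (mul_nonneg (norm_nonneg _) (gsExp_pos s t z).le)]
  by_cases hz : z ∈ Metric.closedBall (0 : Phase d) R
  · gcongr
    exact gsExp_le_of_mem hs t hz
  · simp [cut, hz]

/-- The Hilbert space `L²` on phase space. -/
abbrev L2Phase (d : ℕ) : Type := Lp ℂ 2 (volume : Measure (Phase d))

lemma locallyIntegrable_L2Phase (G : L2Phase d) : LocallyIntegrable G volume :=
  (Lp.memLp G).locallyIntegrable one_le_two

lemma exists_integral_cut_le (hs : 0 < s) (d : ℕ) (R t : ℝ) :
    ∃ C, ∀ G : L2Phase d, ∫ z, ‖cut R G z‖ * gsExp s t z ≤ C * ‖G‖ := by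
  have hB : MeasurableSet (Metric.closedBall (0 : Phase d) R) :=
    Metric.isClosed_closedBall.measurableSet
  have hBf : volume (Metric.closedBall (0 : Phase d) R) ≠ ⊤ :=
    (isCompact_closedBall 0 R).measure_lt_top.ne
  set e : Lp ℝ 2 (volume : Measure (Phase d)) := indicatorConstLp 2 hB hBf (1 : ℝ)
  refine ⟨Real.exp (|t| * R ^ (1 / s)) * ‖e‖, fun G => ?_⟩
  have hr := isRapid_cut hs R (locallyIntegrable_L2Phase G)
  set N : Lp ℝ 2 (volume : Measure (Phase d)) := (Lp.memLp G).norm.toLp _ with hN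
  have hNn : ‖N‖ = ‖G‖ := by
    rw [hN, Lp.norm_toLp, eLpNorm_norm, Lp.norm_def]
  have h1 : ∫ z, ‖cut R G z‖ = ⟪e, N⟫_ℝ := by
    rw [L2.inner_indicatorConstLp_one, ← integral_indicator hB]
    refine integral_congr_ae ?_
    filter_upwards [(Lp.memLp G).norm.coeFn_toLp] with z hz
    rw [cut, norm_indicator_eq_indicator_norm]
    simp only [Set.indicator]
    rw [hz]
  calc _ ≤ ∫ z, ‖cut R G z‖ * Real.exp (|t| * R ^ (1 / s)) := by
        refine integral_mono (hr.2 t) (hr.integrable.norm.mul_const _) fun z => ?_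
        by_cases hz : z ∈ Metric.closedBall (0 : Phase d) R
        · exact mul_le_mul_of_nonneg_left (gsExp_le_of_mem hs t hz) (norm_nonneg _)
        · simp [cut, hz]
    _ = Real.exp (|t| * R ^ (1 / s)) * ⟪e, N⟫_ℝ := by rw [integral_mul_const, h1, mul_comm]
    _ ≤ Real.exp (|t| * R ^ (1 / s)) * (‖e‖ * ‖N‖) := by
        gcongr; exact real_inner_le_norm e N
    _ = _ := by rw [hNn, mul_assoc]

/-- A distribution applied to truncated superpositions is given by a square integrable kernel. -/
lemma exists_kernel (hs : 1 / 2 < s) (u : GSDist s d) (R : ℝ) :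
    ∃ k : L2Phase d, ∀ (G : L2Phase d) (f : GelfandShilov s d), IsSynth (cut R G) f →
      u f = ⟪k, G⟫_ℂ := by
  have hs0 : 0 < s := by linarith
  obtain ⟨B, r, hB, hu⟩ := exists_norm_apply_le_integral hs u
  obtain ⟨C, hC⟩ := exists_integral_cut_le hs0 d R r
  have hr := fun G : L2Phase d => isRapid_cut hs0 R (locallyIntegrable_L2Phase G)
  choose S hS using fun G : L2Phase d => (hr G).exists_isSynth hs
  -- Synthesis is linear because the coefficients determine the synthesized function.
  have hSadd : ∀ G H, S (G + H) = S G + S H := fun G H => by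
    refine (hS (G + H)).unique (((hS G).add (hS H) (hr G) (hr H)).congr ?_)
    filter_upwards [Lp.coeFn_add G H] with z hz
    simp only [cut, Set.indicator]
    split_ifs
    · exact hz.symm
    · simp
  have hSsmul : ∀ (c : ℂ) G, S (c • G) = c • S G := fun c G => by
    refine (hS (c • G)).unique (((hS G).smul c).congr ?_)
    filter_upwards [Lp.coeFn_smul c G] with z hz
    simp only [cut, Set.indicator]
    split_ifs
    · exact hz.symm
    · simp
  let L : L2Phase d →ₗ[ℂ] ℂ :=
    { toFun := fun G => u (S G)
      map_add' := fun G H => by rw [hSadd, map_add]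
      map_smul' := fun c G => by rw [hSsmul, map_smul, RingHom.id_apply] }
  -- On a ball the weight is bounded and L² embeds in L¹, so the functional is L²-bounded and the
  -- Riesz theorem supplies the kernel.
  let Λ : StrongDual ℂ (L2Phase d) := L.mkContinuous (B * C) fun G => by
    rw [mul_assoc]
    exact (hu _ _ (hr G) (hS G)).trans (mul_le_mul_of_nonneg_left (hC G) hB)
  refine ⟨(InnerProductSpace.toDual ℂ (L2Phase d)).symm Λ, fun G f hf => ?_⟩
  rw [InnerProductSpace.toDual_symm_apply, hf.unique (hS G)]
  rfl

/-- The coefficients of `g` with respect to the coherent states. -/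
def bargmann (g : GelfandShilov s d) (z : Phase d) : ℂ := ⟪weyl z phi, g.toL2⟫_ℂ

lemma continuous_bargmann (g : GelfandShilov s d) : Continuous (bargmann g) :=
  (continuous_weyl phi).inner continuous_const

/-- The Gaussian lies in Σ_s, by the result on U⁻¹φ with U the identity, so the decay of matrix
coefficients applies. -/
lemma exists_norm_bargmann_mul_gsExp_le (d : ℕ) (hs : 1 / 2 < s) (t : ℝ) :
    ∃ (A : ℝ) (h : {h : ℝ // 0 < h}), 0 ≤ A ∧ ∀ (g : GelfandShilov s d) z,
      ‖bargmann g z‖ * gsExp s t z ≤ A * gsSeminorm s d h g := by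
  have hs0 : 0 < s := by linarith
  obtain ⟨p, hp⟩ := Intertwines.exists_toL2_eq_symm_phi (d := d) hs
    (M := ContinuousLinearEquiv.refl ℝ (Phase d)) (U := LinearIsometryEquiv.refl ℂ (L2 d))
    (MeasurePreserving.id volume) fun z k => rfl
  obtain ⟨A, h, hA, H⟩ := exists_norm_coeff_mul_gsExp_le d hs0 t
  refine ⟨A * gsSeminorm s d h p, h, mul_nonneg hA (apply_nonneg _ _), fun g z => ?_⟩
  have e : bargmann g z = coeff z g.toSchwartz p.toSchwartz := by
    rw [← inner_weyl_toL2, hp]; rfl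
  rw [e]
  refine (H g p z).trans_eq ?_
  ring

lemma isRapid_bargmann (hs : 1 / 2 < s) (g : GelfandShilov s d) : IsRapid s (bargmann g) := by
  have hs0 : 0 < s := by linarith
  refine ⟨(continuous_bargmann g).aestronglyMeasurable, fun t => ?_⟩
  obtain ⟨A, h, -, H⟩ := exists_norm_bargmann_mul_gsExp_le d hs (t + s)
  refine ((integrable_gsExp_neg hs0).const_mul (A * gsSeminorm s d h g)).mono'
    ((continuous_bargmann g).norm.mul (continuous_gsExp hs0 t)).aestronglyMeasurable
    (Filter.Eventually.of_forall fun z => ?_)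
  have e : gsExp s t z = gsExp s (t + s) z * gsExp s (-s) z := by
    rw [← gsExp_add]; congr 1; ring
  rw [Real.norm_of_nonneg (mul_nonneg (norm_nonneg _) (gsExp_pos s t z).le), e, ← mul_assoc]
  exact mul_le_mul_of_nonneg_right (H g z) (gsExp_pos s _ z).le

/-- The reproducing formula holds in L², and injectivity of the inclusion makes it pointwise. -/
lemma isSynth_bargmann (hs : 1 / 2 < s) (g : GelfandShilov s d) :
    IsSynth (bargmann g) ((gconst d * (‖(phi : L2 d)‖ ^ 2 : ℝ)) • g) := by
  obtain ⟨f, hf⟩ := (isRapid_bargmann hs g).exists_isSynth hs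
  have h1 := toL2_eq_integral (isRapid_bargmann hs g).integrable hf
  have h2 := integral_inner_smul_weyl_phi (isRapid_bargmann hs g).integrable
  have h3 : f = (gconst d * (‖(phi : L2 d)‖ ^ 2 : ℝ)) • g :=
    toL2_injective (by rw [toL2_smul, h1]; exact h2)
  rwa [← h3]

/-- The Gaussian is real, so reflecting the momentum exchanges the Hermitian coefficient of g for a
bilinear one. -/
lemma bargmann_momNeg (g : GelfandShilov s d) (z : Phase d) :
    bargmann g (momNeg d z) = ⟪star g.toL2, weyl z phi⟫_ℂ := by
  rw [bargmann, ← star_phi, ← star_weyl, inner_star_left_eq_integral, inner_star_left_eq_integral,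
    star_phi]
  simp only [mul_comm]

/-- A distribution applied to the truncated superposition of `g` is the pairing with a function
in `Σ_s`. -/
lemma exists_pairing_eq_cut (hs : 1 / 2 < s) (u : GSDist s d) (R : ℝ) :
    ∃ v : GelfandShilov s d, ∀ g f : GelfandShilov s d, IsSynth (cut R (bargmann g)) f →
      u f = pairing v g := by
  have hs0 : 0 < s := by linarith
  have hB : MeasurableSet (Metric.closedBall (0 : Phase d) R) :=
    Metric.isClosed_closedBall.measurableSet
  obtain ⟨k, hk⟩ := exists_kernel hs u R
  have hmp : MeasurePreserving (momNeg d) volume volume := (momNeg d).measurePreserving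
  -- The pairing is bilinear while the kernel represents u sesquilinearly, so k is conjugated and
  -- its momentum reflected. The ball is invariant under the reflection.
  set k' : L2Phase d := Lp.compMeasurePreserving (momNeg d) hmp (star k) with hk'
  have hk'c : k' =ᵐ[volume] fun z => conj (k (momNeg d z)) := by
    filter_upwards [Lp.coeFn_compMeasurePreserving (star k) hmp,
      hmp.quasiMeasurePreserving.ae_eq_comp (Lp.coeFn_star k)] with z h1 h2
    rw [h1, h2]; rfl
  have hr := isRapid_cut hs0 R (locallyIntegrable_L2Phase k')
  obtain ⟨v, hv⟩ := hr.exists_isSynth hs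
  refine ⟨v, fun g f hf => ?_⟩
  have hm : MemLp (cut R (bargmann g)) 2 volume := by
    refine (memLp_indicator_iff_restrict hB).2 ?_
    have : IsFiniteMeasure (volume.restrict (Metric.closedBall (0 : Phase d) R)) :=
      isFiniteMeasure_restrict.2 (isCompact_closedBall 0 R).measure_lt_top.ne
    refine MemLp.of_bound (continuous_bargmann g).aestronglyMeasurable
      (‖(phi : L2 d)‖ * ‖g.toL2‖) (Filter.Eventually.of_forall fun z => ?_)
    refine (norm_inner_le_norm _ _).trans_eq ?_
    rw [LinearIsometry.norm_map]
  have hG : cut R (hm.toLp _) =ᵐ[volume] cut R (bargmann g) := by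
    filter_upwards [hm.coeFn_toLp] with z hz
    simp only [cut, Set.indicator] at hz ⊢
    split_ifs with h
    · rw [hz, if_pos h]
    · rfl
  have h1 : ⟪star g.toL2, v.toL2⟫_ℂ = pairing v g := by
    rw [pairing_eq_inner, inner_star_left_eq_integral, inner_star_left_eq_integral]
    simp only [mul_comm]
  have h2 := inner_integral_smul_weyl continuous_id hr.integrable (star g.toL2) phi
  simp only [id] at h2
  rw [hk _ f (hf.congr hG.symm), ← h1, toL2_eq_integral hr.integrable hv, h2, L2.inner_def,
    ← hmp.integral_comp (momNeg d).toHomeomorph.measurableEmbedding]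
  refine integral_congr_ae ?_
  filter_upwards [hk'c, hmp.quasiMeasurePreserving.ae_eq_comp hm.coeFn_toLp] with z h3 h4
  simp only [Function.comp_apply] at h4
  rw [RCLike.inner_apply, h4, ← bargmann_momNeg]
  simp only [cut, Set.indicator, h3, mem_closedBall_zero_iff, LinearIsometryEquiv.norm_map]
  split_ifs
  · rw [mul_comm]
  · simp

/-- Distributions are approximated by functions in `Σ_s`, uniformly with respect to one of the
seminorms. -/
lemma exists_norm_sub_pairing_le (hs : 1 / 2 < s) (u : GSDist s d) :
    ∃ (C : ℝ) (h : {h : ℝ // 0 < h}), 0 ≤ C ∧ ∀ R : ℝ, 0 < R → ∃ v : GelfandShilov s d,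
      ∀ g : GelfandShilov s d, ‖u g - pairing v g‖ ≤ C / R * gsSeminorm s d h g := by
  have hs0 : 0 < s := by linarith
  obtain ⟨B, r, hB, hu⟩ := exists_norm_apply_le_integral hs u
  -- The rate r serves the bound on u, one s yields the gain 1/R and the other s yields
  -- integrability.
  obtain ⟨A, h, hA, H⟩ := exists_norm_bargmann_mul_gsExp_le d hs (r + s + s)
  set c := gconst d * (‖(phi : L2 d)‖ ^ 2 : ℝ) with hc
  have hc0 : c ≠ 0 := mul_ne_zero gconst_ne_zero (by exact_mod_cast norm_phi_sq_pos.ne')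
  set J := ∫ z : Phase d, gsExp s (-s) z
  have hJ : 0 ≤ J := integral_nonneg fun z => (gsExp_pos s _ z).le
  set D : ℝ := 2 ^ 1 * (1 + (1 ! : ℝ) ^ s)
  have hD : 0 ≤ D := by positivity
  refine ⟨‖c⁻¹‖ * (B * (D * A * J)), h, by positivity, fun R hR => ?_⟩
  obtain ⟨v, hv⟩ := exists_pairing_eq_cut hs u R
  refine ⟨c⁻¹ • v, fun g => ?_⟩
  have hr1 : IsRapid s (cut R (bargmann g)) :=
    isRapid_cut hs0 R (continuous_bargmann g).locallyIntegrable
  have hr0 := isRapid_bargmann hs g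
  have hle : ∀ z, ‖bargmann g z - cut R (bargmann g) z‖ ≤ ‖bargmann g z‖ := fun z => by
    simp only [cut, Set.indicator]
    split_ifs <;> simp
  have hr2 : IsRapid s (fun z => bargmann g z - cut R (bargmann g) z) := by
    refine ⟨hr0.1.sub hr1.1, fun t => (hr0.2 t).mono' ((hr0.1.sub hr1.1).norm.mul
      (continuous_gsExp hs0 t).aestronglyMeasurable) (Filter.Eventually.of_forall fun z => ?_)⟩
    have := gsExp_pos s t z
    rw [Real.norm_of_nonneg (by positivity)]
    gcongr
    exact hle z
  obtain ⟨f1, hf1⟩ := hr1.exists_isSynth hs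
  obtain ⟨f2, hf2⟩ := hr2.exists_isSynth hs
  have hf : c • g = f1 + f2 := by
    refine (isSynth_bargmann hs g).unique ((hf1.add hf2 hr1 hr2).congr
      (Filter.Eventually.of_forall fun z => ?_))
    simp only
    ring
  have hg : u g - pairing (c⁻¹ • v) g = c⁻¹ * u f2 := by
    have e1 : pairing (c⁻¹ • v) g = c⁻¹ * pairing v g := by
      rw [pairing_eq_inner, pairing_eq_inner, toL2_smul, star_smul_L2, inner_smul_left,
        Complex.conj_conj]
    have e2 : u g = c⁻¹ * u (c • g) := by
      rw [map_smul, smul_eq_mul, inv_mul_cancel_left₀ hc0]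
    rw [e1, e2, hf, map_add, hv g f1 hf1]
    ring
  have hb : ∀ z, ‖bargmann g z - cut R (bargmann g) z‖ * gsExp s r z ≤
      D / R * (A * gsSeminorm s d h g) * gsExp s (-s) z := fun z => by
    have hp : 0 ≤ gsSeminorm s d h g := apply_nonneg _ _
    have hn := (gsExp_pos s (-s) z).le
    by_cases hz : z ∈ Metric.closedBall (0 : Phase d) R
    · simp only [cut, Set.indicator_of_mem hz, sub_self, norm_zero, zero_mul]
      positivity
    · rw [mem_closedBall_zero_iff, not_le] at hz
      -- Outside the ball, R < ‖z‖ ≤ D exp(s‖z‖^{1/s}).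
      have h1 : 1 ≤ D / R * gsExp s s z := by
        have := one_add_norm_pow_le_gsExp hs0 1 z
        rw [pow_one] at this
        rw [div_mul_eq_mul_div, le_div_iff₀ hR]
        linarith
      have e : gsExp s r z * gsExp s s z = gsExp s (r + s + s) z * gsExp s (-s) z := by
        rw [← gsExp_add, ← gsExp_add]; congr 1; ring
      have hr := (gsExp_pos s r z).le
      calc _ ≤ ‖bargmann g z‖ * gsExp s r z * 1 := by
            rw [mul_one]; gcongr; exact hle z
        _ ≤ ‖bargmann g z‖ * gsExp s r z * (D / R * gsExp s s z) := by gcongr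
        _ = D / R * (‖bargmann g z‖ * gsExp s (r + s + s) z) * gsExp s (-s) z := by
          linear_combination (D / R * ‖bargmann g z‖) * e
        _ ≤ _ := by
          exact mul_le_mul_of_nonneg_right
            (mul_le_mul_of_nonneg_left (H g z) (by positivity)) hn
  rw [hg, norm_mul]
  calc _ ≤ ‖c⁻¹‖ * (B * ∫ z, D / R * (A * gsSeminorm s d h g) * gsExp s (-s) z) := by
        gcongr
        exact (hu _ f2 hr2 hf2).trans (mul_le_mul_of_nonneg_left
          (integral_mono (hr2.2 r) ((integrable_gsExp_neg hs0).const_mul _) hb) hB)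
    _ = _ := by
        rw [integral_const_mul]
        ring

/-- The range of `Σ_s` is dense in the strong dual. -/
theorem denseRange_toDist (hs : 1 / 2 < s) :
    DenseRange (toDist : GelfandShilov s d → GSDist s d) := by
  intro u
  obtain ⟨C, h, hC, H⟩ := exists_norm_sub_pairing_le hs u
  choose v hv using fun n : ℕ => H (n + 1) (by positivity)
  refine mem_closure_of_tendsto (f := fun n => toDist (v n)) (b := Filter.atTop) ?_
    (Filter.Eventually.of_forall fun n => Set.mem_range_self _)
  rw [← tendsto_sub_nhds_zero_iff]
  refine (ContinuousLinearMap.hasBasis_nhds_zero_of_basis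
    (Metric.nhds_basis_ball (x := (0 : ℂ)))).tendsto_right_iff.2 ?_
  rintro ⟨S, ε⟩ ⟨hS, hε⟩
  -- A bounded set is bounded for the single seminorm in the error estimate, so the convergence is
  -- uniform on it.
  obtain ⟨b, hb, hSb⟩ := (withSeminorms_gsSeminorm s d).isVonNBounded_iff_seminorm_bounded.1 hS h
  have hlim : Filter.Tendsto (fun n : ℕ => C / ((n : ℝ) + 1) * b) Filter.atTop (nhds 0) := by
    have := (tendsto_const_div_atTop_nhds_zero_nat C).comp (Filter.tendsto_add_atTop_nat 1)
    have := this.mul_const b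
    simpa [Function.comp_def] using this
  filter_upwards [hlim.eventually (gt_mem_nhds hε)] with n hn g hg
  rw [mem_ball_zero_iff]
  change ‖pairing (v n) g - u g‖ < ε
  rw [norm_sub_rev]
  refine (hv n g).trans_lt (lt_of_le_of_lt ?_ hn)
  have := (hSb g hg).le
  gcongr

/-- The range of `Σ_s` is dense in the dual with the weak-* topology. -/
theorem denseRange_toDistWeak (hs : 1 / 2 < s) :
    DenseRange (toDistWeak : GelfandShilov s d → GSDistWeak s d) := by
  have hsurj : Function.Surjective (ContinuousLinearMap.toPointwiseConvergenceCLM ℂ (RingHom.id ℂ)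
      (GelfandShilov s d) ℂ) := fun u => ⟨u, rfl⟩
  -- The identity from the strong to the weak-* dual is continuous and surjective, so density
  -- carries over.
  exact hsurj.denseRange.comp (denseRange_toDist hs) (ContinuousLinearMap.continuous _)

end

end Metaplectic

theorem proposition4p4 (d : ℕ) (s : ℝ) (hs : 1 / 2 < s)
    (χ : Matrix.symplecticGroup (Fin d) ℝ) :
    (∃ U : Metaplectic.L2 d ≃ₗᵢ[ℂ] Metaplectic.L2 d, Metaplectic.IsMetaplectic χ U) ∧
    ∀ U : Metaplectic.L2 d ≃ₗᵢ[ℂ] Metaplectic.L2 d, Metaplectic.IsMetaplectic χ U →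
      ∃ T : Metaplectic.GelfandShilov s d →L[ℂ] Metaplectic.GelfandShilov s d,
        (∀ f, (T f).toL2 = U f.toL2) ∧
        (∃! S : Metaplectic.GSDist s d →L[ℂ] Metaplectic.GSDist s d,
          ∀ f, S (Metaplectic.toDist f) = Metaplectic.toDist (T f)) ∧
        (∃! S : Metaplectic.GSDistWeak s d →L[ℂ] Metaplectic.GSDistWeak s d,
          ∀ f, S (Metaplectic.toDistWeak f) = Metaplectic.toDistWeak (T f)) := by
  refine ⟨Metaplectic.exists_isMetaplectic χ, fun U hU => ?_⟩
  obtain ⟨T, hT⟩ := hU.intertwines.exists_continuousLinearMap hs (Metaplectic.measurePreserving_phaseEquiv χ)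
  obtain ⟨T', hT'⟩ := hU.intertwines.exists_pairing_eq hs (Metaplectic.measurePreserving_phaseEquiv χ) hT
  -- The extension is u ↦ u ∘ T' with T' the transpose of T; precomposition is continuous in both
  -- topologies.
  refine ⟨T, hT, ⟨T'.precomp ℂ, fun f => ?_, fun S hS => ?_⟩,
    ⟨PointwiseConvergenceCLM.precomp ℂ T', fun f => ?_, fun S hS => ?_⟩⟩
  · exact ContinuousLinearMap.ext fun g => (hT' f g).symm
  -- Two continuous operators that agree on the dense image of Σ_s coincide.
  · refine ContinuousLinearMap.ext fun u => congrFun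
      ((Metaplectic.denseRange_toDist hs).equalizer S.continuous (T'.precomp ℂ).continuous
        (funext fun f => (hS f).trans ?_)) u
    exact ContinuousLinearMap.ext fun g => hT' f g
  · exact ContinuousLinearMap.ext fun g => (hT' f g).symm
  · refine ContinuousLinearMap.ext fun u => congrFun
      ((Metaplectic.denseRange_toDistWeak hs).equalizer S.continuous
        (PointwiseConvergenceCLM.precomp ℂ T').continuous (funext fun f => (hS f).trans ?_)) u
    exact ContinuousLinearMap.ext fun g => hT' f g
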